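/- Theorem. The single-target change-making problem can be solved deterministically in $O(u\log^3 u)$ time on a word RAM, where $u$ is the largest coin value. Precisely: for a finite nonempty set $V$ of positive integers (the coin values) and an integer $t\ge 0$ (the target), let $u=\max V$ and let $D_V(t)\in\mathbb{N}\cup\{\infty\}$ be the smallest cardinality of a multiset of elements of $V$ with sum exactly $t$ ($\infty$ if there is none). There are a fixed word-RAM program $P$ and constants $c, C$, independent of $V$ and $t$, such that for all such $V$ and $t$, every listing $v_1,\dots,v_n$ of the distinct elements of $V$, and every word length $w\ge c\,\lfloor\log_2(u+t+2)\rfloor$, the program $P$, started with $n,t,v_1,\dots,v_n$ in memory, halts after at most $C\,u\log^3(u+1)$ unit-cost operations on $w$-bit words, without overflow, and outputs $D_V(t)$. (Here $\log(u+1)$ in place of $\log u$ matters only for $u=1$. The unit-cost operations are reading a constant or a register, indirect memory access, truncated subtraction, addition, multiplication, division, remainder, comparison, assignment, and branching.) -/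

import Mathlib

/-! The change-making problem. -/

/-- The minimum number of coins from `V` (each usable any number of times) that sum to
exactly `t`; it is `⊤` if there is no multiset of coins with sum `t`. -/
noncomputable def minCoins (V : Finset ℕ) (t : ℕ) : ℕ∞ :=
  ⨅ S ∈ {S : Multiset ℕ | (∀ s ∈ S, s ∈ V) ∧ S.sum = t}, (Multiset.card S : ℕ∞)

/-! A deterministic word RAM with word length `w`, programmed in structured form. -/

namespace WordRAM

/-- A state: registers, which are addressed by constants of the program, and a memory, which is
addressed by computed values. -/
structure State where
  reg : ℕ → ℕ
  mem : ℕ → ℕ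

/-- The binary word operations. -/
inductive Op where
  | add
  | sub
  | mul
  | div
  | mod
  | lt
  | eq

/-- Subtraction is truncated at `0`, division rounds down (with `x / 0 = 0` and `x % 0 = x`),
comparisons return `1` or `0`. -/
def Op.apply : Op → ℕ → ℕ → ℕ
  | .add, x, y => x + y
  | .sub, x, y => x - y
  | .mul, x, y => x * y
  | .div, x, y => x / y
  | .mod, x, y => x % y
  | .lt, x, y => if x < y then 1 else 0
  | .eq, x, y => if x = y then 1 else 0

/-- Expressions: constants, register contents, contents of the memory cell at a computed address,
and word operations. -/
inductive Expr where
  | const (k : ℕ)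
  | reg (i : ℕ)
  | load (a : Expr)
  | op (o : Op) (a b : Expr)

/-- The value `x` as a word of length `w`; undefined if `x` does not fit. -/
def word (w x : ℕ) : Option ℕ :=
  if x < 2 ^ w then some x else none

/-- The value of an expression. It is undefined if some constant or intermediate result does
not fit into a word of length `w`. -/
def Expr.eval (w : ℕ) (σ : State) : Expr → Option ℕ
  | .const k => word w k
  | .reg i => word w (σ.reg i)
  | .load a => (a.eval w σ).bind fun x => word w (σ.mem x)
  | .op o a b => (a.eval w σ).bind fun x => (b.eval w σ).bind fun y => word w (o.apply x y)

/-- The time for evaluating an expression: one unit for each constant, register access, memory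
access and word operation. -/
def Expr.cost : Expr → ℕ
  | .const _ => 1
  | .reg _ => 1
  | .load a => a.cost + 1
  | .op _ a b => a.cost + b.cost + 1

/-- Programs. `set i e` writes the value of `e` into register `i`, `store a e` writes the value of
`e` into the memory cell whose address is the value of `a`, `ite e p q` and `loop e p` branch and
iterate according to whether the value of `e` is nonzero. -/
inductive Prog where
  | nop
  | set (i : ℕ) (e : Expr)
  | store (a e : Expr)
  | seq (p q : Prog)
  | ite (e : Expr) (p q : Prog)
  | loop (e : Expr) (p : Prog)

/-- `Exec w p σ k τ`: with word length `w`, the program `p` started in the state `σ` terminates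
after exactly `k` time units in the state `τ`. An evaluation that is undefined (overflow) blocks
the execution, so that such a run never terminates. -/
inductive Exec (w : ℕ) : Prog → State → ℕ → State → Prop where
  | nop (σ : State) : Exec w .nop σ 1 σ
  | set {i : ℕ} {e : Expr} {σ : State} {x : ℕ} (he : e.eval w σ = some x) :
      Exec w (.set i e) σ (e.cost + 1) { σ with reg := Function.update σ.reg i x }
  | store {a e : Expr} {σ : State} {x y : ℕ}
      (ha : a.eval w σ = some x) (he : e.eval w σ = some y) :
      Exec w (.store a e) σ (a.cost + e.cost + 1) { σ with mem := Function.update σ.mem x y }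
  | seq {p q : Prog} {σ τ υ : State} {k l : ℕ}
      (hp : Exec w p σ k τ) (hq : Exec w q τ l υ) : Exec w (.seq p q) σ (k + l) υ
  | ite_true {e : Expr} {p q : Prog} {σ τ : State} {x k : ℕ}
      (he : e.eval w σ = some x) (hx : x ≠ 0) (hp : Exec w p σ k τ) :
      Exec w (.ite e p q) σ (e.cost + 1 + k) τ
  | ite_false {e : Expr} {p q : Prog} {σ τ : State} {k : ℕ}
      (he : e.eval w σ = some 0) (hq : Exec w q σ k τ) :
      Exec w (.ite e p q) σ (e.cost + 1 + k) τ
  | loop_true {e : Expr} {p : Prog} {σ τ υ : State} {x k l : ℕ}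
      (he : e.eval w σ = some x) (hx : x ≠ 0) (hp : Exec w p σ k τ)
      (hl : Exec w (.loop e p) τ l υ) : Exec w (.loop e p) σ (e.cost + 1 + k + l) υ
  | loop_false {e : Expr} {p : Prog} {σ : State} (he : e.eval w σ = some 0) :
      Exec w (.loop e p) σ (e.cost + 1) σ

/-- The initial state on the coin values `v = [v₁, …, vₙ]` and the target `t`: the memory holds
`n, t, v₁, …, vₙ` in the cells `0, 1, 2, …, n + 1`; everything else is `0`. -/
def input (v : List ℕ) (t : ℕ) : State where
  reg := fun _ => 0
  mem := fun a => (v.length :: t :: v).getD a 0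

/-- The output, read off from two registers: `⊤` (no solution) if register `0` holds `0`, and
otherwise the number in register `1`. -/
def output (σ : State) : ℕ∞ :=
  if σ.reg 0 = 0 then ⊤ else (σ.reg 1 : ℕ∞)

end WordRAM

/-! Two facts about coins carry the algorithm. First, among any `u` coins some nonempty subfamily
has a sum divisible by `u` (pigeonhole on prefix sums), and replacing it by copies of the largest
coin `u` does not increase the number of coins (`exists_few_smaller_coins`). So some optimal
solution has fewer than `u` coins different from `u`, of total less than `u * u`. A large target
therefore forces copies of `u`: `k = (t - u * u) / u` of them can be stripped off
(`feasible_add_mul_iff`), and what remains is below `u * u + u` and, if reachable at all, needs at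
most `2 * u` coins (`Feasible.le_two_mul`).

Second, a multiset of coins splits into two halves of almost equal cardinality whose sums differ by
at most `u` (`exists_balanced_split`). To decide whether at most `m` coins reach `t`, it is thus
enough to know which sums near `t / 2` are reached by `m / 2` coins, and so on down to the empty
multiset. The relevant sums at level `i` stay within `2 * u` of `t / 2 ^ i`, because halving
reproduces this radius. Passing from level `i + 1` to level `i` means finding the support of `p * p
* q`, where `p` is the indicator polynomial of a window and `q` that of the optional extra coin
(`window_succ_iff`). The degree is at most `9 * u`, so transforms of length `N = 2 ^ L` with `9 * u
< N ≤ 18 * u` suffice. A transform costs `O(N L)`, a decision takes `L` levels, and binary search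
for the number of coins takes `L` decisions: `O(N L ^ 3)` in all.

The transforms have to be carried out on integer words. Complex numbers become Gaussian integers
scaled by `S = N ^ 12`, and the twiddle factors come from the half-angle formulas with integer
square roots. The final errors are at most `S / 4` (`invApx_close`), while the exact results are `S
* N` times natural numbers, so a threshold separates zero from nonzero coefficients
(`coeff_ne_zero_iff_re_invApx`). A Gaussian integer `x + y * i` is kept in a single word as the
residue of `x + y * I` modulo `I ^ 2 + 1` with `I = N ^ 32`. There `I` is a square root of `-1`, so
ring operations are word operations followed by a remainder; rounding and conjugation first recover
the two coordinates, which is possible as long as they are below `I / 2` in absolute value.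

The program is verified in a logic of total correctness with time bounds (`Runs`). Every loop has an
iteration count known in advance, and the absence of overflow is part of the evaluation of each
expression. -/

namespace WordRAM

/-! ### A program logic with time bounds -/

/-- From `σ`, the program `p` terminates within `K` time units in a state that satisfies `Q`. -/
def Runs (w : ℕ) (p : Prog) (σ : State) (K : ℕ) (Q : State → Prop) : Prop :=
  ∃ k τ, Exec w p σ k τ ∧ k ≤ K ∧ Q τ

section Runs

variable {w : ℕ} {p q : Prog} {e a : Expr} {σ : State} {K K' x y i : ℕ} {Q Q' : State → Prop}

theorem Runs.mono (h : Runs w p σ K Q) (hK : K ≤ K') (hQ : ∀ τ, Q τ → Q' τ) :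
    Runs w p σ K' Q' := by
  obtain ⟨k, τ, h1, h2, h3⟩ := h
  exact ⟨k, τ, h1, h2.trans hK, hQ τ h3⟩

theorem Runs.seq (hp : Runs w p σ K Q) (hq : ∀ τ, Q τ → Runs w q τ K' Q') :
    Runs w (.seq p q) σ (K + K') Q' := by
  obtain ⟨k, τ, h1, h2, h3⟩ := hp
  obtain ⟨k', τ', h1', h2', h3'⟩ := hq τ h3
  exact ⟨_, _, .seq h1 h1', by omega, h3'⟩

theorem Runs.set (he : e.eval w σ = some x)
    (hQ : Q { σ with reg := Function.update σ.reg i x }) :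
    Runs w (.set i e) σ (e.cost + 1) Q :=
  ⟨_, _, .set he, le_rfl, hQ⟩

theorem Runs.store (ha : a.eval w σ = some x) (he : e.eval w σ = some y)
    (hQ : Q { σ with mem := Function.update σ.mem x y }) :
    Runs w (.store a e) σ (a.cost + e.cost + 1) Q :=
  ⟨_, _, .store ha he, le_rfl, hQ⟩

/-- A loop whose number `n` of iterations is known beforehand. -/
theorem Runs.loop (Inv : ℕ → State → Prop) (n c : ℕ) (h0 : Inv 0 σ)
    (hstep : ∀ i < n, ∀ σ, Inv i σ →
      (∃ x, e.eval w σ = some x ∧ x ≠ 0) ∧ Runs w p σ c (Inv (i + 1)))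
    (hend : ∀ σ, Inv n σ → e.eval w σ = some 0) :
    Runs w (.loop e p) σ (n * (c + e.cost + 1) + (e.cost + 1)) (Inv n) := by
  suffices H : ∀ d i σ, i + d = n → Inv i σ →
      Runs w (.loop e p) σ (d * (c + e.cost + 1) + (e.cost + 1)) (Inv n) from
    H n 0 σ (by omega) h0
  intro d
  induction d with
  | zero =>
    intro i σ hi hInv
    obtain rfl : i = n := by omega
    exact ⟨_, _, .loop_false (hend σ hInv), by omega, hInv⟩
  | succ d ih =>
    intro i σ hi hInv
    obtain ⟨⟨x, hx, hx0⟩, k, τ, hk, hkc, hτ⟩ := hstep i (by omega) σ hInv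
    obtain ⟨l, υ, hl, hlc, hυ⟩ := ih (i + 1) τ (by omega) hτ
    refine ⟨_, _, .loop_true hx hx0 hk hl, ?_, hυ⟩
    rw [Nat.succ_mul]
    omega

end Runs

/-! ### Evaluation of expressions -/

section Eval

variable {w : ℕ} {σ : State} {a b c : Expr} {x y z : ℕ}

theorem word_eq_some (h : x < 2 ^ w) : word w x = some x := if_pos h

theorem lt_of_word (h : word w x = some y) : y < 2 ^ w := by
  unfold word at h
  split_ifs at h with hx
  exact (Option.some.inj h) ▸ hx

theorem Expr.eval_lt : ∀ {a : Expr} {x : ℕ}, a.eval w σ = some x → x < 2 ^ w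
  | .const k, x, h => lt_of_word h
  | .reg i, x, h => lt_of_word h
  | .load a, x, h => by
    obtain ⟨y, -, hy⟩ := Option.bind_eq_some_iff.1 h
    exact lt_of_word hy
  | .op o a b, x, h => by
    obtain ⟨y, -, hy⟩ := Option.bind_eq_some_iff.1 h
    obtain ⟨z, -, hz⟩ := Option.bind_eq_some_iff.1 hy
    exact lt_of_word hz

theorem eval_const (h : x < 2 ^ w) : (Expr.const x).eval w σ = some x := word_eq_some h

theorem eval_reg {i : ℕ} (hi : σ.reg i = x) (h : x < 2 ^ w) : (Expr.reg i).eval w σ = some x := by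
  subst hi
  exact word_eq_some h

theorem eval_load (ha : a.eval w σ = some x) (hx : σ.mem x = y) (h : y < 2 ^ w) :
    (Expr.load a).eval w σ = some y := by
  subst hx
  simp [Expr.eval, ha, word_eq_some h]

theorem eval_op {o : Op} (ha : a.eval w σ = some x) (hb : b.eval w σ = some y)
    (h : o.apply x y < 2 ^ w) : (Expr.op o a b).eval w σ = some (o.apply x y) := by
  simp [Expr.eval, ha, hb, word_eq_some h]

theorem eval_add (ha : a.eval w σ = some x) (hb : b.eval w σ = some y) (h : x + y < 2 ^ w) :
    (Expr.op .add a b).eval w σ = some (x + y) := eval_op ha hb h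

theorem eval_mul (ha : a.eval w σ = some x) (hb : b.eval w σ = some y) (h : x * y < 2 ^ w) :
    (Expr.op .mul a b).eval w σ = some (x * y) := eval_op ha hb h

/-- Truncated subtraction, and likewise division and remainder below, never exceeds its first
operand, which already fits into a word; hence no overflow hypothesis. -/
theorem eval_sub (ha : a.eval w σ = some x) (hb : b.eval w σ = some y) :
    (Expr.op .sub a b).eval w σ = some (x - y) :=
  eval_op ha hb ((Nat.sub_le x y).trans_lt (Expr.eval_lt ha))

theorem eval_div (ha : a.eval w σ = some x) (hb : b.eval w σ = some y) :
    (Expr.op .div a b).eval w σ = some (x / y) :=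
  eval_op ha hb ((Nat.div_le_self x y).trans_lt (Expr.eval_lt ha))

theorem eval_mod (ha : a.eval w σ = some x) (hb : b.eval w σ = some y) :
    (Expr.op .mod a b).eval w σ = some (x % y) :=
  eval_op ha hb ((Nat.mod_le x y).trans_lt (Expr.eval_lt ha))

theorem one_lt_two_pow_of_lt (hx : 0 < w) (p : Prop) [Decidable p] :
    (if p then 1 else 0) < 2 ^ w := by
  have : 1 < 2 ^ w := Nat.one_lt_two_pow hx.ne'
  split_ifs <;> omega

theorem eval_lt (hw : 0 < w) (ha : a.eval w σ = some x) (hb : b.eval w σ = some y) :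
    (Expr.op .lt a b).eval w σ = some (if x < y then 1 else 0) :=
  eval_op ha hb (one_lt_two_pow_of_lt hw _)

theorem eval_eq (hw : 0 < w) (ha : a.eval w σ = some x) (hb : b.eval w σ = some y) :
    (Expr.op .eq a b).eval w σ = some (if x = y then 1 else 0) :=
  eval_op ha hb (one_lt_two_pow_of_lt hw _)

/-- `c * a + (1 - c) * b`, which selects `a` or `b` according to a Boolean value `c`. -/
def Expr.select (c a b : Expr) : Expr :=
  .op .add (.op .mul c a) (.op .mul (.op .sub (.const 1) c) b)

theorem eval_select (hw : 0 < w) (p : Prop) [Decidable p]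
    (hc : c.eval w σ = some (if p then 1 else 0))
    (ha : a.eval w σ = some x) (hb : b.eval w σ = some y) :
    (Expr.select c a b).eval w σ = some (if p then x else y) := by
  have hx := Expr.eval_lt ha
  have hy := Expr.eval_lt hb
  have h1 : (1 : ℕ) < 2 ^ w := Nat.one_lt_two_pow hw.ne'
  unfold Expr.select
  by_cases hp : p
  · simp only [hp, if_true] at hc ⊢
    have := eval_add (eval_mul hc ha (by omega))
      (eval_mul (eval_sub (eval_const h1) hc) hb (by simp)) (by simpa using hx)
    simpa using this
  · simp only [hp, if_false] at hc ⊢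
    have := eval_add (eval_mul hc ha (by simp))
      (eval_mul (eval_sub (eval_const h1) hc) hb (by simpa using hy)) (by simpa using hy)
    simpa using this

end Eval

/-! ### Filling an array

The memory is divided into arrays of length `N`, where `N` is held in register `20`; the array
with index `k` occupies the cells `k * N, …, k * N + N - 1`. -/

/-- The cell of the array with index `k` at the computed position `e`. -/
def Expr.cell (k : ℕ) (e : Expr) : Expr := .load (.op .add (.op .mul (.const k) (.reg 20)) e)

/-- Write into each cell of the array with index `k` the value of the expression `e`, in which
register `2` holds the position. -/
def Prog.fill (k : ℕ) (e : Expr) : Prog :=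
  .seq (.set 2 (.const 0))
    (.loop (.op .lt (.reg 2) (.reg 20))
      (.seq (.store (.op .add (.op .mul (.const k) (.reg 20)) (.reg 2)) e)
        (.set 2 (.op .add (.reg 2) (.const 1)))))

section Fill

variable {w N k : ℕ} {σ : State} {e : Expr}

theorem eval_cell {x y : ℕ} (hN : σ.reg 20 = N) (hw : (k + 1) * N < 2 ^ w) (hN0 : 0 < N)
    (he : e.eval w σ = some x) (hx : x < N) (hy : σ.mem (k * N + x) = y) (hyw : y < 2 ^ w) :
    (Expr.cell k e).eval w σ = some y := by
  have h1 : k * N + N < 2 ^ w := by rwa [Nat.succ_mul] at hw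
  have h2 : k ≤ k * N := Nat.le_mul_of_pos_right k hN0
  exact eval_load (eval_add (eval_mul (eval_const (by omega)) (eval_reg hN (by omega)) (by omega))
    he (by omega)) hy hyw

/-- When entry `j` is computed, only the earlier entries of the array have been overwritten. The
hypothesis on `e` records this, so that `e` may still read the old entry `j` and pointwise updates
can be done in place. -/
theorem runs_fill (f : ℕ → ℕ) (hN : σ.reg 20 = N) (hw : (k + 1) * N + 1 < 2 ^ w) (hN0 : 0 < N)
    (he : ∀ j < N, ∀ σ' : State, σ'.reg 2 = j → (∀ r, r ≠ 2 → σ'.reg r = σ.reg r) →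
      (∀ a, a < k * N ∨ k * N + j ≤ a → σ'.mem a = σ.mem a) → e.eval w σ' = some (f j)) :
    Runs w (.fill k e) σ (N * (e.cost + 20) + 20) fun τ =>
      (∀ r, r ≠ 2 → τ.reg r = σ.reg r) ∧ (∀ j < N, τ.mem (k * N + j) = f j) ∧
      ∀ a, a < k * N ∨ (k + 1) * N ≤ a → τ.mem a = σ.mem a := by
  have h1 : k * N + N + 1 < 2 ^ w := by rwa [Nat.succ_mul] at hw
  have h2 : k ≤ k * N := Nat.le_mul_of_pos_right k hN0
  have hw0 : 0 < w := by
    rcases Nat.eq_zero_or_pos w with rfl | h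
    · simp at h1
    · exact h
  have hk : (k + 1) * N = k * N + N := Nat.succ_mul k N
  unfold Prog.fill
  refine Runs.mono (Runs.seq (Q := fun τ => (∀ r, r ≠ 2 → τ.reg r = σ.reg r) ∧ τ.reg 2 = 0 ∧
    τ.mem = σ.mem) (Runs.set (eval_const (by omega)) ?_) fun σ₀ hσ₀ =>
    Runs.loop (fun i τ => (∀ r, r ≠ 2 → τ.reg r = σ.reg r) ∧ τ.reg 2 = i ∧
      (∀ j < i, τ.mem (k * N + j) = f j) ∧
      ∀ a, a < k * N ∨ k * N + i ≤ a → τ.mem a = σ.mem a) N (e.cost + 10)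
      ⟨hσ₀.1, hσ₀.2.1, by simp, fun a _ => by rw [hσ₀.2.2]⟩ ?_ ?_) ?_ ?_
  · refine ⟨fun r hr => ?_, ?_, rfl⟩ <;> simp [*]
  · rintro i hi τ ⟨hr, h2i, hf, ha⟩
    have hNτ : τ.reg 20 = N := by rw [hr 20 (by decide), hN]
    refine ⟨⟨1, ?_, one_ne_zero⟩, ?_⟩
    · have := eval_lt hw0 (eval_reg (w := w) h2i (by omega)) (eval_reg (w := w) hNτ (by omega))
      simpa [hi] using this
    · refine Runs.mono (Runs.seq (Q := fun υ => υ.reg = τ.reg ∧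
        υ.mem = Function.update τ.mem (k * N + i) (f i))
        (Runs.store (eval_add (eval_mul (eval_const (by omega)) (eval_reg hNτ (by omega))
          (by omega)) (eval_reg h2i (by omega)) (by omega)) (he i hi τ h2i hr ha) ⟨rfl, rfl⟩)
        fun υ hυ => Runs.set (eval_add (eval_reg (by rw [hυ.1, h2i]) (by omega))
          (eval_const (by omega)) (by omega)) ?_) ?_ (fun _ h => h)
      · refine ⟨fun r hr2 => ?_, by simp, fun j hj => ?_, fun a haa => ?_⟩
        · simp [hr2, hυ.1, hr r hr2]
        · simp only [hυ.2, Function.update_apply]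
          split_ifs with h
          · congr 1; omega
          · exact hf j (by omega)
        · simp only [hυ.2, Function.update_apply]
          rw [if_neg (by omega)]
          exact ha a (by omega)
      · simp [Expr.cost]; omega
  · rintro τ ⟨hr, h2i, hf, ha⟩
    have hNτ : τ.reg 20 = N := by rw [hr 20 (by decide), hN]
    have := eval_lt hw0 (eval_reg (w := w) h2i (by omega)) (eval_reg (w := w) hNτ (by omega))
    simpa using this
  · simp only [Expr.cost]
    have : N * (e.cost + 10 + (1 + 1 + 1) + 1) ≤ N * (e.cost + 20) :=
      Nat.mul_le_mul_left _ (by omega)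
    omega
  · rintro τ ⟨hr, h2i, hf, ha⟩
    exact ⟨hr, hf, fun a h => ha a (by omega)⟩

end Fill

end WordRAM

/-! ### Sums of boundedly many coins -/

/-- `s` is the sum of at most `m` coins from `V`. -/
def Feasible (V : Finset ℕ) (m s : ℕ) : Prop :=
  ∃ S : Multiset ℕ, (∀ x ∈ S, x ∈ V) ∧ S.sum = s ∧ Multiset.card S ≤ m

section Feasible

variable {V : Finset ℕ} {u : ℕ}

theorem Feasible.mono {m m' s : ℕ} (h : Feasible V m s) (hm : m ≤ m') : Feasible V m' s := by
  obtain ⟨S, h1, h2, h3⟩ := h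
  exact ⟨S, h1, h2, h3.trans hm⟩

theorem Feasible.add {m m' s s' : ℕ} (h : Feasible V m s) (h' : Feasible V m' s') :
    Feasible V (m + m') (s + s') := by
  obtain ⟨S, h1, h2, h3⟩ := h
  obtain ⟨S', h1', h2', h3'⟩ := h'
  refine ⟨S + S', fun x hx => ?_, by simp [h2, h2'], by simp; omega⟩
  rcases Multiset.mem_add.1 hx with hx | hx
  exacts [h1 x hx, h1' x hx]

theorem feasible_one_of_mem {a : ℕ} (ha : a ∈ V) : Feasible V 1 a :=
  ⟨{a}, by simpa using ha, by simp, by simp⟩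

theorem feasible_zero (m : ℕ) : Feasible V m 0 := ⟨0, by simp, by simp, by simp⟩

theorem feasible_zero_left_iff {s : ℕ} : Feasible V 0 s ↔ s = 0 := by
  constructor
  · rintro ⟨S, -, h2, h3⟩
    obtain rfl : S = 0 := Multiset.card_eq_zero.1 (Nat.le_zero.1 h3)
    simpa using h2.symm
  · rintro rfl
    exact feasible_zero 0

/-- A multiset of numbers that are at most `u` splits into halves whose sums differ by at most
`u`. -/
theorem exists_balanced_split (n : ℕ) : ∀ S : Multiset ℕ, Multiset.card S = n →
    (∀ x ∈ S, x ≤ u) → ∃ A B : Multiset ℕ, S = A + B ∧ Multiset.card A ≤ (n + 1) / 2 ∧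
      Multiset.card B ≤ (n + 1) / 2 ∧ A.sum ≤ B.sum + u ∧ B.sum ≤ A.sum + u := by
  induction n using Nat.strong_induction_on with
  | _ n ih =>
    intro S hS hu
    rcases S.empty_or_exists_mem with rfl | ⟨x, hx⟩
    · exact ⟨0, 0, by simp⟩
    obtain ⟨T, rfl⟩ := Multiset.exists_cons_of_mem hx
    rcases T.empty_or_exists_mem with rfl | ⟨y, hy⟩
    · have := hu x (by simp)
      have hn : n = 1 := by simpa using hS.symm
      exact ⟨{x}, 0, by simp, by simp [hn], by simp, by simpa using this, by simp⟩
    obtain ⟨T, rfl⟩ := Multiset.exists_cons_of_mem hy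
    simp only [Multiset.card_cons] at hS
    obtain ⟨A, B, rfl, hA, hB, hAB, hBA⟩ := ih (n - 2) (by omega) T (by omega)
      fun z hz => hu z (by simp [hz])
    have hxu := hu x (by simp)
    have hyu := hu y (by simp)
    have key : ∀ a b : ℕ, a ::ₘ b ::ₘ (A + B) = x ::ₘ y ::ₘ (A + B) →
        a + A.sum ≤ b + B.sum + u → b + B.sum ≤ a + A.sum + u →
        ∃ A' B' : Multiset ℕ, x ::ₘ y ::ₘ (A + B) = A' + B' ∧ Multiset.card A' ≤ (n + 1) / 2 ∧
          Multiset.card B' ≤ (n + 1) / 2 ∧ A'.sum ≤ B'.sum + u ∧ B'.sum ≤ A'.sum + u := by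
      intro a b h h1 h2
      refine ⟨a ::ₘ A, b ::ₘ B, ?_, ?_, ?_, by simpa using h1, by simpa using h2⟩
      · rw [← h, Multiset.cons_add, Multiset.add_cons]
      · simp; omega
      · simp; omega
    -- The larger of the two new coins goes to the half with the smaller sum, so the difference of
    -- the sums stays within `u`.
    by_cases hxy : (x ≤ y ↔ B.sum ≤ A.sum)
    · exact key x y rfl (by omega) (by omega)
    · exact key y x (Multiset.cons_swap _ _ _) (by omega) (by omega)

/-- If more than `2 * k` coins are used, then `β = 1` and one coin `a` is set aside; the remaining
coins are at most `2 * k` and are split in balance. Otherwise nothing is set aside and `a = 0`. -/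
theorem Feasible.exists_split (hV : ∀ x ∈ V, x ≤ u) {k β s : ℕ} (hβ : β < 2)
    (h : Feasible V (2 * k + β) s) : ∃ s₁ s₂ a, s = s₁ + s₂ + a ∧ Feasible V k s₁ ∧
      Feasible V k s₂ ∧ (a = 0 ∨ β = 1 ∧ a ∈ V) ∧ s₁ ≤ s₂ + u ∧ s₂ ≤ s₁ + u := by
  have even : ∀ S : Multiset ℕ, (∀ x ∈ S, x ∈ V) → Multiset.card S ≤ 2 * k →
      ∃ s₁ s₂, S.sum = s₁ + s₂ ∧ Feasible V k s₁ ∧ Feasible V k s₂ ∧ s₁ ≤ s₂ + u ∧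
        s₂ ≤ s₁ + u := by
    intro S hS hc
    obtain ⟨A, B, rfl, hA, hB, hAB, hBA⟩ :=
      exists_balanced_split (u := u) _ S rfl fun x hx => hV x (hS x hx)
    exact ⟨A.sum, B.sum, by simp, ⟨A, fun x hx => hS x (by simp [hx]), rfl, by omega⟩,
      ⟨B, fun x hx => hS x (by simp [hx]), rfl, by omega⟩, hAB, hBA⟩
  obtain ⟨S, hS, rfl, hc⟩ := h
  by_cases h2 : Multiset.card S ≤ 2 * k
  · obtain ⟨s₁, s₂, h1, h2, h3, h4, h5⟩ := even S hS h2
    exact ⟨s₁, s₂, 0, h1, h2, h3, Or.inl rfl, h4, h5⟩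
  · obtain ⟨a, ha⟩ := Multiset.card_pos_iff_exists_mem.1 (show 0 < Multiset.card S by omega)
    obtain ⟨T, rfl⟩ := Multiset.exists_cons_of_mem ha
    simp only [Multiset.card_cons] at hc h2
    obtain ⟨s₁, s₂, h1, h2, h3, h4, h5⟩ := even T (fun x hx => hS x (by simp [hx])) (by omega)
    refine ⟨s₁, s₂, a, ?_, h2, h3, Or.inr ⟨by omega, hS a ha⟩, h4, h5⟩
    rw [Multiset.sum_cons, h1]
    omega

/-! ### Windows of sums around `t / 2 ^ i` -/

/-- Position `x` of the window at level `i` stands for the sum `x + t / 2 ^ i - 2 * u` with at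
most `m / 2 ^ i` coins. -/
def Window (V : Finset ℕ) (u t m i x : ℕ) : Prop :=
  x ≤ 4 * u ∧ ∃ s, s + 2 * u = x + t / 2 ^ i ∧ Feasible V (m / 2 ^ i) s

theorem window_zero_iff {t m : ℕ} : Window V u t m 0 (2 * u) ↔ Feasible V m t := by
  simp only [Window, pow_zero, Nat.div_one]
  constructor
  · rintro ⟨-, s, h1, h2⟩
    obtain rfl : s = t := by omega
    exact h2
  · exact fun h => ⟨by omega, t, by omega, h⟩

/-- At this level no coin is allowed any more, so only the empty sum `0` is left. -/
theorem window_top_iff {t m L x : ℕ} (hm : m < 2 ^ L) :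
    Window V u t m L x ↔ x + t / 2 ^ L = 2 * u := by
  simp only [Window, Nat.div_eq_of_lt hm, feasible_zero_left_iff]
  constructor
  · rintro ⟨-, s, h1, rfl⟩
    omega
  · generalize t / 2 ^ L = c
    exact fun h => ⟨by omega, 0, by omega, rfl⟩

/-- The radius `2 * u` is the one that reproduces itself. A sum within `2 * u` of `c = t / 2 ^ i`,
minus an extra coin that is at most `u`, splits into parts differing by at most `u`, so both parts
are within `(2 * u + u + u) / 2 = 2 * u` of `c / 2`. The digit `c % 2` and the shift `2 * u` in the
equation come from rewriting sums as positions. The converse needs no balance: feasible parts add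
up. -/
theorem window_succ_iff (hV : ∀ x ∈ V, x ≤ u) {t m i x : ℕ} :
    Window V u t m i x ↔ x ≤ 4 * u ∧ ∃ x₁ x₂ a, Window V u t m (i + 1) x₁ ∧
      Window V u t m (i + 1) x₂ ∧ (a = 0 ∨ m / 2 ^ i % 2 = 1 ∧ a ∈ V) ∧
      x₁ + x₂ + a = x + t / 2 ^ i % 2 + 2 * u := by
  have ht : t / 2 ^ (i + 1) = t / 2 ^ i / 2 := by rw [pow_succ, Nat.div_div_eq_div_mul]
  have hm : m / 2 ^ (i + 1) = m / 2 ^ i / 2 := by rw [pow_succ, Nat.div_div_eq_div_mul]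
  simp only [Window, ht, hm]
  generalize t / 2 ^ i = c
  generalize m / 2 ^ i = n
  constructor
  · rintro ⟨hx, s, hs, hf⟩
    refine ⟨hx, ?_⟩
    have hn : n = 2 * (n / 2) + n % 2 := (Nat.div_add_mod n 2).symm
    rw [hn] at hf
    obtain ⟨s₁, s₂, a, h1, h2, h3, h4, h5, h6⟩ := hf.exists_split hV (Nat.mod_lt _ two_pos)
    have ha : a ≤ u := by
      rcases h4 with rfl | ⟨-, h4⟩
      exacts [Nat.zero_le u, hV a h4]
    refine ⟨s₁ + 2 * u - c / 2, s₂ + 2 * u - c / 2, a, ⟨by omega, s₁, by omega, h2⟩,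
      ⟨by omega, s₂, by omega, h3⟩, h4, by omega⟩
  · rintro ⟨hx, x₁, x₂, a, ⟨hx₁, s₁, h1, h2⟩, ⟨hx₂, s₂, h3, h4⟩, h5, h6⟩
    refine ⟨hx, s₁ + s₂ + a, by omega, ?_⟩
    have h7 : Feasible V (n % 2) a := by
      rcases h5 with rfl | ⟨h, ha⟩
      · exact feasible_zero _
      · rw [h]; exact feasible_one_of_mem ha
    exact ((h2.add h4).add h7).mono (by omega)

/-! ### Large targets -/

theorem minCoins_le_iff {t m : ℕ} : minCoins V t ≤ m ↔ Feasible V m t := by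
  constructor
  · intro h
    by_contra hf
    have : ((m + 1 : ℕ) : ℕ∞) ≤ minCoins V t := by
      refine le_iInf₂ fun S hS => ?_
      rw [Nat.cast_le]
      by_contra hc
      exact hf ⟨S, hS.1, hS.2, by omega⟩
    have := this.trans h
    rw [Nat.cast_le] at this
    omega
  · rintro ⟨S, h1, h2, h3⟩
    refine (iInf₂_le S ⟨h1, h2⟩).trans ?_
    exact_mod_cast h3

/-- Among `u` integers, some nonempty family has a sum that is divisible by `u`. -/
theorem exists_le_dvd_sum (hu : 0 < u) (S : Multiset ℕ) (hS : u ≤ Multiset.card S) :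
    ∃ T ≤ S, T ≠ 0 ∧ u ∣ T.sum := by
  induction S using Quotient.inductionOn with
  | _ l =>
    have hl : u ≤ l.length := by simpa using hS
    -- Two of the `u + 1` prefix sums agree modulo `u`; the segment between them is the required
    -- family.
    obtain ⟨i, hi, j, hj, hij, h⟩ := Finset.exists_ne_map_eq_of_card_lt_of_maps_to
      (s := Finset.range (u + 1)) (t := Finset.range u) (f := fun i => (l.take i).sum % u)
      (by simp) (fun i _ => by simpa using Nat.mod_lt _ hu)
    wlog hlt : i < j generalizing i j
    · exact this j hj i hi hij.symm h.symm (by omega)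
    simp only [Finset.mem_range] at hi hj
    refine ⟨((l.take j).drop i : List ℕ), ?_, ?_, ?_⟩
    · exact ((List.drop_sublist _ _).trans (List.take_sublist _ _)).subperm
    · intro h0
      have := congrArg Multiset.card h0
      simp at this
      omega
    · have hsum : (l.take j).sum = (l.take i).sum + ((l.take j).drop i).sum := by
        conv_lhs => rw [← List.take_append_drop i (l.take j), List.sum_append, List.take_take,
          min_eq_left hlt.le]
      rw [Multiset.sum_coe]
      have h' : (l.take i).sum ≡ (l.take i).sum + ((l.take j).drop i).sum [MOD u] := by
        rw [← hsum]; exact h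
      have := (Nat.modEq_iff_dvd' (by omega)).1 h'
      simpa using this

/-- In a minimal multiset of coins, fewer than `u` coins differ from the largest coin `u`. -/
theorem exists_few_smaller_coins (huV : u ∈ V) (hV : ∀ x ∈ V, x ≤ u) (hu : 0 < u) (n : ℕ) :
    ∀ S : Multiset ℕ, (∀ x ∈ S, x ∈ V) → Multiset.card (S.filter (· ≠ u)) = n →
      ∃ S' : Multiset ℕ, (∀ x ∈ S', x ∈ V) ∧ S'.sum = S.sum ∧
        Multiset.card S' ≤ Multiset.card S ∧ Multiset.card (S'.filter (· ≠ u)) < u := by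
  induction n using Nat.strong_induction_on with
  | _ n ih =>
    intro S hS hn
    by_cases hnu : n < u
    · exact ⟨S, hS, rfl, le_rfl, hn ▸ hnu⟩
    obtain ⟨T, hT, hT0, q, hq⟩ := exists_le_dvd_sum hu (S.filter (· ≠ u)) (by omega)
    have hTS : T ≤ S := hT.trans (Multiset.filter_le _ _)
    obtain ⟨R, rfl⟩ := Multiset.le_iff_exists_add.1 hTS
    have hTf : T.filter (· ≠ u) = T := Multiset.filter_eq_self.2 fun x hx =>
      (Multiset.mem_filter.1 (Multiset.mem_of_le hT hx)).2
    have hTpos : 0 < Multiset.card T := Multiset.card_pos.2 hT0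
    -- Every coin of `T` is at most `u`, so `T.sum = u * q` needs at least `q` coins; the exchange
    -- is therefore no loss.
    have hqT : q ≤ Multiset.card T := by
      have h1 : T.sum ≤ Multiset.card T • u :=
        Multiset.sum_le_card_nsmul T u fun x hx => hV x (hS x (by simp [hx]))
      rw [hq, smul_eq_mul, mul_comm] at h1
      exact Nat.le_of_mul_le_mul_right h1 hu
    rw [Multiset.filter_add, Multiset.card_add, hTf] at hn
    have hrep : (Multiset.replicate q u).filter (· ≠ u) = 0 :=
      Multiset.filter_eq_nil.2 fun x hx => by simp [Multiset.eq_of_mem_replicate hx]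
    obtain ⟨S', h1, h2, h3, h4⟩ := ih (Multiset.card (R.filter (· ≠ u))) (by omega)
      (Multiset.replicate q u + R) (by
        intro x hx
        rcases Multiset.mem_add.1 hx with hx | hx
        · rw [Multiset.eq_of_mem_replicate hx]; exact huV
        · exact hS x (by simp [hx])) (by rw [Multiset.filter_add, hrep, zero_add])
    refine ⟨S', h1, ?_, ?_, h4⟩
    · rw [h2, Multiset.sum_add, Multiset.sum_add, Multiset.sum_replicate, hq, smul_eq_mul,
        mul_comm]
    · refine h3.trans ?_
      rw [Multiset.card_add, Multiset.card_add, Multiset.card_replicate]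
      omega

/-- After the exchange the copies of `u` are split off and counted by `q`. The other coins are fewer
than `u`, each at most `u`, so their sum is below `u * u`. -/
theorem Feasible.exists_many_largest (huV : u ∈ V) (hV : ∀ x ∈ V, x ≤ u) (hu : 0 < u) {m t : ℕ}
    (h : Feasible V m t) : ∃ (S : Multiset ℕ) (q : ℕ), (∀ x ∈ S, x ∈ V) ∧ S.sum + q * u = t ∧
      Multiset.card S + q ≤ m ∧ Multiset.card S < u ∧ S.sum < u * u := by
  obtain ⟨S₀, h1, h2, h3⟩ := h
  obtain ⟨S, hS, hsum, hcard, hfew⟩ := exists_few_smaller_coins huV hV hu _ S₀ h1 rfl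
  have hdec := Multiset.filter_add_not (· ≠ u) S
  have hrep : S.filter (fun x => ¬ x ≠ u) = Multiset.replicate (S.count u) u := by
    simp [Multiset.filter_eq']
  rw [hrep] at hdec
  refine ⟨S.filter (· ≠ u), S.count u, fun x hx => hS x (Multiset.mem_of_mem_filter hx), ?_, ?_,
    hfew, ?_⟩
  · rw [← h2, ← hsum]
    conv_rhs => rw [← hdec]
    simp
  · have := congrArg Multiset.card hdec
    simp only [Multiset.card_add, Multiset.card_replicate] at this
    omega
  · have h4 : (S.filter (· ≠ u)).sum ≤ Multiset.card (S.filter (· ≠ u)) • u :=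
      Multiset.sum_le_card_nsmul _ u fun x hx => hV x (hS x (Multiset.mem_of_mem_filter hx))
    rw [smul_eq_mul] at h4
    exact h4.trans_lt (Nat.mul_lt_mul_of_pos_right hfew hu)

/-- In the normal form of `Feasible.exists_many_largest`, `q * u ≤ t < (u + 1) * u` gives at most
`u` copies of the largest coin, and there are fewer than `u` others. -/
theorem Feasible.le_two_mul (huV : u ∈ V) (hV : ∀ x ∈ V, x ≤ u) (hu : 0 < u) {m t : ℕ}
    (ht : t < u * u + u) (h : Feasible V m t) : Feasible V (2 * u) t := by
  obtain ⟨S, q, h1, h2, h3, h4, h5⟩ := h.exists_many_largest huV hV hu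
  refine ⟨S + Multiset.replicate q u, ?_, by simp [h2], ?_⟩
  · intro x hx
    rcases Multiset.mem_add.1 hx with hx | hx
    · exact h1 x hx
    · rw [Multiset.eq_of_mem_replicate hx]; exact huV
  · have : q < u + 1 := by
      by_contra hq
      have : (u + 1) * u ≤ q * u := Nat.mul_le_mul_right u (by omega)
      rw [Nat.succ_mul] at this
      omega
    simp only [Multiset.card_add, Multiset.card_replicate]
    omega

/-- If `u * u ≤ t`, the smaller coins cannot cover `t`, so the normal form of a solution for `t + k
* u` contains at least `k` copies of `u`, which can be removed. -/
theorem feasible_add_mul_iff (huV : u ∈ V) (hV : ∀ x ∈ V, x ≤ u) (hu : 0 < u) {m t k : ℕ}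
    (ht : k = 0 ∨ u * u ≤ t) : Feasible V (m + k) (t + k * u) ↔ Feasible V m t := by
  constructor
  · intro h
    rcases ht with rfl | ht
    · simpa using h
    obtain ⟨S, q, h1, h2, h3, h4, h5⟩ := h.exists_many_largest huV hV hu
    have hkq : k ≤ q := by
      by_contra hq
      have : q * u ≤ k * u := Nat.mul_le_mul_right u (by omega)
      omega
    refine ⟨S + Multiset.replicate (q - k) u, ?_, ?_, ?_⟩
    · intro x hx
      rcases Multiset.mem_add.1 hx with hx | hx
      · exact h1 x hx
      · rw [Multiset.eq_of_mem_replicate hx]; exact huV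
    · have : (q - k) * u + k * u = q * u := by rw [← Nat.add_mul]; congr 1; omega
      simp only [Multiset.sum_add, Multiset.sum_replicate, smul_eq_mul]
      omega
    · simp only [Multiset.card_add, Multiset.card_replicate]
      omega
  · intro h
    refine h.add ⟨Multiset.replicate k u, fun x hx => ?_, by simp, by simp⟩
    rw [Multiset.eq_of_mem_replicate hx]; exact huV

/-- Complements `feasible_add_mul_iff`, which speaks only about budgets of the form `m + k`: smaller
budgets never suffice. -/
theorem Feasible.le_of_large (huV : u ∈ V) (hV : ∀ x ∈ V, x ≤ u) (hu : 0 < u) {m t k : ℕ}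
    (ht : k = 0 ∨ u * u ≤ t) (h : Feasible V m (t + k * u)) : k ≤ m := by
  rcases ht with rfl | ht
  · omega
  obtain ⟨S, q, h1, h2, h3, h4, h5⟩ := h.exists_many_largest huV hV hu
  by_contra hq
  have : (q + 1) * u ≤ k * u := Nat.mul_le_mul_right u (by omega)
  rw [Nat.succ_mul] at this
  omega

end Feasible

/-! ### The fast Fourier transform along the tree of factors of `X ^ 2 ^ L - 1` -/

namespace FFT

/-- The first index of the butterfly of width `m` that involves `j`; the second one is
`lo m j + m`. -/
def lo (m j : ℕ) : ℕ := j / (2 * m) * (2 * m) + j % m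

section Index

variable {m b r : ℕ}

theorem lo_left (hr : r < m) : lo m (b * (2 * m) + r) = b * (2 * m) + r := by
  have h : b * (2 * m) + r = r + m * (2 * b) := by ring
  have h2 : (b * (2 * m) + r) / (2 * m) = b := by
    rw [add_comm, Nat.add_mul_div_right _ _ (by omega), Nat.div_eq_of_lt (by omega), zero_add]
  rw [lo, h2, h, Nat.add_mul_mod_self_left, Nat.mod_eq_of_lt hr, ← h]

theorem lo_right (hr : r < m) : lo m (b * (2 * m) + r + m) = b * (2 * m) + r := by
  have h : b * (2 * m) + r + m = r + m * (2 * b + 1) := by ring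
  have h2 : (b * (2 * m) + r + m) / (2 * m) = b := by
    rw [add_assoc, add_comm, Nat.add_mul_div_right _ _ (by omega), Nat.div_eq_of_lt (by omega),
      zero_add]
  rw [lo, h2, h, Nat.add_mul_mod_self_left, Nat.mod_eq_of_lt hr]

theorem div_left (hr : r < m) : (b * (2 * m) + r) / (2 * m) = b := by
  rw [add_comm, Nat.add_mul_div_right _ _ (by omega), Nat.div_eq_of_lt (by omega), zero_add]

theorem div_right (hr : r < m) : (b * (2 * m) + r + m) / (2 * m) = b := by
  rw [add_assoc, add_comm, Nat.add_mul_div_right _ _ (by omega), Nat.div_eq_of_lt (by omega),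
    zero_add]

theorem mod_left (hr : r < m) : (b * (2 * m) + r) % (2 * m) = r := by
  rw [add_comm, Nat.add_mul_mod_self_right, Nat.mod_eq_of_lt (by omega)]

theorem mod_right (hr : r < m) : (b * (2 * m) + r + m) % (2 * m) = r + m := by
  rw [add_assoc, add_comm, Nat.add_mul_mod_self_right, Nat.mod_eq_of_lt (by omega)]

theorem exists_left_or_right (hm : 0 < m) (j : ℕ) :
    ∃ b r, r < m ∧ (j = b * (2 * m) + r ∨ j = b * (2 * m) + r + m) := by
  have h := Nat.div_add_mod' j (2 * m)
  have h2 := Nat.mod_lt j (show 0 < 2 * m by omega)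
  by_cases hj : j % (2 * m) < m
  · exact ⟨j / (2 * m), j % (2 * m), hj, Or.inl h.symm⟩
  · exact ⟨j / (2 * m), j % (2 * m) - m, by omega, Or.inr (by omega)⟩

/-- Both indices of a butterfly stay inside the array, which is what confines the transforms to
positions below `2 ^ L`. -/
theorem lo_add_lt {L e j : ℕ} (he : e < L) (hj : j < 2 ^ L) : lo (2 ^ e) j + 2 ^ e < 2 ^ L := by
  obtain ⟨d, rfl⟩ : ∃ d, L = d + (e + 1) := ⟨L - (e + 1), by omega⟩
  have hm : 0 < 2 ^ e := by positivity
  have h1 : j / (2 * 2 ^ e) < 2 ^ d := by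
    rw [Nat.div_lt_iff_lt_mul (by omega)]
    calc j < _ := hj
      _ = _ := by ring
  have h2 := Nat.mod_lt j hm
  have h3 : (j / (2 * 2 ^ e) + 1) * (2 * 2 ^ e) ≤ 2 ^ d * (2 * 2 ^ e) := Nat.mul_le_mul_right _ h1
  have h4 : 2 ^ (d + (e + 1)) = 2 ^ d * (2 * 2 ^ e) := by ring
  rw [Nat.succ_mul] at h3
  rw [lo, h4]
  omega

end Index

section Steps

variable {R : Type*} [AddCommGroup R]

/-- One level of the forward transform; `μ b` is the multiplication by the twiddle factor of the
block `b`. -/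
def fwdStep (μ : ℕ → R → R) (m : ℕ) (a : ℕ → R) (j : ℕ) : R :=
  if j % (2 * m) < m then a (lo m j) + μ (j / (2 * m)) (a (lo m j + m))
  else a (lo m j) - μ (j / (2 * m)) (a (lo m j + m))

/-- One level of the inverse transform. -/
def invStep (μ : ℕ → R → R) (m : ℕ) (a : ℕ → R) (j : ℕ) : R :=
  if j % (2 * m) < m then a (lo m j) + a (lo m j + m)
  else μ (j / (2 * m)) (a (lo m j) - a (lo m j + m))

/-- The forward transform of length `2 ^ L` after `ℓ` levels. -/
def fwd (μ : ℕ → R → R) (L : ℕ) (a : ℕ → R) : ℕ → ℕ → R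
  | 0 => a
  | ℓ + 1 => fwdStep μ (2 ^ (L - 1 - ℓ)) (fwd μ L a ℓ)

/-- The inverse transform after `ℓ` levels. -/
def inv (μ : ℕ → R → R) (a : ℕ → R) : ℕ → ℕ → R
  | 0 => a
  | ℓ + 1 => invStep μ (2 ^ ℓ) (inv μ a ℓ)

theorem inv_congr (μ : ℕ → R → R) {L : ℕ} {a a' : ℕ → R} (h : ∀ j < 2 ^ L, a j = a' j) :
    ∀ ℓ ≤ L, ∀ j < 2 ^ L, inv μ a ℓ j = inv μ a' ℓ j := by
  intro ℓ
  induction ℓ with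
  | zero => exact fun _ => h
  | succ ℓ ih =>
    intro hℓ j hj
    have hlt := lo_add_lt (e := ℓ) (by omega) hj
    simp only [inv, invStep, ih (by omega) _ hlt,
      ih (by omega) (lo (2 ^ ℓ) j) ((Nat.le_add_right _ _).trans_lt hlt)]

end Steps

theorem sum_range_two_mul {M : Type*} [AddCommMonoid M] (f : ℕ → M) (n : ℕ) :
    ∑ q ∈ Finset.range (2 * n), f q = ∑ q ∈ Finset.range n, (f (2 * q) + f (2 * q + 1)) := by
  induction n with
  | zero => simp
  | succ n ih =>
    rw [Finset.sum_range_succ, ← ih, Nat.mul_succ, Finset.sum_range_succ, Finset.sum_range_succ,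
      add_assoc]

/-! ### The exact transforms over the complex numbers -/

section Complex

variable {ψ : ℕ → ℂ} {L : ℕ}

/-- The forward transform evaluates the polynomial with coefficients `a` at the points
`ψ b ^ 2`. -/
theorem fwd_eq_sum (h0 : ∀ b, 2 * b + 1 < 2 ^ L → ψ (2 * b) ^ 2 = ψ b)
    (h1 : ∀ b, 2 * b + 1 < 2 ^ L → ψ (2 * b + 1) ^ 2 = -ψ b) (a : ℕ → ℂ) :
    ∀ ℓ ≤ L, ∀ b < 2 ^ ℓ, ∀ r < 2 ^ (L - ℓ),
      fwd (fun b x => ψ b * x) L a ℓ (b * 2 ^ (L - ℓ) + r) =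
        ∑ q ∈ Finset.range (2 ^ ℓ), a (q * 2 ^ (L - ℓ) + r) * (ψ b ^ 2) ^ q := by
  -- After `ℓ` levels, block `b` holds the remainder of the polynomial modulo `X ^ (2 * m) - ψ b ^
  -- 2`, where `2 * m = 2 ^ (L - ℓ)`. This modulus factors as `(X ^ m - ψ b) * (X ^ m + ψ b)`, and
  -- `h0`, `h1` identify `ψ b` and `-ψ b` as the squares that belong to the blocks `2 * b` and `2 *
  -- b + 1` of the next level.
  intro ℓ
  induction ℓ with
  | zero =>
    intro _ b hb r hr
    obtain rfl : b = 0 := by simpa using hb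
    simp [fwd]
  | succ ℓ ih =>
    intro hℓ b' hb' r hr
    have hm : 2 ^ (L - ℓ) = 2 * 2 ^ (L - (ℓ + 1)) := by
      rw [show L - ℓ = L - (ℓ + 1) + 1 by omega]; ring
    have he : L - 1 - ℓ = L - (ℓ + 1) := by omega
    have hbL : b' < 2 ^ L := hb'.trans_le (Nat.pow_le_pow_right two_pos hℓ)
    have ih' := ih (by omega) (b' / 2) (by rw [pow_succ] at hb'; omega)
    rw [hm] at ih'
    simp only [fwd, he]
    generalize 2 ^ (L - (ℓ + 1)) = m at *
    have hL2 : 2 ∣ 2 ^ L := dvd_pow_self 2 (by omega)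
    have e1 := ih' r (by omega)
    have e2 := ih' (r + m) (by omega)
    rw [← add_assoc] at e2
    rw [pow_succ, mul_comm (2 ^ ℓ) 2, sum_range_two_mul]
    obtain ⟨b, rfl | rfl⟩ : ∃ b, b' = 2 * b ∨ b' = 2 * b + 1 := ⟨b' / 2, by omega⟩
    · have hb : 2 * b / 2 = b := by omega
      rw [hb] at e1 e2
      rw [show 2 * b * m + r = b * (2 * m) + r by ring]
      simp only [fwdStep, mod_left hr, hr, if_true, lo_left hr, div_left hr, e1, e2, h0 b (by omega),
        Finset.mul_sum, ← Finset.sum_add_distrib]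
      refine Finset.sum_congr rfl fun q _ => ?_
      rw [show q * (2 * m) + r = 2 * q * m + r by ring,
        show q * (2 * m) + (r + m) = (2 * q + 1) * m + r by ring]
      ring
    · have hb : (2 * b + 1) / 2 = b := by omega
      rw [hb] at e1 e2
      rw [show (2 * b + 1) * m + r = b * (2 * m) + r + m by ring]
      simp only [fwdStep, mod_right hr, lo_right hr, div_right hr, e1, e2, h1 b (by omega),
        Finset.mul_sum, ← Finset.sum_sub_distrib]
      rw [if_neg (by omega)]
      refine Finset.sum_congr rfl fun q _ => ?_
      rw [show q * (2 * m) + r = 2 * q * m + r by ring,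
        show q * (2 * m) + (r + m) = (2 * q + 1) * m + r by ring,
        pow_succ (-ψ b) (2 * q), show (-ψ b) ^ (2 * q) = (ψ b ^ 2) ^ q by rw [pow_mul, neg_sq]]
      ring

theorem fwd_top_eq_sum (h0 : ∀ b, 2 * b + 1 < 2 ^ L → ψ (2 * b) ^ 2 = ψ b)
    (h1 : ∀ b, 2 * b + 1 < 2 ^ L → ψ (2 * b + 1) ^ 2 = -ψ b) (a : ℕ → ℂ) {b : ℕ}
    (hb : b < 2 ^ L) : fwd (fun b x => ψ b * x) L a L b =
      ∑ q ∈ Finset.range (2 ^ L), a q * (ψ b ^ 2) ^ q := by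
  simpa using fwd_eq_sum h0 h1 a L le_rfl b hb 0 (by simp)

/-- Adding and subtracting the two outputs of a butterfly returns twice its inputs, because the
conjugate of a number on the unit circle is its inverse. The scalar `c` carries the powers of two
from the levels undone before. -/
theorem invStep_fwdStep (hψ : ∀ b, star (ψ b) * ψ b = 1) {m : ℕ} (hm : 0 < m) (a : ℕ → ℂ)
    (c : ℂ) : invStep (fun b x => star (ψ b) * x) m
      (fun j => c * fwdStep (fun b x => ψ b * x) m a j) = fun j => c * 2 * a j := by
  funext j
  obtain ⟨b, r, hr, rfl | rfl⟩ := exists_left_or_right hm j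
  · simp only [invStep, fwdStep, mod_left hr, mod_right hr, lo_left hr, lo_right hr, div_left hr,
      div_right hr, hr, if_true, if_neg (show ¬ r + m < m by omega)]
    ring
  · simp only [invStep, fwdStep, mod_left hr, mod_right hr, lo_left hr, lo_right hr, div_left hr,
      div_right hr, hr, if_true, if_neg (show ¬ r + m < m by omega)]
    linear_combination (2 * c * a (b * (2 * m) + r + m)) * hψ b

theorem inv_fwd (hψ : ∀ b, star (ψ b) * ψ b = 1) (a : ℕ → ℂ) : ∀ ℓ ≤ L,
    inv (fun b x => star (ψ b) * x) (fwd (fun b x => ψ b * x) L a L) ℓ =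
      fun j => 2 ^ ℓ * fwd (fun b x => ψ b * x) L a (L - ℓ) j := by
  intro ℓ
  induction ℓ with
  | zero => intro _; simp [inv]
  | succ ℓ ih =>
    intro hℓ
    obtain ⟨d, hd⟩ : ∃ d, L - ℓ = d + 1 := ⟨L - ℓ - 1, by omega⟩
    rw [inv, ih (by omega), hd, show L - (ℓ + 1) = d by omega, fwd,
      show L - 1 - d = ℓ by omega, invStep_fwdStep hψ (by positivity), pow_succ]

open Polynomial in
/-- The inverse transform of the pointwise product of the transforms of three polynomials. -/
theorem inv_mul_eq_coeff (h0 : ∀ b, 2 * b + 1 < 2 ^ L → ψ (2 * b) ^ 2 = ψ b)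
    (h1 : ∀ b, 2 * b + 1 < 2 ^ L → ψ (2 * b + 1) ^ 2 = -ψ b) (hψ : ∀ b, star (ψ b) * ψ b = 1)
    (p q : ℂ[X]) (hp : p.natDegree < 2 ^ L) (hq : q.natDegree < 2 ^ L)
    (hpq : (p * p * q).natDegree < 2 ^ L) {j : ℕ} (hj : j < 2 ^ L) :
    inv (fun b x => star (ψ b) * x) (fun b =>
      fwd (fun b x => ψ b * x) L p.coeff L b * fwd (fun b x => ψ b * x) L p.coeff L b *
      fwd (fun b x => ψ b * x) L q.coeff L b) L j = 2 ^ L * (p * p * q).coeff j := by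
  have key : ∀ f : ℂ[X], f.natDegree < 2 ^ L → ∀ b < 2 ^ L,
      fwd (fun b x => ψ b * x) L f.coeff L b = f.eval (ψ b ^ 2) := by
    intro f hf b hb
    rw [fwd_top_eq_sum h0 h1 _ hb, Polynomial.eval_eq_sum_range' hf]
  rw [inv_congr _ (a' := fwd (fun b x => ψ b * x) L (p * p * q).coeff L) _ L le_rfl j hj,
    inv_fwd hψ _ L le_rfl]
  · simp [fwd]
  · intro b hb
    rw [key p hp b hb, key q hq b hb, key _ hpq b hb, eval_mul, eval_mul]

end Complex

/-! ### The twiddle factors -/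

/-- The angle `π / 2 ^ (k + 1)`, as a point of the unit circle. -/
noncomputable def theta (k : ℕ) : ℂ := Complex.exp ((Real.pi / 2 ^ (k + 1) : ℝ) * Complex.I)

/-- The product of the `theta i` over the binary digits `i < k` of `b`. -/
noncomputable def psi (k b : ℕ) : ℂ :=
  ∏ i ∈ Finset.range k, if b / 2 ^ i % 2 = 1 then theta i else 1

theorem theta_zero : theta 0 = Complex.I := by
  rw [theta]
  push_cast
  rw [pow_one, Complex.exp_pi_div_two_mul_I]

theorem theta_succ_sq (k : ℕ) : theta (k + 1) ^ 2 = theta k := by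
  rw [theta, theta, ← Complex.exp_nat_mul]
  congr 1
  push_cast
  rw [pow_succ (2 : ℂ) (k + 1)]
  field_simp

theorem norm_theta (k : ℕ) : ‖theta k‖ = 1 := Complex.norm_exp_ofReal_mul_I _

theorem norm_psi (k b : ℕ) : ‖psi k b‖ = 1 := by
  rw [psi, norm_prod]
  refine Finset.prod_eq_one fun i _ => ?_
  split_ifs
  exacts [norm_theta i, norm_one]

theorem star_psi_mul_psi (k b : ℕ) : star (psi k b) * psi k b = 1 := by
  have h := Complex.conj_mul' (psi k b)
  rw [norm_psi] at h
  simpa using h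

theorem psi_succ (k b : ℕ) :
    psi (k + 1) b = psi k b * if b / 2 ^ k % 2 = 1 then theta k else 1 :=
  Finset.prod_range_succ _ _

theorem psi_succ_eq_of_lt {k b : ℕ} (hb : b < 2 ^ k) : psi (k + 1) b = psi k b := by
  rw [psi_succ, Nat.div_eq_of_lt hb]
  simp

/-- Squaring turns `theta (i + 1)` into `theta i`, so it shifts the binary digits of `b` down by one
place; the lowest digit contributes `theta 0 ^ 2 = -1`. This makes `psi` meet the two conditions on
the twiddle factors. -/
theorem psi_succ_sq (k b : ℕ) :
    psi (k + 1) b ^ 2 = psi k (b / 2) * if b % 2 = 1 then -1 else 1 := by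
  rw [psi, Finset.prod_range_succ', mul_pow, ← Finset.prod_pow, psi]
  congr 1
  · refine Finset.prod_congr rfl fun i _ => ?_
    rw [pow_succ' 2 i, ← Nat.div_div_eq_div_mul]
    split_ifs
    exacts [theta_succ_sq i, one_pow 2]
  · rw [pow_zero, Nat.div_one]
    split_ifs
    · rw [theta_zero, Complex.I_sq]
    · exact one_pow 2

theorem psi_two_mul_sq {L b : ℕ} (hb : 2 * b + 1 < 2 ^ L) : psi L (2 * b) ^ 2 = psi L b := by
  obtain ⟨k, rfl⟩ : ∃ k, L = k + 1 := ⟨L - 1, by rcases L with _ | L <;> simp at hb ⊢⟩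
  rw [psi_succ_sq, psi_succ_eq_of_lt (by rw [pow_succ] at hb; omega),
    Nat.mul_div_cancel_left _ two_pos]
  simp

theorem psi_two_mul_add_one_sq {L b : ℕ} (hb : 2 * b + 1 < 2 ^ L) :
    psi L (2 * b + 1) ^ 2 = -psi L b := by
  obtain ⟨k, rfl⟩ : ∃ k, L = k + 1 := ⟨L - 1, by rcases L with _ | L <;> simp at hb ⊢⟩
  rw [psi_succ_sq, psi_succ_eq_of_lt (by rw [pow_succ] at hb; omega),
    show (2 * b + 1) / 2 = b by omega, show (2 * b + 1) % 2 = 1 by omega]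
  simp

end FFT

/-! ### Fixed-point arithmetic in the Gaussian integers

A Gaussian integer `P` represents the complex number `P / S`. -/

namespace FFT

open scoped ComplexConjugate

/-- Division by `S`, rounded down in both coordinates. -/
def rnd (S : ℕ) (z : GaussianInt) : GaussianInt := ⟨z.re / S, z.im / S⟩

section Rounding

variable {S : ℕ}

theorem abs_floor_div_sub_le (hS : 0 < S) (x : ℤ) : |((x / S : ℤ) : ℝ) - x / S| ≤ 1 := by
  have h := Int.emod_nonneg x (show (S : ℤ) ≠ 0 by omega)
  have h' := Int.emod_lt_of_pos x (show (0 : ℤ) < S by omega)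
  have h'' : (x : ℝ) = S * ((x / S : ℤ) : ℝ) + ((x % S : ℤ) : ℝ) := by
    exact_mod_cast (Int.mul_ediv_add_emod x S).symm
  have hS' : (0 : ℝ) < S := by exact_mod_cast hS
  have h1 : (0 : ℝ) ≤ ((x % S : ℤ) : ℝ) := by exact_mod_cast h
  have h2 : ((x % S : ℤ) : ℝ) ≤ S := by exact_mod_cast h'.le
  rw [h'', add_div, mul_div_cancel_left₀ _ hS'.ne', abs_le]
  have h3 : 0 ≤ ((x % S : ℤ) : ℝ) / S := by positivity
  have h4 : ((x % S : ℤ) : ℝ) / S ≤ 1 := by rwa [div_le_one hS']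
  constructor <;> linarith

theorem norm_rnd_sub_le (hS : 0 < S) (z : GaussianInt) : ‖(rnd S z : ℂ) - z / S‖ ≤ 2 := by
  refine (Complex.norm_le_abs_re_add_abs_im _).trans ?_
  have h1 := abs_floor_div_sub_le hS z.re
  have h2 := abs_floor_div_sub_le hS z.im
  have e1 : ((rnd S z : ℂ) - z / S).re = ((z.re / S : ℤ) : ℝ) - z.re / S := by
    rw [Complex.sub_re, Complex.div_natCast_re, ← GaussianInt.intCast_re, ← GaussianInt.intCast_re]
    rfl
  have e2 : ((rnd S z : ℂ) - z / S).im = ((z.im / S : ℤ) : ℝ) - z.im / S := by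
    rw [Complex.sub_im, Complex.div_natCast_im, ← GaussianInt.intCast_im, ← GaussianInt.intCast_im]
    rfl
  rw [e1, e2]
  linarith

/-- The error of a rounded product. -/
theorem norm_rnd_mul_sub_le (hS : 0 < S) {P Q : GaussianInt} {p q : ℂ} {δ e A B : ℝ}
    (hP : ‖(P : ℂ) - S * p‖ ≤ δ) (hQ : ‖(Q : ℂ) - S * q‖ ≤ e) (hp : ‖p‖ ≤ A) (hq : ‖q‖ ≤ B)
    (he : e ≤ S) : ‖(rnd S (P * Q) : ℂ) - S * (p * q)‖ ≤ δ * (B + 1) + A * e + 2 := by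
  have hS' : (0 : ℝ) < S := by exact_mod_cast hS
  have hSc : (S : ℂ) ≠ 0 := by exact_mod_cast hS.ne'
  have hδ : 0 ≤ δ := (norm_nonneg _).trans hP
  have hQn : ‖(Q : ℂ)‖ ≤ S * (B + 1) := by
    calc ‖(Q : ℂ)‖ = ‖((Q : ℂ) - S * q) + S * q‖ := by ring_nf
      _ ≤ e + S * B := by
        refine (norm_add_le _ _).trans (add_le_add hQ ?_)
        rw [norm_mul, Complex.norm_natCast]
        exact mul_le_mul_of_nonneg_left hq hS'.le
      _ ≤ S * (B + 1) := by linarith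
  -- The usual splitting of the error of a product. The factor `Q / S` is at most `B + 1` because of
  -- `e ≤ S`, and the rounding itself adds at most `2`.
  have h1 : ((P * Q : GaussianInt) : ℂ) / S - S * (p * q) =
      (((P : ℂ) - S * p) * Q) / S + p * ((Q : ℂ) - S * q) := by
    rw [GaussianInt.toComplex_mul]
    field_simp
    ring
  have h2 : ‖((P * Q : GaussianInt) : ℂ) / S - S * (p * q)‖ ≤ δ * (B + 1) + A * e := by
    rw [h1]
    refine (norm_add_le _ _).trans (add_le_add ?_ ?_)
    · rw [norm_div, norm_mul, Complex.norm_natCast, div_le_iff₀ hS']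
      calc _ ≤ δ * (S * (B + 1)) := mul_le_mul hP hQn (norm_nonneg _) hδ
        _ = _ := by ring
    · rw [norm_mul]
      exact mul_le_mul hp hQ (norm_nonneg _) ((norm_nonneg _).trans hp)
  calc _ = ‖((rnd S (P * Q) : ℂ) - (P * Q : GaussianInt) / S) +
        (((P * Q : GaussianInt) : ℂ) / S - S * (p * q))‖ := by ring_nf
    _ ≤ 2 + (δ * (B + 1) + A * e) :=
      (norm_add_le _ _).trans (add_le_add (norm_rnd_sub_le hS _) h2)
    _ = _ := by ring

theorem norm_le_of_close {P : GaussianInt} {p : ℂ} {δ A : ℝ} (hP : ‖(P : ℂ) - S * p‖ ≤ δ)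
    (hp : ‖p‖ ≤ A) (hδ : δ ≤ S) : ‖(P : ℂ)‖ ≤ S * (A + 1) := by
  calc ‖(P : ℂ)‖ = ‖((P : ℂ) - S * p) + S * p‖ := by ring_nf
    _ ≤ δ + S * A := by
      refine (norm_add_le _ _).trans (add_le_add hP ?_)
      rw [norm_mul, Complex.norm_natCast]
      exact mul_le_mul_of_nonneg_left hp (Nat.cast_nonneg S)
    _ ≤ S * (A + 1) := by linarith

theorem norm_mul_le_of_close {P Q : GaussianInt} {p q : ℂ} {δ e A B : ℝ}
    (hP : ‖(P : ℂ) - S * p‖ ≤ δ) (hQ : ‖(Q : ℂ) - S * q‖ ≤ e) (hp : ‖p‖ ≤ A) (hq : ‖q‖ ≤ B)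
    (hδ : δ ≤ S) (he : e ≤ S) :
    ‖((P * Q : GaussianInt) : ℂ)‖ ≤ S * (A + 1) * (S * (B + 1)) := by
  rw [GaussianInt.toComplex_mul, norm_mul]
  have hP' := norm_le_of_close hP hp hδ
  exact mul_le_mul hP' (norm_le_of_close hQ hq he) (norm_nonneg _) ((norm_nonneg _).trans hP')

end Rounding

/-! ### Propagation of rounding errors through the transforms -/

section Transforms

variable {S L : ℕ} {Ψ : ℕ → GaussianInt} {ψ : ℕ → ℂ} {δ : ℝ}

/-- Rounded multiplication by the fixed-point number `Ψ b`. -/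
def rmul (S : ℕ) (Ψ : ℕ → GaussianInt) (b : ℕ) (x : GaussianInt) : GaussianInt := rnd S (Ψ b * x)

/-- With `D = δ * (2 ^ L + 1) + 2`, one level takes an error `E` to at most `2 * E + D`: one copy of
`E` from each input, and `D` from the twiddle factor and the rounding. Exact input means that `E`
starts at `0`. The hypothesis `hδS` keeps all errors below `S`, as the estimate for products
requires. -/
theorem fwd_close (hS : 0 < S) (hΨ : ∀ b < 2 ^ L, ‖(Ψ b : ℂ) - S * ψ b‖ ≤ δ)
    (hψ : ∀ b, ‖ψ b‖ = 1) {g : ℕ → GaussianInt} {a : ℕ → ℂ}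
    (hg : ∀ j < 2 ^ L, (g j : ℂ) = S * a j) (ha : ∀ j < 2 ^ L, ‖a j‖ ≤ 1)
    (hδS : 2 ^ L * (δ * (2 ^ L + 1) + 2) ≤ S) : ∀ ℓ ≤ L, ∀ j < 2 ^ L,
      ‖GaussianInt.toComplex (fwd (rmul S Ψ) L g ℓ j) - S * fwd (fun b x => ψ b * x) L a ℓ j‖ ≤
        (2 ^ ℓ - 1) * (δ * (2 ^ L + 1) + 2) ∧
      ‖fwd (fun b x => ψ b * x) L a ℓ j‖ ≤ 2 ^ ℓ := by
  have hδ : 0 ≤ δ := (norm_nonneg _).trans (hΨ 0 (by positivity))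
  intro ℓ
  induction ℓ with
  | zero =>
    intro _ j hj
    simp [fwd, hg j hj, ha j hj]
  | succ ℓ ih =>
    intro hℓ j hj
    have hlt := lo_add_lt (e := L - 1 - ℓ) (by omega) hj
    simp only [fwd, fwdStep]
    generalize hm : 2 ^ (L - 1 - ℓ) = m at *
    obtain ⟨e1, b1⟩ := ih (by omega) _ ((Nat.le_add_right _ _).trans_lt hlt)
    obtain ⟨e2, b2⟩ := ih (by omega) _ hlt
    have hb : j / (2 * m) < 2 ^ L := (Nat.div_le_self _ _).trans_lt hj
    set D := δ * (2 ^ L + 1) + 2 with hD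
    have hD0 : 0 ≤ D := by positivity
    have hpow : (2 : ℝ) ^ ℓ ≤ 2 ^ L := pow_le_pow_right₀ one_le_two (by omega)
    have hE : (2 ^ ℓ - 1) * D ≤ (S : ℝ) :=
      (mul_le_mul_of_nonneg_right (by linarith) hD0).trans hδS
    have e3 := norm_rnd_mul_sub_le hS (hΨ _ hb) e2 (hψ _).le (b2.trans hpow) hE
    have b3 : ‖ψ (j / (2 * m)) * fwd (fun b x => ψ b * x) L a ℓ (lo m j + m)‖ ≤ 2 ^ ℓ := by
      rw [norm_mul, hψ, one_mul]; exact b2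
    have hp2 : (2 : ℝ) ^ (ℓ + 1) = 2 ^ ℓ + 2 ^ ℓ := by ring
    have hfin : (2 ^ ℓ - 1) * D + (δ * (2 ^ L + 1) + 1 * ((2 ^ ℓ - 1) * D) + 2) =
        (2 ^ (ℓ + 1) - 1) * D := by rw [hp2, hD]; ring
    rw [← hfin, hp2]
    split_ifs
    · refine ⟨?_, (norm_add_le _ _).trans (add_le_add b1 b3)⟩
      refine le_trans (le_of_eq ?_) ((norm_add_le _ _).trans (add_le_add e1 e3))
      rw [GaussianInt.toComplex_add, rmul]
      ring_nf
    · refine ⟨?_, (norm_sub_le _ _).trans (add_le_add b1 b3)⟩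
      refine le_trans (le_of_eq ?_) ((norm_sub_le _ _).trans (add_le_add e1 e3))
      rw [GaussianInt.toComplex_sub, rmul]
      ring_nf

/-- The recursion `E ↦ 2 * E + D` again, now starting from the error `e`. The multiplication acts on
a difference, whose error is already `2 * E`; hence the extra factor `2` in `hδS`. -/
theorem inv_close (hS : 0 < S) (hΨ : ∀ b < 2 ^ L, ‖(Ψ b : ℂ) - S * ψ b‖ ≤ δ)
    (hψ : ∀ b, ‖ψ b‖ = 1) {g : ℕ → GaussianInt} {a : ℕ → ℂ} {e B : ℝ}
    (hg : ∀ j < 2 ^ L, ‖(g j : ℂ) - S * a j‖ ≤ e) (ha : ∀ j < 2 ^ L, ‖a j‖ ≤ B)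
    (hδS : 2 * (2 ^ L * (e + (δ * (2 ^ L * B + 1) + 2))) ≤ S) : ∀ ℓ ≤ L, ∀ j < 2 ^ L,
      ‖GaussianInt.toComplex (inv (rmul S Ψ) g ℓ j) - S * inv (fun b x => ψ b * x) a ℓ j‖ ≤
        2 ^ ℓ * (e + (δ * (2 ^ L * B + 1) + 2)) - (δ * (2 ^ L * B + 1) + 2) ∧
      ‖inv (fun b x => ψ b * x) a ℓ j‖ ≤ 2 ^ ℓ * B := by
  have hδ : 0 ≤ δ := (norm_nonneg _).trans (hΨ 0 (by positivity))
  have he : 0 ≤ e := (norm_nonneg _).trans (hg 0 (by positivity))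
  have hB : 0 ≤ B := (norm_nonneg _).trans (ha 0 (by positivity))
  intro ℓ
  induction ℓ with
  | zero =>
    intro _ j hj
    simpa [inv] using ⟨hg j hj, ha j hj⟩
  | succ ℓ ih =>
    intro hℓ j hj
    have hlt := lo_add_lt (e := ℓ) (by omega) hj
    simp only [inv, invStep]
    generalize hm : 2 ^ ℓ = m at hlt ⊢
    obtain ⟨e1, b1⟩ := ih (by omega) _ ((Nat.le_add_right _ _).trans_lt hlt)
    obtain ⟨e2, b2⟩ := ih (by omega) _ hlt
    have hb : j / (2 * m) < 2 ^ L := (Nat.div_le_self _ _).trans_lt hj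
    set D := δ * (2 ^ L * B + 1) + 2 with hD
    have hD0 : 0 ≤ D := by positivity
    have hpow : (2 : ℝ) ^ ℓ * 2 ≤ 2 ^ L := by
      rw [← pow_succ]; exact pow_le_pow_right₀ one_le_two (by omega)
    have hp2 : (2 : ℝ) ^ (ℓ + 1) = 2 ^ ℓ + 2 ^ ℓ := by ring
    set E := (2 : ℝ) ^ ℓ * (e + D) - D with hE
    have hE2 : E + E ≤ (S : ℝ) := by
      have : (2 : ℝ) ^ ℓ * (e + D) ≤ 2 ^ L * (e + D) :=
        mul_le_mul_of_nonneg_right (by nlinarith [pow_pos (two_pos (α := ℝ)) ℓ]) (by positivity)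
      linarith
    set x := inv (rmul S Ψ) g ℓ (lo m j)
    set y := inv (rmul S Ψ) g ℓ (lo m j + m)
    set x' := inv (fun b x => ψ b * x) a ℓ (lo m j)
    set y' := inv (fun b x => ψ b * x) a ℓ (lo m j + m)
    have e3 : ‖((x - y : GaussianInt) : ℂ) - S * (x' - y')‖ ≤ E + E := by
      refine le_trans (le_of_eq ?_) ((norm_sub_le _ _).trans (add_le_add e1 e2))
      rw [GaussianInt.toComplex_sub]
      ring_nf
    have b3 : ‖x' - y'‖ ≤ 2 ^ (ℓ + 1) * B := by
      rw [hp2, add_mul]; exact (norm_sub_le _ _).trans (add_le_add b1 b2)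
    have b4 : 2 ^ (ℓ + 1) * B ≤ 2 ^ L * B :=
      mul_le_mul_of_nonneg_right (by rw [pow_succ]; exact hpow) hB
    have e4 := norm_rnd_mul_sub_le hS (hΨ _ hb) e3 (hψ _).le (b3.trans b4) hE2
    have hfin : δ * (2 ^ L * B + 1) + 1 * (E + E) + 2 = 2 ^ (ℓ + 1) * (e + D) - D := by
      rw [hp2, hE, hD]; ring
    rw [hfin] at e4
    split_ifs
    · constructor
      · have hE' : E + E ≤ 2 ^ (ℓ + 1) * (e + D) - D := by rw [hp2, hE]; linarith
        refine le_trans (le_of_eq ?_) (((norm_add_le _ _).trans (add_le_add e1 e2)).trans hE')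
        rw [GaussianInt.toComplex_add]
        ring_nf
      · rw [hp2, add_mul]; exact (norm_add_le _ _).trans (add_le_add b1 b2)
    · exact ⟨e4, by rw [norm_mul, hψ, one_mul]; exact b3⟩

end Transforms

/-! ### Computation of the twiddle factors -/

/-- `Q * cos (π / 2 ^ (k + 1))`, approximately. -/
def cosApx (Q : ℕ) : ℕ → ℕ
  | 0 => 0
  | k + 1 => Nat.sqrt ((Q + cosApx Q k) * Q / 2)

/-- `Q * sin (π / 2 ^ (k + 1))`, approximately. -/
def sinApx (Q : ℕ) : ℕ → ℕ
  | 0 => Q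
  | k + 1 => Nat.sqrt ((Q - cosApx Q k) * Q / 2)

theorem cosApx_le (Q : ℕ) : ∀ k, cosApx Q k ≤ Q
  | 0 => Nat.zero_le Q
  | k + 1 => by
    have h := cosApx_le Q k
    rw [cosApx]
    calc Nat.sqrt ((Q + cosApx Q k) * Q / 2) ≤ Nat.sqrt (Q * Q) := by
          refine Nat.sqrt_le_sqrt (Nat.div_le_of_le_mul ?_)
          calc (Q + cosApx Q k) * Q ≤ (Q + Q) * Q := Nat.mul_le_mul_right _ (by omega)
            _ = _ := by ring
      _ = Q := Nat.sqrt_eq Q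

theorem sinApx_le (Q : ℕ) : ∀ k, sinApx Q k ≤ Q
  | 0 => le_rfl
  | k + 1 => by
    rw [sinApx]
    calc Nat.sqrt ((Q - cosApx Q k) * Q / 2) ≤ Nat.sqrt (Q * Q) := by
          refine Nat.sqrt_le_sqrt ((Nat.div_le_self _ _).trans (Nat.mul_le_mul_right _ ?_))
          omega
      _ = Q := Nat.sqrt_eq Q

theorem cos_half_angle (k : ℕ) : 2 * Real.cos (Real.pi / 2 ^ (k + 1 + 1)) ^ 2 =
    1 + Real.cos (Real.pi / 2 ^ (k + 1)) := by
  have h : Real.pi / 2 ^ (k + 1) = 2 * (Real.pi / 2 ^ (k + 1 + 1)) := by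
    rw [pow_succ (2 : ℝ) (k + 1)]; field_simp
  rw [h, Real.cos_two_mul]
  ring

theorem sin_half_angle (k : ℕ) : 2 * Real.sin (Real.pi / 2 ^ (k + 1 + 1)) ^ 2 =
    1 - Real.cos (Real.pi / 2 ^ (k + 1)) := by
  have := cos_half_angle k
  have h := Real.sin_sq_add_cos_sq (Real.pi / 2 ^ (k + 1 + 1))
  linarith

theorem angle_mem (k : ℕ) : 0 ≤ Real.pi / 2 ^ (k + 1) ∧ Real.pi / 2 ^ (k + 1) ≤ Real.pi / 2 := by
  refine ⟨by positivity, div_le_div_of_nonneg_left Real.pi_pos.le two_pos ?_⟩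
  rw [pow_succ]
  have : (1 : ℝ) ≤ 2 ^ k := one_le_pow₀ one_le_two
  linarith

theorem cos_angle_nonneg (k : ℕ) : 0 ≤ Real.cos (Real.pi / 2 ^ (k + 1)) := by
  obtain ⟨h1, h2⟩ := angle_mem k
  exact Real.cos_nonneg_of_mem_Icc ⟨by linarith [Real.pi_pos], h2⟩

theorem sin_angle_nonneg (k : ℕ) : 0 ≤ Real.sin (Real.pi / 2 ^ (k + 1)) := by
  obtain ⟨h1, h2⟩ := angle_mem k
  exact Real.sin_nonneg_of_nonneg_of_le_pi h1 (by linarith [Real.pi_pos])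

/-- The half-angle recursion contracts errors: an error `η` of the cosine becomes about `η / (4 *
y)`, where the new cosine `y` is at least `cos (π / 4)`, and the integer square root adds at most
`1`. So the bound `4` does not grow with `k`. -/
theorem abs_cosApx_sub_le {Q : ℕ} (hQ : 2 ∣ Q) (hQ5 : 5 ≤ Q) : ∀ k,
    |(cosApx Q k : ℝ) - Q * Real.cos (Real.pi / 2 ^ (k + 1))| ≤ 4
  | 0 => by simp [cosApx]
  | k + 1 => by
    have ih := abs_le.1 (abs_cosApx_sub_le hQ hQ5 k)
    have hy := cos_half_angle k
    have hx0 := cos_angle_nonneg k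
    have hy0 := cos_angle_nonneg (k + 1)
    have hQ5' : (5 : ℝ) ≤ Q := by exact_mod_cast hQ5
    have hX : (((Q + cosApx Q k) * Q / 2 : ℕ) : ℝ) = (Q + cosApx Q k) * Q / 2 := by
      rw [Nat.cast_div (hQ.mul_left _) (by norm_num)]; push_cast; ring
    have h1 : ((Nat.sqrt ((Q + cosApx Q k) * Q / 2) : ℕ) : ℝ) ^ 2 ≤
        (((Q + cosApx Q k) * Q / 2 : ℕ) : ℝ) := by exact_mod_cast Nat.sqrt_le' _
    have h2 : (((Q + cosApx Q k) * Q / 2 : ℕ) : ℝ) <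
        ((Nat.sqrt ((Q + cosApx Q k) * Q / 2) : ℕ) + 1 : ℝ) ^ 2 := by
      exact_mod_cast Nat.lt_succ_sqrt' _
    rw [hX] at h1 h2
    rw [cosApx]
    have hr0 : (0 : ℝ) ≤ (Nat.sqrt ((Q + cosApx Q k) * Q / 2) : ℕ) := Nat.cast_nonneg _
    generalize ((Nat.sqrt ((Q + cosApx Q k) * Q / 2) : ℕ) : ℝ) = r at *
    generalize Real.cos (Real.pi / 2 ^ (k + 1)) = x at *
    generalize Real.cos (Real.pi / 2 ^ (k + 1 + 1)) = y at *
    generalize (cosApx Q k : ℝ) = c at *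
    generalize (Q : ℝ) = q at *
    -- From `x ≥ 0` and `2 * y ^ 2 = 1 + x`.
    have hy7 : (7 / 10 : ℝ) ≤ y := by nlinarith
    have hz : (q * y) ^ 2 = q * (q + q * x) / 2 := by linear_combination q ^ 2 / 2 * hy
    have ih1 := mul_le_mul_of_nonneg_left ih.1 (show 0 ≤ q by linarith)
    have ih2 := mul_le_mul_of_nonneg_left ih.2 (show 0 ≤ q by linarith)
    have hc1 : (q + c) * q / 2 ≤ (q * y) ^ 2 + 2 * q := by linarith
    have hc2 : (q * y) ^ 2 - 2 * q ≤ (q + c) * q / 2 := by linarith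
    have hqy : 7 / 10 * q ≤ q * y := by nlinarith
    generalize q * y = z at *
    rw [abs_le]
    constructor
    · by_contra hlt
      push Not at hlt
      have : (r + 1) ^ 2 ≤ (z - 3) ^ 2 := pow_le_pow_left₀ (by linarith) (by linarith) 2
      nlinarith
    · by_contra hlt
      push Not at hlt
      have : (z + 4) ^ 2 ≤ r ^ 2 := pow_le_pow_left₀ (by linarith) (by linarith) 2
      nlinarith

/-- Sines may be close to `0`, where the square root is not Lipschitz: an error of `2 * Q` under the
root can become an error of order `√Q`. Therefore the computation uses `Q = S * S`, and dividing by
`S` later leaves a bounded error. Each sine is computed from a cosine, so these errors do not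
accumulate. -/
theorem abs_sinApx_sub_le {S : ℕ} (hS : 2 ∣ S) (hS5 : 5 ≤ S) : ∀ k,
    |(sinApx (S * S) k : ℝ) - ((S * S : ℕ) : ℝ) * Real.sin (Real.pi / 2 ^ (k + 1))| ≤ 2 * S + 1
  | 0 => by simp [sinApx]; positivity
  | k + 1 => by
    have hQ : 2 ∣ S * S := hS.mul_left S
    have ih := abs_le.1 (abs_cosApx_sub_le hQ (by nlinarith) k)
    have hcle := cosApx_le (S * S) k
    have hy := sin_half_angle k
    have hy0 := sin_angle_nonneg (k + 1)
    have hS5' : (5 : ℝ) ≤ S := by exact_mod_cast hS5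
    rw [sinApx]
    have hX : (((S * S - cosApx (S * S) k) * (S * S) / 2 : ℕ) : ℝ) =
        (((S * S : ℕ) : ℝ) - cosApx (S * S) k) * ((S * S : ℕ) : ℝ) / 2 := by
      rw [Nat.cast_div (hQ.mul_left _) (by norm_num), Nat.cast_mul, Nat.cast_sub hcle]
      norm_num
    generalize hn : (S * S - cosApx (S * S) k) * (S * S) / 2 = n at *
    have h1 : (Nat.sqrt n : ℝ) ^ 2 ≤ n := by exact_mod_cast Nat.sqrt_le' _
    have h2 : (n : ℝ) < (Nat.sqrt n + 1 : ℝ) ^ 2 := by exact_mod_cast Nat.lt_succ_sqrt' _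
    rw [hX] at h1 h2
    have hr0 : (0 : ℝ) ≤ Nat.sqrt n := Nat.cast_nonneg _
    have hq : ((S * S : ℕ) : ℝ) = (S : ℝ) ^ 2 := by push_cast; ring
    generalize (Nat.sqrt n : ℝ) = r at *
    generalize Real.cos (Real.pi / 2 ^ (k + 1)) = x at *
    generalize Real.sin (Real.pi / 2 ^ (k + 1 + 1)) = y at *
    generalize (cosApx (S * S) k : ℝ) = c at *
    generalize ((S * S : ℕ) : ℝ) = q at *
    generalize (S : ℝ) = s at *
    have hq0 : 0 < q := by rw [hq]; positivity
    have hz : (q * y) ^ 2 = q * (q - q * x) / 2 := by linear_combination q ^ 2 / 2 * hy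
    have ih1 := mul_le_mul_of_nonneg_left ih.1 hq0.le
    have ih2 := mul_le_mul_of_nonneg_left ih.2 hq0.le
    have hc1 : (q - c) * q / 2 ≤ (q * y) ^ 2 + 2 * q := by linarith
    have hc2 : (q * y) ^ 2 - 2 * q ≤ (q - c) * q / 2 := by linarith
    have hqy : 0 ≤ q * y := by positivity
    generalize q * y = z at *
    rw [abs_le]
    constructor
    · by_contra hlt
      push Not at hlt
      have : (r + 1) ^ 2 ≤ (z - 2 * s) ^ 2 := pow_le_pow_left₀ (by linarith) (by linarith) 2
      nlinarith
    · by_contra hlt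
      push Not at hlt
      have : (z + 2 * s) ^ 2 ≤ r ^ 2 := pow_le_pow_left₀ (by positivity) (by linarith) 2
      nlinarith

/-- The fixed-point approximation of `theta k`. -/
def thetaApx (S k : ℕ) : GaussianInt :=
  ⟨((cosApx (S * S) k / S : ℕ) : ℤ), ((sinApx (S * S) k / S : ℕ) : ℤ)⟩

/-- The bound is `(1 + 4) + (1 + 3)`: in each coordinate a rounding error `1` plus the error of
`cosApx` or `sinApx` after division by `S`. -/
theorem norm_thetaApx_sub_le {S : ℕ} (hS : 2 ∣ S) (hS5 : 5 ≤ S) (k : ℕ) :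
    ‖(thetaApx S k : ℂ) - S * theta k‖ ≤ 9 := by
  have hS5' : (5 : ℝ) ≤ S := by exact_mod_cast hS5
  have hS0 : (0 : ℝ) < S := by linarith
  have hc := abs_cosApx_sub_le (hS.mul_left S) (by nlinarith) k
  have hs := abs_sinApx_sub_le hS hS5 k
  have fc := abs_floor_div_sub_le (S := S) (by omega) (cosApx (S * S) k : ℤ)
  have fs := abs_floor_div_sub_le (S := S) (by omega) (sinApx (S * S) k : ℤ)
  rw [theta, Complex.exp_mul_I, ← Complex.ofReal_cos, ← Complex.ofReal_sin]
  generalize Real.cos (Real.pi / 2 ^ (k + 1)) = x at *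
  generalize Real.sin (Real.pi / 2 ^ (k + 1)) = y at *
  refine (Complex.norm_le_abs_re_add_abs_im _).trans ?_
  have e1 : ((thetaApx S k : ℂ) - S * (x + y * Complex.I)).re =
      (((cosApx (S * S) k : ℤ) / (S : ℤ) : ℤ) : ℝ) - S * x := by
    simp [thetaApx, GaussianInt.toComplex_def]
  have e2 : ((thetaApx S k : ℂ) - S * (x + y * Complex.I)).im =
      (((sinApx (S * S) k : ℤ) / (S : ℤ) : ℤ) : ℝ) - S * y := by
    simp [thetaApx, GaussianInt.toComplex_def]
  rw [e1, e2]
  have key : ∀ (n : ℕ) (z b : ℝ), |(n : ℝ) - ((S * S : ℕ) : ℝ) * z| ≤ b * S →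
      |(((n : ℤ) / (S : ℤ) : ℤ) : ℝ) - (n : ℤ) / S| ≤ 1 →
      |(((n : ℤ) / (S : ℤ) : ℤ) : ℝ) - S * z| ≤ 1 + b := by
    intro n z b h1 h2
    have h3 : |((n : ℤ) : ℝ) / S - S * z| ≤ b := by
      have : ((n : ℤ) : ℝ) / S - S * z = ((n : ℝ) - ((S * S : ℕ) : ℝ) * z) / S := by
        push_cast; field_simp
      rw [this, abs_div, abs_of_pos hS0, div_le_iff₀ hS0]
      exact h1
    calc _ ≤ _ := abs_sub_le _ (((n : ℤ) : ℝ) / S) _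
      _ ≤ 1 + b := add_le_add h2 h3
  have k1 := key _ x 4 (hc.trans (by linarith)) fc
  have k2 := key _ y 3 (hs.trans (by linarith)) fs
  linarith

/-- The fixed-point approximation of `psi k b`. -/
def psiApx (S : ℕ) : ℕ → ℕ → GaussianInt
  | 0, _ => S
  | k + 1, b => if b / 2 ^ k % 2 = 1 then rnd S (thetaApx S k * psiApx S k b) else psiApx S k b

/-- Each factor adds at most `9 * (1 + 1) + 2 = 20` by `norm_rnd_mul_sub_le`, as both factors lie on
the unit circle. -/
theorem norm_psiApx_sub_le {S : ℕ} (hS : 2 ∣ S) (hS5 : 5 ≤ S) (b : ℕ) : ∀ k, 20 * k ≤ S →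
    ‖(psiApx S k b : ℂ) - S * psi k b‖ ≤ 20 * k
  | 0, _ => by simp [psiApx, psi]
  | k + 1, hk => by
    have ih := norm_psiApx_sub_le hS hS5 b k (by omega)
    rw [psiApx, psi_succ]
    have hk' : (20 * k : ℝ) ≤ S := by exact_mod_cast (show 20 * k ≤ S by omega)
    split_ifs
    · have := norm_rnd_mul_sub_le (by omega) (norm_thetaApx_sub_le hS hS5 k) ih
        (norm_theta k).le (norm_psi k b).le hk'
      rw [mul_comm (psi k b)]
      push_cast
      linarith
    · rw [mul_one]
      push_cast
      linarith

end FFT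

namespace FFT

/-! ### Products of polynomials with coefficients `0` and `1` -/

section Indicator

open Polynomial

/-- The polynomial whose coefficients are the indicator function of `W` on `{0, …, d}`. -/
noncomputable def indicator (d : ℕ) (W : ℕ → Prop) [DecidablePred W] : ℕ[X] :=
  ∑ j ∈ Finset.range (d + 1), if W j then X ^ j else 0

variable {d : ℕ} {W : ℕ → Prop} [DecidablePred W]

theorem coeff_indicator (hW : ∀ j, W j → j ≤ d) (j : ℕ) :
    (indicator d W).coeff j = if W j then 1 else 0 := by
  rw [indicator, finsetSum_coeff]
  have : ∀ i, (if W i then (X : ℕ[X]) ^ i else 0).coeff j =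
      if j = i then if W j then 1 else 0 else 0 := by
    intro i
    by_cases h : j = i
    · subst h
      by_cases h : W j <;> simp [h]
    · by_cases h' : W i <;> simp [h', h, coeff_X_pow]
  simp only [this, Finset.sum_ite_eq, Finset.mem_range]
  split_ifs with h1 h2 h2
  · rfl
  · rfl
  · exact absurd (hW j h2) (by omega)
  · rfl

theorem natDegree_indicator_le (hW : ∀ j, W j → j ≤ d) : (indicator d W).natDegree ≤ d := by
  rw [natDegree_le_iff_coeff_eq_zero]
  intro j hj
  rw [coeff_indicator hW, if_neg fun h => absurd (hW j h) (by omega)]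

/-- Natural coefficients cannot cancel, so the support of a product is the sumset of the supports.
-/
theorem coeff_mul_mul_ne_zero_iff (p q : ℕ[X]) (k : ℕ) : (p * p * q).coeff k ≠ 0 ↔
    ∃ x₁ x₂ a, p.coeff x₁ ≠ 0 ∧ p.coeff x₂ ≠ 0 ∧ q.coeff a ≠ 0 ∧ x₁ + x₂ + a = k := by
  simp only [coeff_mul, ne_eq, Finset.sum_eq_zero_iff, Prod.forall,
    mul_eq_zero, not_forall, not_or, exists_prop]
  constructor
  · rintro ⟨y, a, h1, ⟨x₁, x₂, h2, h3, h4⟩, h5⟩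
    rw [Finset.HasAntidiagonal.mem_antidiagonal] at h1 h2
    exact ⟨x₁, x₂, a, h3, h4, h5, by rw [h2, h1]⟩
  · rintro ⟨x₁, x₂, a, h3, h4, h5, h6⟩
    exact ⟨x₁ + x₂, a, Finset.HasAntidiagonal.mem_antidiagonal.2 h6,
      ⟨x₁, x₂, Finset.HasAntidiagonal.mem_antidiagonal.2 rfl, h3, h4⟩, h5⟩

end Indicator

/-! ### Transforms with fixed precision -/

/-- The scale `N ^ 12` of the fixed-point numbers for transforms of length `N = 2 ^ L`. -/
def scale (L : ℕ) : ℕ := (2 ^ L) ^ 12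

/-- The table of twiddle factors. -/
def twiddle (L : ℕ) : ℕ → GaussianInt := psiApx (scale L) L

/-- The forward transform after `ℓ` levels. -/
def fwdApx (L : ℕ) (g : ℕ → GaussianInt) (ℓ : ℕ) : ℕ → GaussianInt :=
  fwd (rmul (scale L) (twiddle L)) L g ℓ

/-- The inverse transform after `ℓ` levels. -/
def invApx (L : ℕ) (g : ℕ → GaussianInt) (ℓ : ℕ) : ℕ → GaussianInt :=
  inv (rmul (scale L) fun b => star (twiddle L b)) g ℓ

/-- The pointwise product of the transforms of `gx`, `gx` and `gy`. -/
def mulApx (L : ℕ) (gx gy : ℕ → GaussianInt) (b : ℕ) : GaussianInt :=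
  rnd (scale L) (rnd (scale L) (fwdApx L gx L b * fwdApx L gx L b) * fwdApx L gy L b)

/-! ### Error and size bounds at the scale `N ^ 12` -/

section Precision

variable {L : ℕ}

/-- Successive powers of `N = 2 ^ L` differ by a factor of at least `16`. With these inequalities as
input, all later comparisons of polynomials in `N` are linear in the powers of `N`. -/
theorem sixteen_mul_pow_le (hL : 4 ≤ L) (k : ℕ) : 16 * ((2 : ℝ) ^ L) ^ k ≤ (2 ^ L) ^ (k + 1) := by
  have : (16 : ℝ) ≤ 2 ^ L := by
    calc (16 : ℝ) = 2 ^ 4 := by norm_num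
      _ ≤ 2 ^ L := pow_le_pow_right₀ one_le_two hL
  rw [pow_succ, mul_comm]
  exact mul_le_mul_of_nonneg_left this (by positivity)

theorem sixteen_le_two_pow (hL : 4 ≤ L) : 16 ≤ 2 ^ L := by
  calc 16 = 2 ^ 4 := by norm_num
    _ ≤ 2 ^ L := Nat.pow_le_pow_right two_pos hL

theorem scale_pos : 0 < scale L := by unfold scale; positivity

theorem two_dvd_scale (hL : 4 ≤ L) : 2 ∣ scale L :=
  dvd_pow (dvd_pow_self 2 (by omega)) (by norm_num)

theorem two_pow_le_scale : 2 ^ L ≤ scale L := Nat.le_self_pow (by norm_num) _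

theorem cast_scale : (scale L : ℝ) = (2 ^ L) ^ 12 := by simp [scale]

theorem norm_twiddle_sub_le (hL : 4 ≤ L) (b : ℕ) :
    ‖(twiddle L b : ℂ) - scale L * psi L b‖ ≤ (2 ^ L) ^ 3 := by
  have hN := sixteen_le_two_pow hL
  have hLN : L < 2 ^ L := Nat.lt_two_pow_self
  have h1 : 20 * L ≤ (2 ^ L) ^ 3 := by
    calc 20 * L ≤ 256 * 2 ^ L := by omega
      _ = 16 * 16 * 2 ^ L := by ring
      _ ≤ 2 ^ L * 2 ^ L * 2 ^ L := by gcongr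
      _ = _ := by ring
  have h2 : (2 ^ L) ^ 3 ≤ scale L := Nat.pow_le_pow_right (by positivity) (by norm_num)
  refine (norm_psiApx_sub_le (two_dvd_scale hL) ?_ b L (h1.trans h2)).trans (by exact_mod_cast h1)
  have := two_pow_le_scale (L := L)
  omega

theorem norm_star_twiddle_sub_le (hL : 4 ≤ L) (b : ℕ) :
    ‖((star (twiddle L b) : GaussianInt) : ℂ) - scale L * star (psi L b)‖ ≤ (2 ^ L) ^ 3 := by
  have h := norm_twiddle_sub_le hL b
  rw [← norm_star] at h
  refine le_trans (le_of_eq ?_) h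
  rw [GaussianInt.toComplex_star, star_sub, star_mul']
  simp

theorem norm_star_psi (b : ℕ) : ‖star (psi L b)‖ = 1 := by rw [norm_star, norm_psi]

section Forward

variable {g : ℕ → GaussianInt} {a : ℕ → ℂ} (hg : ∀ j < 2 ^ L, (g j : ℂ) = scale L * a j)
  (ha : ∀ j < 2 ^ L, ‖a j‖ ≤ 1)

include hg ha

/-- The error budget is kept in crude powers of `N`: `N ^ 3` for the twiddle factors, `N ^ 6` after
a forward transform, `N ^ 8` after squaring, `N ^ 10` after the triple product, and finally `N ^ 12
/ 4`, a quarter of the scale, during the inverse transform. -/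
theorem fwdApx_close (hL : 4 ≤ L) {ℓ : ℕ} (hℓ : ℓ ≤ L) {j : ℕ} (hj : j < 2 ^ L) :
    ‖(fwdApx L g ℓ j : ℂ) - scale L * fwd (fun b x => psi L b * x) L a ℓ j‖ ≤ (2 ^ L) ^ 6 ∧
      ‖fwd (fun b x => psi L b * x) L a ℓ j‖ ≤ 2 ^ L := by
  have pw := sixteen_mul_pow_le hL
  have h1 : (1 : ℝ) ≤ 2 ^ L := one_le_pow₀ one_le_two
  have hpow : (2 : ℝ) ^ ℓ ≤ 2 ^ L := pow_le_pow_right₀ one_le_two hℓ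
  obtain ⟨h2, h3⟩ := fwd_close scale_pos (fun b _ => norm_twiddle_sub_le hL b) (norm_psi L) hg ha
    (by
      rw [cast_scale]
      have := pw 1; have := pw 2; have := pw 3; have := pw 4; have := pw 5; have := pw 6
      have := pw 7; have := pw 8; have := pw 9; have := pw 10; have := pw 11
      generalize (2 : ℝ) ^ L = n at *
      simp only [Nat.reduceAdd] at *
      linarith) ℓ hℓ j hj
  refine ⟨h2.trans ?_, h3.trans hpow⟩
  calc _ ≤ ((2 : ℝ) ^ L) * ((2 ^ L) ^ 3 * (2 ^ L + 1) + 2) :=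
        mul_le_mul_of_nonneg_right (by linarith) (by positivity)
    _ ≤ _ := by
      have := pw 1; have := pw 2; have := pw 3; have := pw 4; have := pw 5
      generalize (2 : ℝ) ^ L = n at *
      simp only [Nat.reduceAdd] at *
      linarith

/-- Before a product can be rounded, its coordinates have to be read off from its code, and this
requires a norm below half of the base `N ^ 32`. The same bound reappears for every number that the
program rounds, conjugates or compares. -/
theorem norm_twiddle_mul_fwdApx_lt (hL : 4 ≤ L) {ℓ : ℕ} (hℓ : ℓ ≤ L) {j : ℕ} (hj : j < 2 ^ L)
    (b : ℕ) : ‖((twiddle L b * fwdApx L g ℓ j : GaussianInt) : ℂ)‖ < (2 ^ L) ^ 32 / 2 := by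
  obtain ⟨h1, h2⟩ := fwdApx_close hg ha hL hℓ hj
  have h0 : (1 : ℝ) ≤ 2 ^ L := one_le_pow₀ one_le_two
  refine (norm_mul_le_of_close (norm_twiddle_sub_le hL b) h1 (norm_psi L b).le h2 ?_ ?_).trans_lt ?_
  · rw [cast_scale]; exact pow_le_pow_right₀ h0 (by norm_num)
  · rw [cast_scale]; exact pow_le_pow_right₀ h0 (by norm_num)
  · rw [cast_scale]
    have pw := sixteen_mul_pow_le hL
    have := pw 24; have := pw 25; have := pw 26; have := pw 27; have := pw 28
    have := pw 29; have := pw 30; have := pw 31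
    have hp : 0 < ((2 : ℝ) ^ L) ^ 24 := by positivity
    generalize (2 : ℝ) ^ L = n at *
    simp only [Nat.reduceAdd] at *
    linarith

end Forward

section Product

variable {gx gy : ℕ → GaussianInt} {ax ay : ℕ → ℂ}
  (hgx : ∀ j < 2 ^ L, (gx j : ℂ) = scale L * ax j) (hax : ∀ j < 2 ^ L, ‖ax j‖ ≤ 1)
  (hgy : ∀ j < 2 ^ L, (gy j : ℂ) = scale L * ay j) (hay : ∀ j < 2 ^ L, ‖ay j‖ ≤ 1)

include hgx hax

theorem norm_sq_fwdApx_lt (hL : 4 ≤ L) {b : ℕ} (hb : b < 2 ^ L) :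
    ‖((fwdApx L gx L b * fwdApx L gx L b : GaussianInt) : ℂ)‖ < (2 ^ L) ^ 32 / 2 := by
  obtain ⟨h1, h2⟩ := fwdApx_close hgx hax hL le_rfl hb
  have h0 : (1 : ℝ) ≤ 2 ^ L := one_le_pow₀ one_le_two
  have h3 : ((2 : ℝ) ^ L) ^ 6 ≤ scale L := by
    rw [cast_scale]; exact pow_le_pow_right₀ h0 (by norm_num)
  refine (norm_mul_le_of_close h1 h1 h2 h2 h3 h3).trans_lt ?_
  rw [cast_scale]
  have pw := sixteen_mul_pow_le hL
  have := pw 24; have := pw 25; have := pw 26; have := pw 27; have := pw 28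
  have := pw 29; have := pw 30; have := pw 31
  have hp : 0 < ((2 : ℝ) ^ L) ^ 24 := by positivity
  generalize (2 : ℝ) ^ L = n at *
  simp only [Nat.reduceAdd] at *
  linarith

theorem rnd_sq_close (hL : 4 ≤ L) {b : ℕ} (hb : b < 2 ^ L) :
    ‖(rnd (scale L) (fwdApx L gx L b * fwdApx L gx L b) : ℂ) - scale L *
      (fwd (fun b x => psi L b * x) L ax L b * fwd (fun b x => psi L b * x) L ax L b)‖ ≤
        (2 ^ L) ^ 8 ∧
      ‖fwd (fun b x => psi L b * x) L ax L b * fwd (fun b x => psi L b * x) L ax L b‖ ≤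
        (2 ^ L) ^ 2 := by
  obtain ⟨h1, h2⟩ := fwdApx_close hgx hax hL le_rfl hb
  have h0 : (1 : ℝ) ≤ 2 ^ L := one_le_pow₀ one_le_two
  have h3 : ((2 : ℝ) ^ L) ^ 6 ≤ scale L := by
    rw [cast_scale]; exact pow_le_pow_right₀ h0 (by norm_num)
  refine ⟨(norm_rnd_mul_sub_le scale_pos h1 h1 h2 h2 h3).trans ?_, ?_⟩
  · have pw := sixteen_mul_pow_le hL
    have := pw 0; have := pw 1; have := pw 2; have := pw 3; have := pw 4; have := pw 5
    have := pw 6; have := pw 7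
    generalize (2 : ℝ) ^ L = n at *
    simp only [Nat.reduceAdd] at *
    linarith
  · rw [norm_mul, sq]
    exact mul_le_mul h2 h2 (norm_nonneg _) (by positivity)

include hgy hay

theorem norm_rnd_sq_mul_lt (hL : 4 ≤ L) {b : ℕ} (hb : b < 2 ^ L) :
    ‖((rnd (scale L) (fwdApx L gx L b * fwdApx L gx L b) * fwdApx L gy L b : GaussianInt) : ℂ)‖ <
      (2 ^ L) ^ 32 / 2 := by
  obtain ⟨h1, h2⟩ := rnd_sq_close hgx hax hL hb
  obtain ⟨h3, h4⟩ := fwdApx_close hgy hay hL le_rfl hb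
  have h0 : (1 : ℝ) ≤ 2 ^ L := one_le_pow₀ one_le_two
  refine (norm_mul_le_of_close h1 h3 h2 h4 ?_ ?_).trans_lt ?_
  · rw [cast_scale]; exact pow_le_pow_right₀ h0 (by norm_num)
  · rw [cast_scale]; exact pow_le_pow_right₀ h0 (by norm_num)
  · rw [cast_scale]
    have pw := sixteen_mul_pow_le hL
    have := pw 24; have := pw 25; have := pw 26; have := pw 27; have := pw 28
    have := pw 29; have := pw 30; have := pw 31
    have hp : 0 < ((2 : ℝ) ^ L) ^ 24 := by positivity
    generalize (2 : ℝ) ^ L = n at *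
    simp only [Nat.reduceAdd] at *
    linarith

theorem mulApx_close (hL : 4 ≤ L) {b : ℕ} (hb : b < 2 ^ L) :
    ‖(mulApx L gx gy b : ℂ) - scale L *
      (fwd (fun b x => psi L b * x) L ax L b * fwd (fun b x => psi L b * x) L ax L b *
        fwd (fun b x => psi L b * x) L ay L b)‖ ≤ (2 ^ L) ^ 10 ∧
      ‖fwd (fun b x => psi L b * x) L ax L b * fwd (fun b x => psi L b * x) L ax L b *
        fwd (fun b x => psi L b * x) L ay L b‖ ≤ (2 ^ L) ^ 3 := by
  obtain ⟨h1, h2⟩ := rnd_sq_close hgx hax hL hb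
  obtain ⟨h3, h4⟩ := fwdApx_close hgy hay hL le_rfl hb
  have h0 : (1 : ℝ) ≤ 2 ^ L := one_le_pow₀ one_le_two
  have h5 : ((2 : ℝ) ^ L) ^ 6 ≤ scale L := by
    rw [cast_scale]; exact pow_le_pow_right₀ h0 (by norm_num)
  refine ⟨(norm_rnd_mul_sub_le scale_pos h1 h3 h2 h4 h5).trans ?_, ?_⟩
  · have pw := sixteen_mul_pow_le hL
    have := pw 0; have := pw 1; have := pw 2; have := pw 3; have := pw 4; have := pw 5
    have := pw 6; have := pw 7; have := pw 8; have := pw 9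
    generalize (2 : ℝ) ^ L = n at *
    simp only [Nat.reduceAdd] at *
    linarith
  · rw [norm_mul, pow_succ _ 2]
    exact mul_le_mul h2 h4 (norm_nonneg _) (by positivity)

theorem invApx_close (hL : 4 ≤ L) {ℓ : ℕ} (hℓ : ℓ ≤ L) {j : ℕ} (hj : j < 2 ^ L) :
    ‖(invApx L (mulApx L gx gy) ℓ j : ℂ) - scale L * inv (fun b x => star (psi L b) * x)
      (fun b => fwd (fun b x => psi L b * x) L ax L b * fwd (fun b x => psi L b * x) L ax L b *
        fwd (fun b x => psi L b * x) L ay L b) ℓ j‖ ≤ (2 ^ L) ^ 12 / 4 ∧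
      ‖inv (fun b x => star (psi L b) * x)
      (fun b => fwd (fun b x => psi L b * x) L ax L b * fwd (fun b x => psi L b * x) L ax L b *
        fwd (fun b x => psi L b * x) L ay L b) ℓ j‖ ≤ (2 ^ L) ^ 4 := by
  have pw := sixteen_mul_pow_le hL
  have hpow : (2 : ℝ) ^ ℓ ≤ 2 ^ L := pow_le_pow_right₀ one_le_two hℓ
  have hb : (2 : ℝ) ^ L * ((2 ^ L) ^ 10 + ((2 ^ L) ^ 3 * (2 ^ L * (2 ^ L) ^ 3 + 1) + 2)) ≤
      (2 ^ L) ^ 12 / 4 := by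
    have := pw 0; have := pw 1; have := pw 2; have := pw 3; have := pw 4; have := pw 5
    have := pw 6; have := pw 7; have := pw 8; have := pw 9; have := pw 10; have := pw 11
    generalize (2 : ℝ) ^ L = n at *
    simp only [Nat.reduceAdd] at *
    linarith
  have hp12 : (0 : ℝ) ≤ (2 ^ L) ^ 12 := by positivity
  obtain ⟨h2, h3⟩ := inv_close (L := L) scale_pos (fun b _ => norm_star_twiddle_sub_le hL b)
    norm_star_psi (fun j hj => (mulApx_close hgx hax hgy hay hL hj).1)
    (fun j hj => (mulApx_close hgx hax hgy hay hL hj).2) (by rw [cast_scale]; linarith) ℓ hℓ j hj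
  refine ⟨h2.trans (le_trans ?_ hb), h3.trans ?_⟩
  · refine (sub_le_self _ (by positivity)).trans ?_
    exact mul_le_mul_of_nonneg_right hpow (by positivity)
  · rw [pow_succ' _ 3]
    exact mul_le_mul_of_nonneg_right hpow (by positivity)

theorem norm_invApx_lt (hL : 4 ≤ L) {ℓ : ℕ} (hℓ : ℓ ≤ L) {j : ℕ} (hj : j < 2 ^ L) :
    ‖(invApx L (mulApx L gx gy) ℓ j : ℂ)‖ < (2 ^ L) ^ 32 / 2 := by
  obtain ⟨h1, h2⟩ := invApx_close hgx hax hgy hay hL hℓ hj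
  have hp : 0 < ((2 : ℝ) ^ L) ^ 12 := by positivity
  refine (norm_le_of_close h1 h2 ?_).trans_lt ?_
  · rw [cast_scale]; linarith
  · rw [cast_scale]
    have pw := sixteen_mul_pow_le hL
    have h17 : ((2 : ℝ) ^ L) ^ 17 ≤ (2 ^ L) ^ 32 :=
      pow_le_pow_right₀ (one_le_pow₀ one_le_two) (by norm_num)
    have := pw 12; have := pw 13; have := pw 14; have := pw 15; have := pw 16
    generalize (2 : ℝ) ^ L = n at *
    simp only [Nat.reduceAdd] at *
    linarith

theorem norm_star_twiddle_mul_lt (hL : 4 ≤ L) {ℓ : ℕ} (hℓ : ℓ ≤ L) {i j : ℕ} (hi : i < 2 ^ L)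
    (hj : j < 2 ^ L) (b : ℕ) :
    ‖((star (twiddle L b) * (invApx L (mulApx L gx gy) ℓ i - invApx L (mulApx L gx gy) ℓ j) :
      GaussianInt) : ℂ)‖ < (2 ^ L) ^ 32 / 2 := by
  obtain ⟨h1, h2⟩ := invApx_close hgx hax hgy hay hL hℓ hi
  obtain ⟨h3, h4⟩ := invApx_close hgx hax hgy hay hL hℓ hj
  have hp : 0 < ((2 : ℝ) ^ L) ^ 12 := by positivity
  have h0 : (1 : ℝ) ≤ 2 ^ L := one_le_pow₀ one_le_two
  rw [GaussianInt.toComplex_mul, norm_mul]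
  have k1 : ‖((star (twiddle L b) : GaussianInt) : ℂ)‖ ≤ scale L * (1 + 1) :=
    norm_le_of_close (norm_star_twiddle_sub_le hL b) (norm_star_psi b).le
      (by rw [cast_scale]; exact pow_le_pow_right₀ h0 (by norm_num))
  have k2 := norm_le_of_close h1 h2 (by rw [cast_scale]; linarith)
  have k3 := norm_le_of_close h3 h4 (by rw [cast_scale]; linarith)
  have k4 := norm_sub_le (invApx L (mulApx L gx gy) ℓ i : ℂ) (invApx L (mulApx L gx gy) ℓ j : ℂ)
  rw [← GaussianInt.toComplex_sub] at k4
  refine (mul_le_mul k1 (k4.trans (add_le_add k2 k3)) (norm_nonneg _) (by positivity)).trans_lt ?_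
  rw [cast_scale]
  have pw := sixteen_mul_pow_le hL
  have := pw 24; have := pw 25; have := pw 26; have := pw 27; have := pw 28
  have := pw 29; have := pw 30; have := pw 31
  have hp : 0 < ((2 : ℝ) ^ L) ^ 24 := by positivity
  generalize (2 : ℝ) ^ L = n at *
  simp only [Nat.reduceAdd] at *
  linarith

end Product

open Polynomial in
/-- The fixed-point transforms find the nonzero coefficients of a product. -/
theorem coeff_ne_zero_iff_re_invApx (hL : 4 ≤ L) (p q : ℕ[X]) (hp1 : ∀ j, p.coeff j ≤ 1)
    (hq1 : ∀ j, q.coeff j ≤ 1) (hp : p.natDegree < 2 ^ L) (hq : q.natDegree < 2 ^ L)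
    (hpq : p.natDegree + p.natDegree + q.natDegree < 2 ^ L) {j : ℕ} (hj : j < 2 ^ L) :
    (p * p * q).coeff j ≠ 0 ↔ (2 ^ L) ^ 13 / 2 ≤ (invApx L (mulApx L
      (fun j => (scale L : GaussianInt) * p.coeff j)
      (fun j => (scale L : GaussianInt) * q.coeff j)) L j).re := by
  have hc : ∀ f : ℕ[X], ∀ j, (((scale L : GaussianInt) * f.coeff j : GaussianInt) : ℂ) =
      scale L * (f.map (Nat.castRingHom ℂ)).coeff j := by
    intro f j; simp
  have hn : ∀ f : ℕ[X], (∀ j, f.coeff j ≤ 1) → ∀ j, ‖(f.map (Nat.castRingHom ℂ)).coeff j‖ ≤ 1 := by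
    intro f hf j
    rw [coeff_map, eq_natCast, Complex.norm_natCast]
    exact_mod_cast hf j
  have hmul : (p.map (Nat.castRingHom ℂ)) * (p.map (Nat.castRingHom ℂ)) *
      (q.map (Nat.castRingHom ℂ)) = (p * p * q).map (Nat.castRingHom ℂ) := by simp
  obtain ⟨h1, -⟩ := invApx_close (fun j _ => hc p j) (fun j _ => hn p hp1 j) (fun j _ => hc q j)
    (fun j _ => hn q hq1 j) hL le_rfl hj
  have hdeg : (p * p * q).natDegree < 2 ^ L :=
    (natDegree_mul_le.trans (Nat.add_le_add_right natDegree_mul_le _)).trans_lt hpq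
  rw [inv_mul_eq_coeff (fun b hb => psi_two_mul_sq hb) (fun b hb => psi_two_mul_add_one_sq hb)
    (star_psi_mul_psi L) _ _ (natDegree_map_le.trans_lt hp) (natDegree_map_le.trans_lt hq)
    (by rw [hmul]; exact natDegree_map_le.trans_lt hdeg) hj, hmul, coeff_map, eq_natCast] at h1
  generalize (p * p * q).coeff j = c at *
  generalize invApx L _ L j = z at *
  have h2 := abs_le.1 ((Complex.abs_re_le_norm _).trans h1)
  have h3 : ((z : ℂ) - scale L * (2 ^ L * c)).re = z.re - scale L * (2 ^ L * c) := by
    rw [Complex.sub_re, ← GaussianInt.intCast_re]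
    congr 1
    exact_mod_cast Complex.natCast_re (scale L * (2 ^ L * c))
  rw [h3, cast_scale] at h2
  have pw := sixteen_mul_pow_le hL 12
  have h4 : (2 ^ L) ^ 13 / 2 ≤ z.re ↔ (2 : ℝ) ^ L * (2 ^ L) ^ 12 / 2 ≤ z.re := by
    rw [← pow_succ']
    have h2 : (2 : ℤ) ∣ (2 ^ L) ^ 13 := dvd_pow (dvd_pow_self 2 (by omega)) (by norm_num)
    rw [← Int.cast_le (R := ℝ), Int.cast_div h2 (by norm_num)]
    push_cast
    rfl
  rw [h4]
  have hp12 : (0 : ℝ) < (2 ^ L) ^ 12 := by positivity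
  -- The exact value is `N ^ 13 * c` with a natural number `c`, and the error is at most `N ^ 12 /
  -- 4`, far below the threshold `N ^ 13 / 2`.
  constructor
  · intro h
    have hc1 : (1 : ℝ) ≤ c := by exact_mod_cast Nat.one_le_iff_ne_zero.2 h
    have : (2 : ℝ) ^ L * (2 ^ L) ^ 12 * 1 ≤ 2 ^ L * (2 ^ L) ^ 12 * c :=
      mul_le_mul_of_nonneg_left hc1 (by positivity)
    rw [pow_succ' _ 12] at pw
    linarith
  · rintro h rfl
    rw [pow_succ' _ 12] at pw
    simp only [Nat.cast_zero, mul_zero, sub_zero] at h2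
    linarith

end Precision

/-! ### Gaussian integers as residues -/

/-- The ring homomorphism that maps `i` to `I`, where `I ^ 2 = -1` modulo `I * I + 1`. -/
def encHom (I : ℕ) : GaussianInt →+* ZMod (I * I + 1) :=
  Zsqrtd.lift ⟨(I : ZMod (I * I + 1)), by
    have h : ((I * I + 1 : ℕ) : ZMod (I * I + 1)) = 0 := ZMod.natCast_self _
    push_cast at h ⊢
    linear_combination h⟩

/-- The residue of `z` as a natural number. -/
def enc (I : ℕ) (z : GaussianInt) : ℕ := (encHom I z).val

section Enc

variable {I H S : ℕ} {z z' : GaussianInt}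

theorem encHom_apply : encHom I z = z.re + z.im * I := by
  simp [encHom, Zsqrtd.lift]

theorem enc_lt : enc I z < I * I + 1 := ZMod.val_lt _

theorem natCast_enc : (enc I z : ZMod (I * I + 1)) = encHom I z := ZMod.natCast_zmod_val _

/-- Reduces each statement about codes to an identity in `ZMod (I * I + 1)`, where `I ^ 2 = -1`. -/
theorem mod_eq_enc {n : ℕ} (h : (n : ZMod (I * I + 1)) = encHom I z) :
    n % (I * I + 1) = enc I z := by
  rw [enc, ← h, ZMod.val_natCast]

theorem natCast_modulus : ((I * I + 1 : ℕ) : ZMod (I * I + 1)) = 0 := ZMod.natCast_self _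

theorem enc_natCast {n : ℕ} (hn : n < I * I + 1) : enc I (n : GaussianInt) = n := by
  rw [← mod_eq_enc (n := n) (by rw [map_natCast]), Nat.mod_eq_of_lt hn]

theorem enc_add : (enc I z + enc I z') % (I * I + 1) = enc I (z + z') :=
  mod_eq_enc (by rw [Nat.cast_add, natCast_enc, natCast_enc, map_add])

theorem enc_mul : (enc I z * enc I z') % (I * I + 1) = enc I (z * z') :=
  mod_eq_enc (by rw [Nat.cast_mul, natCast_enc, natCast_enc, map_mul])

/-- Subtracting from the modulus first keeps truncated subtraction exact. -/
theorem enc_sub : (enc I z + (I * I + 1 - enc I z')) % (I * I + 1) = enc I (z - z') :=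
  mod_eq_enc (by
    rw [Nat.cast_add, Nat.cast_sub enc_lt.le, natCast_enc, natCast_enc, map_sub, natCast_modulus,
      zero_sub, sub_eq_add_neg])

/-- Adding `H + H * I` makes both coordinates nonnegative, so that they can be read off. -/
theorem enc_shift {x y : ℕ} (hx : (x : ℤ) = z.re + H) (hy : (y : ℤ) = z.im + H)
    (hxI : x < I) (hyI : y < I) : (enc I z + (H * I + H)) % (I * I + 1) = x + y * I := by
  have h1 : x + y * I < I * I + 1 := by nlinarith
  rw [← Nat.mod_eq_of_lt h1]
  refine (ZMod.natCast_eq_natCast_iff' _ _ _).1 ?_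
  rw [Nat.cast_add, natCast_enc, encHom_apply]
  have hx' : (x : ZMod (I * I + 1)) = z.re + H := by
    exact_mod_cast congrArg (Int.cast (R := ZMod (I * I + 1))) hx
  have hy' : (y : ZMod (I * I + 1)) = z.im + H := by
    exact_mod_cast congrArg (Int.cast (R := ZMod (I * I + 1))) hy
  push_cast
  rw [hx', hy']
  ring

theorem exists_shift (hI : I = 2 * H) (hz : ‖(z : ℂ)‖ < H) : ∃ x y : ℕ, (x : ℤ) = z.re + H ∧
    (y : ℤ) = z.im + H ∧ x < I ∧ y < I := by
  have h1 := abs_lt.1 ((Complex.abs_re_le_norm _).trans_lt hz)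
  have h2 := abs_lt.1 ((Complex.abs_im_le_norm _).trans_lt hz)
  rw [← GaussianInt.intCast_re] at h1
  rw [← GaussianInt.intCast_im] at h2
  have a1 : -(H : ℤ) < z.re := by exact_mod_cast h1.1
  have a2 : z.re < (H : ℤ) := by exact_mod_cast h1.2
  have a3 : -(H : ℤ) < z.im := by exact_mod_cast h2.1
  have a4 : z.im < (H : ℤ) := by exact_mod_cast h2.2
  exact ⟨(z.re + H).toNat, (z.im + H).toNat, by omega, by omega, by omega, by omega⟩

/-- Since `S` divides `H`, the offset passes through the floor division: `(r + H) / S = r / S + H /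
S`. So the shifted, nonnegative coordinates can be divided as natural numbers and the offset is
removed afterwards. -/
theorem enc_rnd (hS : 0 < S) (hSH : S ∣ H) {x y : ℕ} (hx : (x : ℤ) = z.re + H)
    (hy : (y : ℤ) = z.im + H) (hHI : H / S * I + H / S ≤ I * I + 1) :
    (x / S + y / S * I + (I * I + 1 - (H / S * I + H / S))) % (I * I + 1) =
      enc I (rnd S z) := by
  have key : ∀ (n : ℕ) (r : ℤ), (n : ℤ) = r + H →
      ((n / S : ℕ) : ZMod (I * I + 1)) = ((r / S : ℤ) : ZMod (I * I + 1)) + (H / S : ℕ) := by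
    intro n r h
    obtain ⟨k, rfl⟩ := hSH
    rw [Nat.mul_div_cancel_left _ hS]
    have h' : ((n / S : ℕ) : ℤ) = r / S + k := by
      rw [Int.natCast_ediv, h]
      push_cast
      rw [Int.add_mul_ediv_left _ _ (by omega)]
    exact_mod_cast congrArg (Int.cast (R := ZMod (I * I + 1))) h'
  refine mod_eq_enc ?_
  rw [Nat.cast_add, Nat.cast_sub hHI, natCast_modulus, encHom_apply]
  push_cast
  rw [key x _ hx, key y _ hy]
  simp only [rnd]
  ring

/-- The shifted coordinates give `(re + H) - (im + H) * I`, and adding `H * I - H` cancels the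
offset. -/
theorem enc_star {x y : ℕ} (hx : (x : ℤ) = z.re + H) (hy : (y : ℤ) = z.im + H)
    (hyI : y ≤ I) (hHI : H ≤ H * I) :
    (x + (I * I + 1 - y * I) + (H * I - H)) % (I * I + 1) = enc I (star z) := by
  have h1 : y * I ≤ I * I + 1 := (Nat.mul_le_mul_right I hyI).trans (Nat.le_succ _)
  have hx' : (x : ZMod (I * I + 1)) = z.re + H := by
    exact_mod_cast congrArg (Int.cast (R := ZMod (I * I + 1))) hx
  have hy' : (y : ZMod (I * I + 1)) = z.im + H := by
    exact_mod_cast congrArg (Int.cast (R := ZMod (I * I + 1))) hy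
  refine mod_eq_enc ?_
  rw [Nat.cast_add, Nat.cast_add, Nat.cast_sub h1, Nat.cast_sub hHI, natCast_modulus, encHom_apply]
  push_cast
  rw [hx', hy', Zsqrtd.re_star, Zsqrtd.im_star]
  push_cast
  ring

end Enc

end FFT

namespace WordRAM

open FFT

instance : Add Expr := ⟨Expr.op .add⟩
instance : Sub Expr := ⟨Expr.op .sub⟩
instance : Mul Expr := ⟨Expr.op .mul⟩
instance : Div Expr := ⟨Expr.op .div⟩
instance : Mod Expr := ⟨Expr.op .mod⟩

theorem Expr.cost_div (a b : Expr) : (a / b).cost = a.cost + b.cost + 1 := rfl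

/-! ### Arithmetic of Gaussian integers on the word RAM

Register `20` holds the length `N = 2 ^ L` of the arrays. The registers `21` to `26` hold the
scale and the numbers that are needed for arithmetic with coded Gaussian integers. -/

/-- The code of `i`. -/
def base (L : ℕ) : ℕ := (2 ^ L) ^ 32

/-- Half of the code of `i`. -/
def half (L : ℕ) : ℕ := base L / 2

/-- The modulus. -/
def modulus (L : ℕ) : ℕ := base L * base L + 1

/-- The registers that hold the parameters of the arithmetic. -/
structure Globals (L : ℕ) (σ : State) : Prop where
  length : σ.reg 20 = 2 ^ L
  scale : σ.reg 21 = scale L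
  base : σ.reg 22 = base L
  modulus : σ.reg 23 = modulus L
  shift : σ.reg 24 = half L * WordRAM.base L + half L
  unshift : σ.reg 25 = half L / FFT.scale L * WordRAM.base L + half L / FFT.scale L
  conj : σ.reg 26 = half L * WordRAM.base L - half L

theorem Globals.congr {L : ℕ} {σ τ : State} (h : Globals L σ)
    (hr : ∀ r, 20 ≤ r → τ.reg r = σ.reg r) : Globals L τ where
  length := by rw [hr _ (by norm_num), h.length]
  scale := by rw [hr _ (by norm_num), h.scale]
  base := by rw [hr _ (by norm_num), h.base]
  modulus := by rw [hr _ (by norm_num), h.modulus]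
  shift := by rw [hr _ (by norm_num), h.shift]
  unshift := by rw [hr _ (by norm_num), h.unshift]
  conj := by rw [hr _ (by norm_num), h.conj]

/-- The words are long enough. -/
structure Wide (w L : ℕ) : Prop where
  four_le : 4 ≤ L
  pow_le : (2 ^ L) ^ 200 ≤ 2 ^ w

section Wide

variable {w L : ℕ}

theorem base_eq (hL : 4 ≤ L) : base L = 2 * half L :=
  (Nat.mul_div_cancel' (dvd_pow (dvd_pow_self 2 (by omega)) (by norm_num))).symm

theorem scale_dvd_half (hL : 4 ≤ L) : scale L ∣ half L := by
  refine (Nat.dvd_div_iff_mul_dvd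
    (dvd_pow (dvd_pow_self 2 (by omega)) (by norm_num))).2 ?_
  have h2 : 2 ∣ (2 ^ L) ^ 20 := dvd_pow (dvd_pow_self 2 (by omega)) (by norm_num)
  calc 2 * scale L ∣ (2 ^ L) ^ 20 * scale L := Nat.mul_dvd_mul_right h2 _
    _ = base L := by rw [scale, base, ← pow_add]

theorem cast_half (hL : 4 ≤ L) : (half L : ℝ) = (2 ^ L) ^ 32 / 2 := by
  have h : (base L : ℝ) = 2 * half L := by exact_mod_cast base_eq hL
  have h2 : (base L : ℝ) = (2 ^ L) ^ 32 := by simp [base]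
  linarith

theorem Wide.two_pow_lt (h : Wide w L) : 16 ≤ 2 ^ L := sixteen_le_two_pow h.four_le

theorem Wide.pos (h : Wide w L) : 0 < w := by
  rcases Nat.eq_zero_or_pos w with rfl | hw
  · have h1 := h.pow_le
    have h2 : 2 ^ L ≤ (2 ^ L) ^ 200 := Nat.le_self_pow (by norm_num) _
    have := h.two_pow_lt
    rw [pow_zero] at h1
    omega
  · exact hw

theorem Wide.pow_lt (h : Wide w L) {k : ℕ} (hk : k < 200) : (2 ^ L) ^ k < 2 ^ w :=
  (Nat.pow_lt_pow_right (by have := h.two_pow_lt; omega) hk).trans_le h.pow_le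

theorem modulus_le (hL : 4 ≤ L) : 16 * modulus L ≤ (2 ^ L) ^ 66 := by
  have hN := sixteen_le_two_pow hL
  have h1 : 1 ≤ (2 ^ L) ^ 64 := Nat.one_le_pow _ _ (by positivity)
  calc 16 * modulus L = 16 * ((2 ^ L) ^ 64 + 1) := by rw [modulus, base, ← pow_add]
    _ ≤ 16 * (16 * (2 ^ L) ^ 64) := by omega
    _ ≤ 2 ^ L * (2 ^ L * (2 ^ L) ^ 64) := by gcongr
    _ = _ := by ring

theorem base_le_modulus : base L ≤ modulus L := by
  unfold modulus
  have : base L ≤ base L * base L := Nat.le_mul_of_pos_right _ (by unfold base; positivity)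
  omega

theorem two_pow_le_base : 2 ^ L ≤ base L := Nat.le_self_pow (by norm_num) _

theorem scale_le_modulus : scale L ≤ modulus L :=
  le_trans (Nat.pow_le_pow_right (by positivity) (by norm_num)) base_le_modulus

theorem Wide.modulus_sq_lt (h : Wide w L) : modulus L * modulus L < 2 ^ w := by
  have h1 := modulus_le h.four_le
  calc modulus L * modulus L ≤ (2 ^ L) ^ 66 * (2 ^ L) ^ 66 := by gcongr <;> omega
    _ = (2 ^ L) ^ 132 := by rw [← pow_add]
    _ < 2 ^ w := h.pow_lt (by norm_num)

/-- The factor `16` leaves room for the sums of a few codes that are formed before a remainder is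
taken. -/
theorem Wide.modulus_lt (h : Wide w L) : 16 * modulus L < 2 ^ w :=
  (modulus_le h.four_le).trans_lt (h.pow_lt (by norm_num))

theorem Wide.length_lt (h : Wide w L) : 16 * 2 ^ L < 2 ^ w := by
  have h1 := h.modulus_lt
  have h2 := two_pow_le_base (L := L)
  have h3 := base_le_modulus (L := L)
  omega

theorem shift_le (hL : 4 ≤ L) : half L * base L + half L ≤ modulus L := by
  have h1 := base_eq hL
  have h2 : half L ≤ half L * base L := Nat.le_mul_of_pos_right _ (by unfold base; positivity)
  have h3 : half L * base L + half L * base L = base L * base L := by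
    conv_rhs => rw [h1]
    conv_lhs => rw [h1]
    ring
  unfold modulus
  omega

theorem unshift_le (hL : 4 ≤ L) :
    half L / scale L * base L + half L / scale L ≤ modulus L := by
  refine le_trans ?_ (shift_le hL)
  have := Nat.div_le_self (half L) (scale L)
  gcongr

end Wide

/-- `σ` evaluates `e` to the code of `z`. -/
def EvalsTo (w L : ℕ) (σ : State) (e : Expr) (z : GaussianInt) : Prop :=
  e.eval w σ = some (enc (base L) z)

namespace Expr

/-- Sum of coded Gaussian integers. -/
def gadd (a b : Expr) : Expr := (a + b) % .reg 23

/-- Difference of coded Gaussian integers. -/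
def gsub (a b : Expr) : Expr := (a + (.reg 23 - b)) % .reg 23

/-- Product of coded Gaussian integers. -/
def gmul (a b : Expr) : Expr := a * b % .reg 23

/-- The code with both coordinates made nonnegative. -/
def gshift (a : Expr) : Expr := (a + .reg 24) % .reg 23

/-- Rounded division of a coded Gaussian integer by the scale. -/
def grnd (a : Expr) : Expr :=
  (gshift a % .reg 22 / .reg 21 + gshift a / .reg 22 / .reg 21 * .reg 22 + (.reg 23 - .reg 25)) %
    .reg 23

/-- Conjugate of a coded Gaussian integer. -/
def gstar (a : Expr) : Expr :=
  (gshift a % .reg 22 + (.reg 23 - gshift a / .reg 22 * .reg 22) + .reg 26) % .reg 23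

end Expr

section Arithmetic

variable {w L : ℕ} {σ : State} {a b c : Expr} {z z' : GaussianInt}

theorem enc_lt_modulus : enc (base L) z < modulus L := enc_lt

theorem eval_modulus (hw : Wide w L) (h : Globals L σ) :
    (Expr.reg 23).eval w σ = some (modulus L) :=
  eval_reg h.modulus (by have := hw.modulus_lt; omega)

theorem eval_base (hw : Wide w L) (h : Globals L σ) : (Expr.reg 22).eval w σ = some (base L) :=
  eval_reg h.base (by have := hw.modulus_lt; have := base_le_modulus (L := L); omega)

theorem eval_scale (hw : Wide w L) (h : Globals L σ) :
    (Expr.reg 21).eval w σ = some (FFT.scale L) :=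
  eval_reg h.scale (by have := hw.modulus_lt; have := scale_le_modulus (L := L); omega)

theorem eval_length (hw : Wide w L) (h : Globals L σ) : (Expr.reg 20).eval w σ = some (2 ^ L) :=
  eval_reg h.length (by have := hw.length_lt; omega)

theorem EvalsTo.gadd (hw : Wide w L) (h : Globals L σ) (ha : EvalsTo w L σ a z)
    (hb : EvalsTo w L σ b z') : EvalsTo w L σ (Expr.gadd a b) (z + z') := by
  have h1 := enc_lt_modulus (L := L) (z := z)
  have h2 := enc_lt_modulus (L := L) (z := z')
  have h3 := hw.modulus_lt
  rw [EvalsTo, ← enc_add]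
  exact eval_mod (eval_add ha hb (by omega)) (eval_modulus hw h)

theorem EvalsTo.gsub (hw : Wide w L) (h : Globals L σ) (ha : EvalsTo w L σ a z)
    (hb : EvalsTo w L σ b z') : EvalsTo w L σ (Expr.gsub a b) (z - z') := by
  have h1 := enc_lt_modulus (L := L) (z := z)
  have h2 := enc_lt_modulus (L := L) (z := z')
  have h3 := hw.modulus_lt
  have h4 : modulus L = base L * base L + 1 := rfl
  rw [EvalsTo, ← enc_sub]
  exact eval_mod (eval_add ha (eval_sub (eval_modulus hw h) hb) (by omega)) (eval_modulus hw h)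

theorem EvalsTo.gmul (hw : Wide w L) (h : Globals L σ) (ha : EvalsTo w L σ a z)
    (hb : EvalsTo w L σ b z') : EvalsTo w L σ (Expr.gmul a b) (z * z') := by
  have h1 := enc_lt_modulus (L := L) (z := z)
  have h2 := enc_lt_modulus (L := L) (z := z')
  have h3 := hw.modulus_sq_lt
  rw [EvalsTo, ← enc_mul]
  exact eval_mod (eval_mul ha hb ((Nat.mul_le_mul h1.le h2.le).trans_lt h3)) (eval_modulus hw h)

theorem eval_gshift (hw : Wide w L) (h : Globals L σ) (ha : EvalsTo w L σ a z) {x y : ℕ}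
    (hx : (x : ℤ) = z.re + half L) (hy : (y : ℤ) = z.im + half L) (hxI : x < base L)
    (hyI : y < base L) : (Expr.gshift a).eval w σ = some (x + y * base L) := by
  have h1 := enc_lt_modulus (L := L) (z := z)
  have h3 := hw.modulus_lt
  have h4 := shift_le hw.four_le
  rw [← enc_shift hx hy hxI hyI]
  exact eval_mod (eval_add ha (eval_reg h.shift (by omega)) (by omega)) (eval_modulus hw h)

theorem add_mul_base_mod {x y : ℕ} (hx : x < base L) : (x + y * base L) % base L = x := by
  rw [Nat.add_mul_mod_self_right, Nat.mod_eq_of_lt hx]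

theorem add_mul_base_div {x y : ℕ} (hx : x < base L) : (x + y * base L) / base L = y := by
  rw [Nat.add_mul_div_right _ _ (by omega), Nat.div_eq_of_lt hx, zero_add]

theorem mul_base_le_modulus {y : ℕ} (hy : y < base L) : y * base L ≤ modulus L :=
  (Nat.mul_le_mul_right _ hy.le).trans (Nat.le_succ _)

theorem EvalsTo.grnd (hw : Wide w L) (h : Globals L σ) (ha : EvalsTo w L σ a z)
    (hz : ‖(z : ℂ)‖ < (2 ^ L) ^ 32 / 2) :
    EvalsTo w L σ (Expr.grnd a) (rnd (FFT.scale L) z) := by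
  rw [← cast_half hw.four_le] at hz
  obtain ⟨x, y, hx, hy, hxI, hyI⟩ := exists_shift (base_eq hw.four_le) hz
  have hs := eval_gshift hw h ha hx hy hxI hyI
  have h3 := hw.modulus_lt
  have h4 := unshift_le hw.four_le
  have h5 := base_le_modulus (L := L)
  have e1 := eval_div (eval_mod hs (eval_base hw h)) (eval_scale hw h)
  have e2 := eval_div (eval_div hs (eval_base hw h)) (eval_scale hw h)
  rw [add_mul_base_mod hxI] at e1
  rw [add_mul_base_div hxI] at e2
  have h6 : x / FFT.scale L ≤ x := Nat.div_le_self _ _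
  have h7 : y / FFT.scale L ≤ y := Nat.div_le_self _ _
  have h8 : y / FFT.scale L * base L ≤ modulus L := mul_base_le_modulus (h7.trans_lt hyI)
  rw [EvalsTo, ← enc_rnd (I := base L) scale_pos (scale_dvd_half hw.four_le) hx hy h4]
  exact eval_mod (eval_add (eval_add e1 (eval_mul e2 (eval_base hw h) (by omega)) (by omega))
    (eval_sub (eval_modulus hw h) (eval_reg h.unshift (by omega)))
    ((Nat.add_le_add_left (Nat.sub_le _ _) _).trans_lt (by change _ + modulus L < _; omega)))
    (eval_modulus hw h)

theorem EvalsTo.gstar (hw : Wide w L) (h : Globals L σ) (ha : EvalsTo w L σ a z)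
    (hz : ‖(z : ℂ)‖ < (2 ^ L) ^ 32 / 2) : EvalsTo w L σ (Expr.gstar a) (star z) := by
  rw [← cast_half hw.four_le] at hz
  obtain ⟨x, y, hx, hy, hxI, hyI⟩ := exists_shift (base_eq hw.four_le) hz
  have hs := eval_gshift hw h ha hx hy hxI hyI
  have h3 := hw.modulus_lt
  have h4 := shift_le hw.four_le
  have h5 := base_le_modulus (L := L)
  have e1 := eval_mod hs (eval_base hw h)
  have e2 := eval_div hs (eval_base hw h)
  rw [add_mul_base_mod hxI] at e1
  rw [add_mul_base_div hxI] at e2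
  have h8 : y * base L ≤ modulus L := mul_base_le_modulus hyI
  have h9 : half L * base L - half L ≤ modulus L := by omega
  have hM : modulus L = base L * base L + 1 := rfl
  rw [EvalsTo, ← enc_star (I := base L) hx hy hyI.le
    (Nat.le_mul_of_pos_right _ (by unfold base; positivity))]
  exact eval_mod (eval_add (eval_add e1 (eval_sub (eval_modulus hw h)
    (eval_mul e2 (eval_base hw h) (by omega)))
    ((Nat.add_le_add_left (Nat.sub_le _ _) _).trans_lt (by omega)))
    (eval_reg h.conj (by omega))
    ((Nat.add_le_add_right (Nat.add_le_add_left (Nat.sub_le _ _) _) _).trans_lt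
      (by omega))) (eval_modulus hw h)

theorem EvalsTo.select (hw : Wide w L) {p : Prop} [Decidable p]
    (hc : c.eval w σ = some (if p then 1 else 0)) (ha : EvalsTo w L σ a z)
    (hb : EvalsTo w L σ b z') :
    EvalsTo w L σ (Expr.select c a b) (if p then z else z') := by
  have := eval_select hw.pos p hc ha hb
  rw [EvalsTo, this]
  split_ifs <;> rfl

end Arithmetic

/-! ### Arrays of Gaussian integers -/

/-- The array with index `k` holds the codes of the Gaussian integers `g j`. -/
def Holds (L : ℕ) (σ : State) (k : ℕ) (g : ℕ → GaussianInt) : Prop :=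
  ∀ j < 2 ^ L, σ.mem (k * 2 ^ L + j) = enc (base L) (g j)

/-- The arrays whose index is not in `s` are the same in `σ` and `τ`. -/
def SameArrays (L : ℕ) (s : Set ℕ) (σ τ : State) : Prop :=
  ∀ i, i ∉ s → ∀ j < 2 ^ L, τ.mem (i * 2 ^ L + j) = σ.mem (i * 2 ^ L + j)

/-- The registers whose index is not in `s` are the same in `σ` and `τ`. -/
def SameRegs (s : Set ℕ) (σ τ : State) : Prop := ∀ r, r ∉ s → τ.reg r = σ.reg r

section Arrays

variable {w L k : ℕ} {σ τ υ : State} {e : Expr} {g h : ℕ → GaussianInt} {s s' : Set ℕ}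

theorem SameArrays.trans (h : SameArrays L s σ τ) (h' : SameArrays L s τ υ) :
    SameArrays L s σ υ := fun i hi j hj => (h' i hi j hj).trans (h i hi j hj)

theorem SameArrays.mono (h : SameArrays L s σ τ) (hs : s ⊆ s') : SameArrays L s' σ τ :=
  fun i hi => h i fun h' => hi (hs h')

theorem SameArrays.of_mem_eq (h : τ.mem = σ.mem) : SameArrays L s σ τ := fun _ _ _ _ => by rw [h]

theorem SameRegs.trans (h : SameRegs s σ τ) (h' : SameRegs s τ υ) : SameRegs s σ υ :=
  fun r hr => (h' r hr).trans (h r hr)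

theorem SameRegs.mono (h : SameRegs s σ τ) (hs : s ⊆ s') : SameRegs s' σ τ :=
  fun i hi => h i fun h' => hi (hs h')

theorem SameRegs.update {i x : ℕ} (hi : i ∈ s) :
    SameRegs s σ { σ with reg := Function.update σ.reg i x } := by
  intro r hr
  have : r ≠ i := fun h => hr (h ▸ hi)
  simp [this]

theorem Holds.congr (h : Holds L σ k g) (h' : SameArrays L s σ τ) (hk : k ∉ s) : Holds L τ k g :=
  fun j hj => (h' k hk j hj).trans (h j hj)

theorem Globals.of_sameRegs (h : Globals L σ) (h' : SameRegs s σ τ) (hs : ∀ r ∈ s, r < 20) :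
    Globals L τ := h.congr fun r hr => h' r fun h'' => absurd (hs r h'') (by omega)

theorem Holds.evalsTo_cell (hw : Wide w L) (hG : Globals L σ) (hk : k ≤ 14) (h : Holds L σ k g)
    {x : ℕ} (he : e.eval w σ = some x) (hx : x < 2 ^ L) : EvalsTo w L σ (.cell k e) (g x) := by
  have h1 := hw.length_lt
  have h2 : (k + 1) * 2 ^ L ≤ 15 * 2 ^ L := Nat.mul_le_mul_right _ (by omega)
  have h3 := hw.modulus_lt
  have h4 := enc_lt_modulus (L := L) (z := g x)
  exact eval_cell hG.length (by omega) (by positivity) he hx (h x hx) (by omega)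

theorem runs_fill_array (f : ℕ → ℕ) (hw : Wide w L) (hG : Globals L σ) (hk : k ≤ 14)
    (he : ∀ j < 2 ^ L, ∀ σ' : State, σ'.reg 2 = j → SameRegs {2} σ σ' → SameArrays L {k} σ σ' →
      σ'.mem (k * 2 ^ L + j) = σ.mem (k * 2 ^ L + j) → e.eval w σ' = some (f j)) :
    Runs w (.fill k e) σ (2 ^ L * (e.cost + 40)) fun τ => SameRegs {2} σ τ ∧
      (∀ j < 2 ^ L, τ.mem (k * 2 ^ L + j) = f j) ∧ SameArrays L {k} σ τ := by
  have h1 := hw.length_lt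
  have h2 : (k + 1) * 2 ^ L ≤ 15 * 2 ^ L := Nat.mul_le_mul_right _ (by omega)
  have h3 := hw.two_pow_lt
  have h4 : ∀ i, i ≠ k → ∀ j < 2 ^ L,
      i * 2 ^ L + j < k * 2 ^ L ∨ (k + 1) * 2 ^ L ≤ i * 2 ^ L + j := by
    intro i hi j hj
    rcases lt_or_gt_of_ne hi with hi | hi
    · have := Nat.mul_le_mul_right (2 ^ L) hi
      rw [Nat.succ_mul] at this
      omega
    · have := Nat.mul_le_mul_right (2 ^ L) (show k + 1 ≤ i from hi)
      exact Or.inr (by omega)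
  refine Runs.mono (runs_fill f hG.length (by omega) (by positivity) fun j hj σ' h5 h6 h7 =>
    he j hj σ' h5 h6 (fun i hi j' hj' => h7 _ ?_) (h7 _ (by omega))) ?_ ?_
  · have := h4 i hi j' hj'
    rw [Nat.succ_mul] at this
    omega
  · rw [Nat.mul_add, Nat.mul_add]
    omega
  · rintro τ ⟨h5, h6, h7⟩
    exact ⟨h5, h6, fun i hi j hj => h7 _ (h4 i hi j hj)⟩

/-- Compute the values of `e` in the auxiliary array `7`, then copy them into the array `k`. -/
def Prog.refill (k : ℕ) (e : Expr) : Prog := .seq (.fill 7 e) (.fill k (.cell 7 (.reg 2)))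

/-- An entry of a transform level depends on two positions, one of which an in-place pass would
already have overwritten; hence the detour through array `7`. -/
theorem runs_refill (g : ℕ → GaussianInt) (hw : Wide w L) (hG : Globals L σ) (hk : k ≤ 6)
    (he : ∀ j < 2 ^ L, ∀ σ' : State, σ'.reg 2 = j → SameRegs {2} σ σ' → SameArrays L {7} σ σ' →
      EvalsTo w L σ' e (g j)) :
    Runs w (.refill k e) σ (2 ^ L * (e.cost + 100)) fun τ => SameRegs {2} σ τ ∧
      Holds L τ k g ∧ SameArrays L {k, 7} σ τ := by
  have h1 := hw.length_lt
  refine Runs.mono (Runs.seq (runs_fill_array (fun j => enc (base L) (g j)) hw hG (by norm_num)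
    fun j hj σ' h5 h6 h7 _ => he j hj σ' h5 h6 h7) fun τ hτ => Runs.mono
    (runs_fill_array (k := k) (fun j => enc (base L) (g j)) hw (hG.of_sameRegs hτ.1 (by simp))
      (by omega) fun j hj σ' h5 h6 h7 _ => ?_) le_rfl fun υ hυ => ⟨hτ.1.trans hυ.1, hυ.2.1,
      (hτ.2.2.mono (by simp)).trans (hυ.2.2.mono (by simp))⟩) ?_ fun _ h => h
  · have hG' : Globals L σ' := (hG.of_sameRegs hτ.1 (by simp)).of_sameRegs h6 (by simp)
    have hH : Holds L σ' 7 g := Holds.congr (σ := τ) hτ.2.1 h7 (by simp; omega)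
    exact hH.evalsTo_cell hw hG' (by norm_num) (eval_reg h5 (by omega)) hj
  · rw [← Nat.mul_add]
    refine Nat.mul_le_mul_left _ ?_
    simp [Expr.cell, Expr.cost]

end Arrays

end WordRAM

namespace WordRAM

open FFT

/-! ### The transforms on the word RAM

Register `3` holds the width `m` of the butterflies; array `2` holds the twiddle factors and
array `3` their conjugates. -/

namespace Expr

/-- The block of the position in register `2`. -/
def block : Expr := .reg 2 / (.const 2 * .reg 3)

/-- The first index of the butterfly. -/
def fst : Expr := block * (.const 2 * .reg 3) + .reg 2 % .reg 3

/-- The second index of the butterfly. -/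
def snd : Expr := fst + .reg 3

/-- Whether the position in register `2` is the first index of its butterfly. -/
def isFst : Expr := .op .lt (.reg 2 % (.const 2 * .reg 3)) (.reg 3)

/-- One entry of a level of the forward transform of the array `k`. -/
def fwdEntry (k : ℕ) : Expr :=
  select isFst (gadd (cell k fst) (grnd (gmul (cell 2 block) (cell k snd))))
    (gsub (cell k fst) (grnd (gmul (cell 2 block) (cell k snd))))

/-- One entry of a level of the inverse transform of the array `k`. -/
def invEntry (k : ℕ) : Expr :=
  select isFst (gadd (cell k fst) (cell k snd))
    (grnd (gmul (cell 3 block) (gsub (cell k fst) (cell k snd))))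

end Expr

/-- The forward transform of the array `k`. -/
def Prog.fwd (k : ℕ) : Prog :=
  .seq (.set 3 (.reg 20 / .const 2))
    (.loop (.reg 3) (.seq (.refill k (.fwdEntry k)) (.set 3 (.reg 3 / .const 2))))

/-- The inverse transform of the array `k`. -/
def Prog.inv (k : ℕ) : Prog :=
  .seq (.set 3 (.const 1))
    (.loop (.op .lt (.reg 3) (.reg 20))
      (.seq (.refill k (.invEntry k)) (.set 3 (.const 2 * .reg 3))))

section Transforms

variable {w L k : ℕ} {σ : State} {g : ℕ → GaussianInt}

section Index

variable {j e : ℕ} (hw : Wide w L) (h2 : σ.reg 2 = j) (hj : j < 2 ^ L) (h3 : σ.reg 3 = 2 ^ e)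
  (he : e < L)

include hw h2 hj h3 he

theorem eval_indices :
    Expr.block.eval w σ = some (j / (2 * 2 ^ e)) ∧ Expr.fst.eval w σ = some (lo (2 ^ e) j) ∧
    Expr.snd.eval w σ = some (lo (2 ^ e) j + 2 ^ e) ∧
    Expr.isFst.eval w σ = some (if j % (2 * 2 ^ e) < 2 ^ e then 1 else 0) := by
  have hN := hw.length_lt
  have hlt := lo_add_lt he hj
  have hm : 2 * 2 ^ e ≤ 2 ^ L := by
    rw [← pow_succ']; exact Nat.pow_le_pow_right two_pos he
  have hlo : lo (2 ^ e) j = j / (2 * 2 ^ e) * (2 * 2 ^ e) + j % 2 ^ e := rfl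
  have e2 : (Expr.reg 2).eval w σ = some j := eval_reg h2 (by omega)
  have e3 : (Expr.reg 3).eval w σ = some (2 ^ e) := eval_reg h3 (by omega)
  have e4 := eval_mul (eval_const (w := w) (σ := σ) (x := 2) (by omega)) e3 (by omega)
  have e5 := eval_div e2 e4
  have e6 : Expr.fst.eval w σ = some (lo (2 ^ e) j) :=
    eval_add (eval_mul e5 e4 (by omega)) (eval_mod e2 e3) (by omega)
  exact ⟨e5, e6, eval_add e6 e3 (by omega), eval_lt hw.pos (eval_mod e2 e4) e3⟩

end Index

theorem evalsTo_fwdEntry (hw : Wide w L) (hG : Globals L σ) (hk : k ≤ 6) {j e : ℕ}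
    (h2 : σ.reg 2 = j) (hj : j < 2 ^ L) (h3 : σ.reg 3 = 2 ^ e) (he : e < L)
    (hΨ : Holds L σ 2 (twiddle L)) (hg : Holds L σ k g)
    (hb : ∀ b, ∀ i < 2 ^ L, ‖((twiddle L b * g i : GaussianInt) : ℂ)‖ < (2 ^ L) ^ 32 / 2) :
    EvalsTo w L σ (.fwdEntry k) (fwdStep (rmul (scale L) (twiddle L)) (2 ^ e) g j) := by
  obtain ⟨e1, e2, e3, e4⟩ := eval_indices hw h2 hj h3 he
  have hlt := lo_add_lt he hj
  have g1 := hg.evalsTo_cell hw hG (by omega) e2 (by omega)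
  have g2 := hg.evalsTo_cell hw hG (by omega) e3 hlt
  have g3 := hΨ.evalsTo_cell hw hG (by norm_num) e1 ((Nat.div_le_self _ _).trans_lt hj)
  have g4 := (g3.gmul hw hG g2).grnd hw hG (hb _ _ hlt)
  exact EvalsTo.select hw e4 (g1.gadd hw hG g4) (g1.gsub hw hG g4)

theorem evalsTo_invEntry (hw : Wide w L) (hG : Globals L σ) (hk : k ≤ 6) {j e : ℕ}
    (h2 : σ.reg 2 = j) (hj : j < 2 ^ L) (h3 : σ.reg 3 = 2 ^ e) (he : e < L)
    (hΨ : Holds L σ 3 fun b => star (twiddle L b)) (hg : Holds L σ k g)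
    (hb : ∀ b, ∀ i < 2 ^ L, ∀ i' < 2 ^ L,
      ‖((star (twiddle L b) * (g i - g i') : GaussianInt) : ℂ)‖ < (2 ^ L) ^ 32 / 2) :
    EvalsTo w L σ (.invEntry k)
      (invStep (rmul (scale L) fun b => star (twiddle L b)) (2 ^ e) g j) := by
  obtain ⟨e1, e2, e3, e4⟩ := eval_indices hw h2 hj h3 he
  have hlt := lo_add_lt he hj
  have g1 := hg.evalsTo_cell hw hG (by omega) e2 (by omega)
  have g2 := hg.evalsTo_cell hw hG (by omega) e3 hlt
  have g3 := hΨ.evalsTo_cell hw hG (by norm_num) e1 ((Nat.div_le_self _ _).trans_lt hj)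
  have g4 := (g3.gmul hw hG (g1.gsub hw hG g2)).grnd hw hG (hb _ _ (by omega) _ hlt)
  exact EvalsTo.select hw e4 (g1.gadd hw hG g2) g4

/-- The cost depends only on the shape of the expression, so it evaluates by computation although
`k` is a variable. -/
theorem cost_fwdEntry : (Expr.fwdEntry k).cost ≤ 300 := Nat.le_of_ble_eq_true rfl

theorem cost_invEntry : (Expr.invEntry k).cost ≤ 300 := Nat.le_of_ble_eq_true rfl

theorem two_pow_div_two_div {i : ℕ} (hi : i < L) :
    2 ^ L / 2 / 2 ^ i = 2 ^ (L - 1 - i) := by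
  rw [Nat.div_div_eq_div_mul, ← pow_succ', Nat.pow_div (by omega) two_pos]
  congr 1
  omega

theorem two_pow_div_two_div_self : 2 ^ L / 2 / 2 ^ L = 0 := by
  have : 0 < 2 ^ L := by positivity
  exact Nat.div_eq_of_lt (by omega)

theorem div_two_pow_succ (n i : ℕ) : n / 2 ^ (i + 1) = n / 2 ^ i / 2 := by
  rw [pow_succ, Nat.div_div_eq_div_mul]

/-- Register `3` runs through the widths `2 ^ (L - 1 - i)` and becomes `0` after exactly `L`
halvings, which ends the loop. The hypothesis `hb` is what makes each rounding decodable. -/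
theorem runs_fwd (hw : Wide w L) (hG : Globals L σ) (hk : k ≤ 6) (hk2 : k ≠ 2)
    (hΨ : Holds L σ 2 (twiddle L)) (hg : Holds L σ k g)
    (hb : ∀ ℓ < L, ∀ b, ∀ i < 2 ^ L,
      ‖((twiddle L b * fwdApx L g ℓ i : GaussianInt) : ℂ)‖ < (2 ^ L) ^ 32 / 2) :
    Runs w (.fwd k) σ (2 ^ L * L * 500) fun τ => SameRegs {2, 3} σ τ ∧
      Holds L τ k (fwdApx L g L) ∧ SameArrays L {k, 7} σ τ := by
  have hL := hw.four_le
  have hN := hw.length_lt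
  have hN16 := hw.two_pow_lt
  refine Runs.mono (Runs.seq (Q := fun τ => SameRegs {2, 3} σ τ ∧ τ.reg 3 = 2 ^ L / 2 ∧
      τ.mem = σ.mem)
    (Runs.set (eval_div (eval_length hw hG) (eval_const (x := 2) (by omega)))
      ⟨SameRegs.update (by simp), by simp, rfl⟩)
    fun σ₀ h₀ => Runs.loop (fun i τ => SameRegs {2, 3} σ τ ∧ τ.reg 3 = 2 ^ L / 2 / 2 ^ i ∧
      Holds L τ k (fwdApx L g i) ∧ SameArrays L {k, 7} σ τ) L (2 ^ L * 400 + 4) ?_ ?_ ?_) ?_ ?_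
  · have hs : SameArrays L {k, 7} σ σ₀ := .of_mem_eq h₀.2.2
    exact ⟨h₀.1, by simpa using h₀.2.1, fun j hj => by rw [h₀.2.2]; exact hg j hj, hs⟩
  · rintro i hi τ ⟨hr, h3, hH, ha⟩
    rw [two_pow_div_two_div hi] at h3
    have hGτ : Globals L τ := hG.of_sameRegs hr (by simp)
    have hm : 2 ^ (L - 1 - i) ≤ 2 ^ L := Nat.pow_le_pow_right two_pos (by omega)
    refine ⟨⟨_, eval_reg h3 (by omega), by positivity⟩, ?_⟩
    refine Runs.mono (Runs.seq (runs_refill (k := k) (fwdApx L g (i + 1)) hw hGτ hk ?_)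
      fun υ hυ => Runs.set (x := 2 ^ L / 2 / 2 ^ (i + 1)) ?_ ?_) ?_ fun _ h => h
    · intro j hj σ' h2 hr' ha'
      refine evalsTo_fwdEntry hw (hGτ.of_sameRegs hr' (by simp)) hk h2 hj
        (by rw [hr' 3 (by simp), h3]) (by omega) ((hΨ.congr ha ?_).congr ha' (by simp))
        (hH.congr ha' (by simp; omega)) (hb i hi)
      simp; omega
    · rw [div_two_pow_succ, two_pow_div_two_div hi]
      exact eval_div (eval_reg (by rw [hυ.1 3 (by simp), h3]) (by omega))
        (eval_const (x := 2) (by omega))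
    · refine ⟨(hr.trans (hυ.1.mono (by simp))).trans (SameRegs.update (by simp)), by simp, ?_,
        ha.trans hυ.2.2⟩
      exact hυ.2.1
    · have := cost_fwdEntry (k := k)
      have : 2 ^ L * ((Expr.fwdEntry k).cost + 100) ≤ 2 ^ L * 400 :=
        Nat.mul_le_mul_left _ (by omega)
      exact Nat.add_le_add this (Nat.le_of_ble_eq_true rfl)
  · rintro τ ⟨hr, h3, -⟩
    rw [two_pow_div_two_div_self] at h3
    exact eval_reg h3 (by positivity)
  · simp only [Expr.cost_div, Expr.cost]
    have : 2 ^ L * L * 500 = L * (2 ^ L * 400) + L * (2 ^ L * 100) := by ring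
    have h4 : L * 16 ≤ L * (2 ^ L * 100) := Nat.mul_le_mul_left _ (by omega)
    rw [this, Nat.mul_add, Nat.mul_add, Nat.mul_add]
    omega
  · rintro τ ⟨hr, -, hH, ha⟩
    exact ⟨hr, hH, ha⟩

theorem runs_inv (hw : Wide w L) (hG : Globals L σ) (hk : k ≤ 6) (hk3 : k ≠ 3)
    (hΨ : Holds L σ 3 fun b => star (twiddle L b)) (hg : Holds L σ k g)
    (hb : ∀ ℓ < L, ∀ b, ∀ i < 2 ^ L, ∀ i' < 2 ^ L,
      ‖((star (twiddle L b) * (invApx L g ℓ i - invApx L g ℓ i') : GaussianInt) : ℂ)‖ <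
        (2 ^ L) ^ 32 / 2) :
    Runs w (.inv k) σ (2 ^ L * L * 500) fun τ => SameRegs {2, 3} σ τ ∧
      Holds L τ k (invApx L g L) ∧ SameArrays L {k, 7} σ τ := by
  have hL := hw.four_le
  have hN := hw.length_lt
  have hN16 := hw.two_pow_lt
  refine Runs.mono (Runs.seq (Q := fun τ => SameRegs {2, 3} σ τ ∧ τ.reg 3 = 1 ∧
      τ.mem = σ.mem)
    (Runs.set (eval_const (x := 1) (by omega)) ⟨SameRegs.update (by simp), by simp, rfl⟩)
    fun σ₀ h₀ => Runs.loop (fun i τ => SameRegs {2, 3} σ τ ∧ τ.reg 3 = 2 ^ i ∧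
      Holds L τ k (invApx L g i) ∧ SameArrays L {k, 7} σ τ) L (2 ^ L * 400 + 4) ?_ ?_ ?_) ?_ ?_
  · have hs : SameArrays L {k, 7} σ σ₀ := .of_mem_eq h₀.2.2
    exact ⟨h₀.1, by simpa using h₀.2.1, fun j hj => by rw [h₀.2.2]; exact hg j hj, hs⟩
  · rintro i hi τ ⟨hr, h3, hH, ha⟩
    have hGτ : Globals L τ := hG.of_sameRegs hr (by simp)
    have hm : 2 ^ i < 2 ^ L := Nat.pow_lt_pow_right one_lt_two hi
    have e3 := eval_lt hw.pos (eval_reg (w := w) h3 (by omega)) (eval_length hw hGτ)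
    rw [if_pos hm] at e3
    refine ⟨⟨_, e3, one_ne_zero⟩, ?_⟩
    refine Runs.mono (Runs.seq (runs_refill (k := k) (invApx L g (i + 1)) hw hGτ hk ?_)
      fun υ hυ => Runs.set (x := 2 ^ (i + 1)) ?_ ?_) ?_ fun _ h => h
    · intro j hj σ' h2 hr' ha'
      refine evalsTo_invEntry hw (hGτ.of_sameRegs hr' (by simp)) hk h2 hj
        (by rw [hr' 3 (by simp), h3]) (by omega) ((hΨ.congr ha ?_).congr ha' (by simp))
        (hH.congr ha' (by simp; omega)) (hb i hi)
      simp; omega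
    · rw [pow_succ']
      exact eval_mul (eval_const (x := 2) (by omega))
        (eval_reg (by rw [hυ.1 3 (by simp), h3]) (by omega)) (by omega)
    · refine ⟨(hr.trans (hυ.1.mono (by simp))).trans (SameRegs.update (by simp)), by simp, ?_,
        ha.trans hυ.2.2⟩
      exact hυ.2.1
    · have := cost_invEntry (k := k)
      have : 2 ^ L * ((Expr.invEntry k).cost + 100) ≤ 2 ^ L * 400 :=
        Nat.mul_le_mul_left _ (by omega)
      exact Nat.add_le_add this (Nat.le_of_ble_eq_true rfl)
  · rintro τ ⟨hr, h3, -⟩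
    have e3 := eval_lt hw.pos (eval_reg (w := w) h3 (by omega))
      (eval_length hw (hG.of_sameRegs hr (by simp)))
    simpa using e3
  · simp only [Expr.cost]
    have : 2 ^ L * L * 500 = L * (2 ^ L * 400) + L * (2 ^ L * 100) := by ring
    have h4 : L * 16 ≤ L * (2 ^ L * 100) := Nat.mul_le_mul_left _ (by omega)
    rw [this, Nat.mul_add, Nat.mul_add, Nat.mul_add]
    omega
  · rintro τ ⟨hr, -, hH, ha⟩
    exact ⟨hr, hH, ha⟩

end Transforms

end WordRAM

namespace WordRAM

open FFT

/-! ### One step of the decision procedure -/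

/-- The array with index `k` holds the indicator function of `W`. -/
def HoldsSet (L : ℕ) (σ : State) (k : ℕ) (W : ℕ → Prop) : Prop :=
  ∀ j < 2 ^ L, (W j → σ.mem (k * 2 ^ L + j) = 1) ∧ (¬ W j → σ.mem (k * 2 ^ L + j) = 0)

/-- The state after the initialization: the parameters, the largest coin `u`, the target `t`, the
threshold for the results of the transforms, the set of coins and the twiddle factors. -/
structure Ready (L u t : ℕ) (V : Finset ℕ) (σ : State) : Prop where
  globals : Globals L σ
  largest : σ.reg 27 = u
  target : σ.reg 28 = t
  threshold : σ.reg 30 = half L + (2 ^ L) ^ 13 / 2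
  coins : HoldsSet L σ 1 (· ∈ V)
  twiddle : Holds L σ 2 (twiddle L)
  conjTwiddle : Holds L σ 3 fun b => star (FFT.twiddle L b)

namespace Expr

/-- The fixed-point number of an entry of the window in array `4`. -/
def windowEntry : Expr := .reg 21 * cell 4 (.reg 2)

/-- The fixed-point number of an entry of the set of admissible single coins: `0`, and all coins
if the binary digit of the number of coins in register `8` at the power of two in register `4`
is `1`. -/
def coinEntry : Expr :=
  .reg 21 * (.op .eq (.reg 2) (.const 0) + .reg 8 / .reg 4 % .const 2 * cell 1 (.reg 2))

/-- The pointwise product of the transforms in the arrays `5` and `6`. -/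
def productEntry : Expr :=
  grnd (gmul (grnd (gmul (cell 5 (.reg 2)) (cell 5 (.reg 2)))) (cell 6 (.reg 2)))

/-- The entry of the next window. -/
def thresholdEntry : Expr :=
  .op .lt (.reg 2) (.const 4 * .reg 27 + .const 1) * (.const 1 - .op .lt
    (gshift (cell 5 ((.reg 2 + .reg 28 / .reg 4 % .const 2 + .const 2 * .reg 27) % .reg 20)) %
      .reg 22) (.reg 30))

end Expr

/-- Compute the window at level `i` from the window at level `i + 1`. -/
def Prog.step : Prog :=
  .seq (.fill 5 .windowEntry) (.seq (.fill 6 .coinEntry) (.seq (.fwd 5) (.seq (.fwd 6)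
    (.seq (.fill 5 .productEntry) (.seq (.inv 5) (.fill 4 .thresholdEntry))))))

section Step

variable {w L u t m i : ℕ} {V : Finset ℕ} {σ τ : State} {W : ℕ → Prop}

theorem HoldsSet.congr {s : Set ℕ} {k : ℕ} (h : HoldsSet L σ k W) (h' : SameArrays L s σ τ)
    (hk : k ∉ s) : HoldsSet L τ k W := by
  intro j hj
  rw [h' k hk j hj]
  exact h j hj

theorem Ready.congr {s s' : Set ℕ} (h : Ready L u t V σ) (hr : SameRegs s σ τ)
    (ha : SameArrays L s' σ τ) (hs : ∀ r ∈ s, r < 20) (hs' : ∀ k ∈ s', 4 ≤ k) :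
    Ready L u t V τ where
  globals := h.globals.of_sameRegs hr hs
  largest := by rw [hr 27 fun h => absurd (hs _ h) (by norm_num), h.largest]
  target := by rw [hr 28 fun h => absurd (hs _ h) (by norm_num), h.target]
  threshold := by rw [hr 30 fun h => absurd (hs _ h) (by norm_num), h.threshold]
  coins := h.coins.congr ha fun h => absurd (hs' _ h) (by norm_num)
  twiddle := h.twiddle.congr ha fun h => absurd (hs' _ h) (by norm_num)
  conjTwiddle := h.conjTwiddle.congr ha fun h => absurd (hs' _ h) (by norm_num)

theorem eval_cell_lt {k x y : ℕ} {e : Expr} (hw : Wide w L) (hG : Globals L σ) (hk : k ≤ 14)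
    (he : e.eval w σ = some x) (hx : x < 2 ^ L) (hy : σ.mem (k * 2 ^ L + x) = y)
    (hyw : y < 2 ^ w) : (Expr.cell k e).eval w σ = some y := by
  have h1 := hw.length_lt
  have h2 : (k + 1) * 2 ^ L ≤ 15 * 2 ^ L := Nat.mul_le_mul_right _ (by omega)
  exact eval_cell hG.length (by omega) (by positivity) he hx hy hyw

theorem HoldsSet.eval_cell [DecidablePred W] {k x : ℕ} {e : Expr} (hw : Wide w L) (hG : Globals L σ) (hk : k ≤ 14)
    (h : HoldsSet L σ k W) (he : e.eval w σ = some x) (hx : x < 2 ^ L) :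
    (Expr.cell k e).eval w σ = some (if W x then 1 else 0) := by
  refine eval_cell_lt hw hG hk he hx ?_ (one_lt_two_pow_of_lt hw.pos _)
  split_ifs with hW
  exacts [(h x hx).1 hW, (h x hx).2 hW]

theorem cast_scale_mul {c : ℕ} (hc : c ≤ 1) :
    enc (base L) ((scale L : GaussianInt) * (c : GaussianInt)) = scale L * c := by
  have h := scale_le_modulus (L := L)
  have h1 : scale L * c ≤ scale L * 1 := Nat.mul_le_mul_left _ hc
  rw [← Nat.cast_mul, enc_natCast]
  rcases Nat.lt_or_ge (scale L) (modulus L) with h2 | h2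
  · have : modulus L = base L * base L + 1 := rfl
    omega
  · exfalso
    have h3 : scale L ≤ base L := Nat.pow_le_pow_right (by positivity) (by norm_num)
    have h4 : base L ≤ base L * base L := Nat.le_mul_of_pos_right _ (by unfold base; positivity)
    have : modulus L = base L * base L + 1 := rfl
    omega

theorem eval_windowEntry [DecidablePred W] (hw : Wide w L) (hG : Globals L σ) {j : ℕ} (h2 : σ.reg 2 = j)
    (hj : j < 2 ^ L) (hW : HoldsSet L σ 4 W) :
    Expr.windowEntry.eval w σ = some (scale L * if W j then 1 else 0) := by
  have h1 := hw.length_lt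
  have h3 := hw.modulus_lt
  have h4 := scale_le_modulus (L := L)
  exact eval_mul (eval_scale hw hG) (hW.eval_cell hw hG (by norm_num)
    (eval_reg h2 (by omega)) hj) (by split_ifs <;> omega)

theorem eval_coinEntry (hw : Wide w L) (hR : Ready L u t V σ) (hV : ∀ x ∈ V, 0 < x) {j : ℕ}
    (h2 : σ.reg 2 = j) (hj : j < 2 ^ L) (h4 : σ.reg 4 = 2 ^ i) (hi : i < L) (h8 : σ.reg 8 = m)
    (hm : m < 2 ^ L) : Expr.coinEntry.eval w σ =
      some (scale L * if j = 0 ∨ m / 2 ^ i % 2 = 1 ∧ j ∈ V then 1 else 0) := by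
  have h1 := hw.length_lt
  have h3 := hw.modulus_lt
  have h5 := scale_le_modulus (L := L)
  have h6 := hw.two_pow_lt
  have hi' : 2 ^ i < 2 ^ L := Nat.pow_lt_pow_right one_lt_two hi
  have e2 : (Expr.reg 2).eval w σ = some j := eval_reg h2 (by omega)
  have e8 := eval_mod (eval_div (eval_reg (w := w) h8 (by omega)) (eval_reg (w := w) h4 (by omega)))
    (eval_const (w := w) (σ := σ) (x := 2) (by omega))
  have hm2 : m / 2 ^ i % 2 < 2 := Nat.mod_lt _ two_pos
  have e1 := eval_eq hw.pos e2 (eval_const (w := w) (σ := σ) (x := 0) (by positivity))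
  have e3 := hR.coins.eval_cell hw hR.globals (by norm_num) e2 hj
  -- Since `0` is not a coin, the two summands are never both `1`.
  have key : (if j = 0 then 1 else 0) + m / 2 ^ i % 2 * (if j ∈ V then 1 else 0) =
      if j = 0 ∨ m / 2 ^ i % 2 = 1 ∧ j ∈ V then 1 else 0 := by
    by_cases hj0 : j = 0
    · have : j ∉ V := fun h => absurd (hV j h) (by omega)
      simp [hj0, hj0 ▸ this]
    · by_cases hjV : j ∈ V
      · rcases (show m / 2 ^ i % 2 = 0 ∨ m / 2 ^ i % 2 = 1 by omega) with h | h <;>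
          simp [hj0, hjV, h]
      · simp [hj0, hjV]
  have e4 := eval_add e1 (eval_mul e8 e3 (by split_ifs <;> omega))
    (by rw [key]; exact one_lt_two_pow_of_lt hw.pos _)
  rw [key] at e4
  exact eval_mul (eval_scale hw hR.globals) e4 (by split_ifs <;> omega)

theorem evalsTo_productEntry {gx gy : ℕ → GaussianInt} (hw : Wide w L) (hG : Globals L σ) {j : ℕ}
    (h2 : σ.reg 2 = j) (hj : j < 2 ^ L) (hx : EvalsTo w L σ (.cell 5 (.reg 2)) (fwdApx L gx L j))
    (hy : Holds L σ 6 (fwdApx L gy L))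
    (hb₁ : ‖((fwdApx L gx L j * fwdApx L gx L j : GaussianInt) : ℂ)‖ < (2 ^ L) ^ 32 / 2)
    (hb₂ : ‖((rnd (scale L) (fwdApx L gx L j * fwdApx L gx L j) * fwdApx L gy L j :
      GaussianInt) : ℂ)‖ < (2 ^ L) ^ 32 / 2) :
    EvalsTo w L σ .productEntry (mulApx L gx gy j) := by
  have h1 := hw.length_lt
  have hy' := hy.evalsTo_cell hw hG (by norm_num) (eval_reg h2 (by omega)) hj
  exact (((hx.gmul hw hG hx).grnd hw hG hb₁).gmul hw hG hy').grnd hw hG hb₂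

theorem threshold_lt (hw : Wide w L) : half L + (2 ^ L) ^ 13 / 2 < 2 ^ w := by
  have h3 := hw.modulus_lt
  have h4 := base_le_modulus (L := L)
  have h5 : (2 ^ L) ^ 13 ≤ base L := Nat.pow_le_pow_right (by positivity) (by norm_num)
  have h6 := base_eq hw.four_le
  omega

theorem eval_thresholdEntry {g : ℕ → GaussianInt} (hw : Wide w L) (hR : Ready L u t V σ)
    (hu : 9 * u < 2 ^ L) (ht : t < 2 ^ w) {j : ℕ} (h2 : σ.reg 2 = j) (hj : j < 2 ^ L)
    (h4 : σ.reg 4 = 2 ^ i) (hi : i < L) (hg : Holds L σ 5 g)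
    (hb : ∀ j < 2 ^ L, ‖(g j : ℂ)‖ < (2 ^ L) ^ 32 / 2) : Expr.thresholdEntry.eval w σ =
      some (if j ≤ 4 * u ∧ (2 ^ L) ^ 13 / 2 ≤ (g (j + t / 2 ^ i % 2 + 2 * u)).re then 1 else 0) := by
  have h1 := hw.length_lt
  have h6 := hw.two_pow_lt
  have hG := hR.globals
  have hi' : 2 ^ i < 2 ^ L := Nat.pow_lt_pow_right one_lt_two hi
  have hm2 : t / 2 ^ i % 2 < 2 := Nat.mod_lt _ two_pos
  have e2 : (Expr.reg 2).eval w σ = some j := eval_reg h2 (by omega)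
  have eu : (Expr.reg 27).eval w σ = some u := eval_reg hR.largest (by omega)
  have e4 := eval_mod (eval_div (eval_reg hR.target ht) (eval_reg (w := w) h4 (by omega)))
    (eval_const (w := w) (σ := σ) (x := 2) (by omega))
  -- The remainder modulo `2 ^ L` only keeps the address inside the array for `j > 4 * u`, where the
  -- result is discarded by the factor `j < 4 * u + 1`; for other `j` it changes nothing.
  have e5 := eval_mod (eval_add (eval_add e2 e4 (by omega)) (eval_mul (eval_const (w := w) (σ := σ)
    (x := 2) (by omega)) eu (by omega)) (by omega)) (eval_length hw hG)
  have hlt : (j + t / 2 ^ i % 2 + 2 * u) % 2 ^ L < 2 ^ L := Nat.mod_lt _ (by positivity)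
  have e6 := hg.evalsTo_cell hw hG (by norm_num) e5 hlt
  have hz := hb _ hlt
  rw [← cast_half hw.four_le] at hz
  obtain ⟨x, y, hx, hy, hxI, hyI⟩ := exists_shift (base_eq hw.four_le) hz
  have e7 := eval_mod (eval_gshift hw hG e6 hx hy hxI hyI) (eval_base hw hG)
  rw [add_mul_base_mod hxI] at e7
  have e8 := eval_sub (eval_const (w := w) (σ := σ) (x := 1) (by omega))
    (eval_lt hw.pos e7 (eval_reg hR.threshold (threshold_lt hw)))
  have e9 := eval_lt hw.pos e2 (eval_add (eval_mul (eval_const (w := w) (σ := σ)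
    (x := 4) (by omega)) eu (by omega)) (eval_const (w := w) (σ := σ) (x := 1) (by omega))
    (by omega))
  have e10 := eval_mul e9 e8 (by split_ifs <;> omega)
  refine e10.trans (congrArg some ?_)
  by_cases hj4 : j ≤ 4 * u
  · have hmod : (j + t / 2 ^ i % 2 + 2 * u) % 2 ^ L = j + t / 2 ^ i % 2 + 2 * u :=
      Nat.mod_eq_of_lt (by omega)
    rw [hmod] at hx
    have hiff : (2 ^ L) ^ 13 / 2 ≤ (g (j + t / 2 ^ i % 2 + 2 * u)).re ↔
        ¬ x < half L + (2 ^ L) ^ 13 / 2 := by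
      have : (((2 ^ L) ^ 13 / 2 : ℕ) : ℤ) = (2 ^ L) ^ 13 / 2 := by push_cast; rfl
      rw [← this]
      omega
    rw [if_pos (show j < 4 * u + 1 by omega)]
    by_cases hx' : x < half L + (2 ^ L) ^ 13 / 2 <;> simp [hx', hiff, hj4]
  · rw [if_neg (show ¬ j < 4 * u + 1 by omega)]
    simp [hj4]

-- By `window_succ_iff`, position `j` belongs to the new window iff `p * p * q` has a nonzero
-- coefficient at `j + t / 2 ^ i % 2 + 2 * u`. Here `p` is the indicator of the old window, and `q`
-- that of `0` together with all coins if the current digit of `m` is `1`. The degree is at most `4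
-- * u + 4 * u + u = 9 * u < 2 ^ L`, so the cyclic product of length `2 ^ L` is the true product.
open Classical in
theorem runs_step (hw : Wide w L) (hR : Ready L u t V σ) (hV : ∀ x ∈ V, 0 < x ∧ x ≤ u)
    (hu : 9 * u < 2 ^ L) (ht : t < 2 ^ w) (h4 : σ.reg 4 = 2 ^ i) (hi : i < L) (h8 : σ.reg 8 = m)
    (hm : m < 2 ^ L) (hW : HoldsSet L σ 4 (Window V u t m (i + 1))) :
    Runs w .step σ (2 ^ L * L * 2000) fun τ => SameRegs {2, 3} σ τ ∧
      HoldsSet L τ 4 (Window V u t m i) ∧ SameArrays L {4, 5, 6, 7} σ τ := by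
  have hL := hw.four_le
  have hG := hR.globals
  have dW : ∀ j, Window V u t m (i + 1) j → j ≤ 4 * u := fun j h => h.1
  have dY : ∀ j, (j = 0 ∨ m / 2 ^ i % 2 = 1 ∧ j ∈ V) → j ≤ u := by
    rintro j (rfl | ⟨-, h⟩)
    exacts [Nat.zero_le u, (hV j h).2]
  set p := indicator (4 * u) (Window V u t m (i + 1)) with hp
  set q := indicator u fun j => j = 0 ∨ m / 2 ^ i % 2 = 1 ∧ j ∈ V with hq
  have cp : ∀ j, p.coeff j = if Window V u t m (i + 1) j then 1 else 0 := coeff_indicator dW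
  have cq : ∀ j, q.coeff j = if j = 0 ∨ m / 2 ^ i % 2 = 1 ∧ j ∈ V then 1 else 0 :=
    coeff_indicator dY
  have cp1 : ∀ j, p.coeff j ≤ 1 := fun j => by rw [cp]; split_ifs <;> omega
  have cq1 : ∀ j, q.coeff j ≤ 1 := fun j => by rw [cq]; split_ifs <;> omega
  have np : p.natDegree ≤ 4 * u := natDegree_indicator_le dW
  have nq : q.natDegree ≤ u := natDegree_indicator_le dY
  set gx : ℕ → GaussianInt := fun j => (scale L : GaussianInt) * p.coeff j with hgx
  set gy : ℕ → GaussianInt := fun j => (scale L : GaussianInt) * q.coeff j with hgy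
  have hgx' : ∀ j < 2 ^ L, (gx j : ℂ) = scale L * (p.coeff j : ℂ) := fun j _ => by simp [hgx]
  have hgy' : ∀ j < 2 ^ L, (gy j : ℂ) = scale L * (q.coeff j : ℂ) := fun j _ => by simp [hgy]
  have hax : ∀ j < 2 ^ L, ‖(p.coeff j : ℂ)‖ ≤ 1 := fun j _ => by
    rw [Complex.norm_natCast]; exact_mod_cast cp1 j
  have hay : ∀ j < 2 ^ L, ‖(q.coeff j : ℂ)‖ ≤ 1 := fun j _ => by
    rw [Complex.norm_natCast]; exact_mod_cast cq1 j
  have hlt := hw.length_lt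
  refine Runs.mono (K := 2 ^ L * (Expr.windowEntry.cost + 40) + (2 ^ L * (Expr.coinEntry.cost + 40) +
    (2 ^ L * L * 500 + (2 ^ L * L * 500 + (2 ^ L * (Expr.productEntry.cost + 40) +
    (2 ^ L * L * 500 + 2 ^ L * (Expr.thresholdEntry.cost + 40))))))) ?_ ?_ fun _ h => h
  swap
  · have c1 : Expr.windowEntry.cost ≤ 160 := Nat.le_of_ble_eq_true rfl
    have c2 : Expr.coinEntry.cost ≤ 160 := Nat.le_of_ble_eq_true rfl
    have c3 : Expr.productEntry.cost ≤ 160 := Nat.le_of_ble_eq_true rfl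
    have c4 : Expr.thresholdEntry.cost ≤ 160 := Nat.le_of_ble_eq_true rfl
    have key : ∀ c ≤ 160, 2 ^ L * (c + 40) ≤ 2 ^ L * L * 50 := by
      intro c hc
      rw [mul_assoc]
      exact Nat.mul_le_mul_left _ (by omega)
    have := key _ c1; have := key _ c2; have := key _ c3; have := key _ c4
    omega
  refine Runs.seq (runs_fill_array (fun j => enc (base L) (gx j)) hw hG (by norm_num)
    fun j hj σ' h2 hr ha _ => ?_) fun σ₁ ⟨r₁, f₁, a₁⟩ => ?_
  · rw [hgx]
    dsimp only
    rw [cast_scale_mul (cp1 j), cp]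
    exact eval_windowEntry hw (hG.of_sameRegs hr (by simp)) h2 hj (hW.congr ha (by simp))
  have R₁ : Ready L u t V σ₁ := hR.congr r₁ a₁ (by simp) (by simp)
  refine Runs.seq (runs_fill_array (fun j => enc (base L) (gy j)) hw R₁.globals (by norm_num)
    fun j hj σ' h2 hr ha _ => ?_) fun σ₂ ⟨r₂, f₂, a₂⟩ => ?_
  · rw [hgy]
    dsimp only
    rw [cast_scale_mul (cq1 j), cq]
    exact eval_coinEntry hw (R₁.congr hr ha (by simp) (by simp)) (fun x hx => (hV x hx).1) h2 hj
      (by rw [hr 4 (by simp), r₁ 4 (by simp), h4]) hi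
      (by rw [hr 8 (by simp), r₁ 8 (by simp), h8]) hm
  have R₂ : Ready L u t V σ₂ := R₁.congr r₂ a₂ (by simp) (by simp)
  have x₂ : Holds L σ₂ 5 gx := Holds.congr (σ := σ₁) f₁ a₂ (by simp)
  refine Runs.seq (runs_fwd (k := 5) hw R₂.globals (by norm_num) (by norm_num) R₂.twiddle x₂
    fun ℓ hℓ b j hj => norm_twiddle_mul_fwdApx_lt hgx' hax hL hℓ.le hj b) fun σ₃ ⟨r₃, x₃, a₃⟩ => ?_
  have R₃ : Ready L u t V σ₃ := R₂.congr r₃ a₃ (by simp) (by simp)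
  have y₃ : Holds L σ₃ 6 gy := Holds.congr (σ := σ₂) f₂ a₃ (by simp)
  refine Runs.seq (runs_fwd (k := 6) hw R₃.globals (by norm_num) (by norm_num) R₃.twiddle y₃
    fun ℓ hℓ b j hj => norm_twiddle_mul_fwdApx_lt hgy' hay hL hℓ.le hj b) fun σ₄ ⟨r₄, y₄, a₄⟩ => ?_
  have R₄ : Ready L u t V σ₄ := R₃.congr r₄ a₄ (by simp) (by simp)
  have x₄ : Holds L σ₄ 5 (fwdApx L gx L) := x₃.congr a₄ (by simp)
  -- Array `5` is overwritten while it is read; this is harmless because entry `j` uses only its own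
  -- old value, provided by `hself`.
  refine Runs.seq (runs_fill_array (fun j => enc (base L) (mulApx L gx gy j)) hw R₄.globals
    (by norm_num) fun j hj σ' h2 hr ha hself => ?_) fun σ₅ ⟨r₅, f₅, a₅⟩ => ?_
  · have hG' := R₄.globals.of_sameRegs hr (by simp)
    have hm' := hw.modulus_lt
    have he := enc_lt_modulus (L := L) (z := fwdApx L gx L j)
    refine evalsTo_productEntry hw hG' h2 hj ?_ (y₄.congr ha (by simp))
      (norm_sq_fwdApx_lt hgx' hax hL hj) (norm_rnd_sq_mul_lt hgx' hax hgy' hay hL hj)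
    exact eval_cell_lt hw hG' (by norm_num) (eval_reg h2 (by omega)) hj
      (hself.trans (x₄ j hj)) (by omega)
  have R₅ : Ready L u t V σ₅ := R₄.congr r₅ a₅ (by simp) (by simp)
  refine Runs.seq (runs_inv (k := 5) (g := mulApx L gx gy) hw R₅.globals (by norm_num)
    (by norm_num) R₅.conjTwiddle f₅ fun ℓ hℓ b j hj j' hj' =>
      norm_star_twiddle_mul_lt hgx' hax hgy' hay hL hℓ.le hj hj' b) fun σ₆ ⟨r₆, x₆, a₆⟩ => ?_
  have R₆ : Ready L u t V σ₆ := R₅.congr r₆ a₆ (by simp) (by simp)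
  have r : SameRegs {2, 3} σ σ₆ := ((((r₁.mono (by simp)).trans (r₂.mono (by simp))).trans
    r₃).trans r₄).trans ((r₅.mono (by simp)).trans r₆)
  have a : SameArrays L {4, 5, 6, 7} σ σ₆ := by
    refine (((((a₁.mono ?_).trans (a₂.mono ?_)).trans (a₃.mono ?_)).trans (a₄.mono ?_)).trans
      (a₅.mono ?_)).trans (a₆.mono ?_) <;> intro x <;> simp <;> omega
  refine Runs.mono (runs_fill_array (fun j => if Window V u t m i j then 1 else 0) hw R₆.globals
    (by norm_num) fun j hj σ' h2 hr ha _ => ?_) le_rfl fun τ ⟨r₇, f₇, a₇⟩ => ⟨r.trans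
      (r₇.mono (by simp)), fun j hj => ⟨fun h => by rw [f₇ j hj, if_pos h],
      fun h => by rw [f₇ j hj, if_neg h]⟩, a.trans (a₇.mono (by simp))⟩
  refine (eval_thresholdEntry hw (R₆.congr hr ha (by simp) (by simp)) hu ht h2 hj
    (by rw [hr 4 (by simp), r 4 (by simp), h4]) hi (x₆.congr ha (by simp)) fun j hj =>
      norm_invApx_lt hgx' hax hgy' hay hL le_rfl hj).trans (congrArg some (if_congr ?_ rfl rfl))
  rw [window_succ_iff fun x hx => (hV x hx).2]
  refine and_congr_right fun hj4 => ?_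
  have hm2 : t / 2 ^ i % 2 < 2 := Nat.mod_lt _ two_pos
  have h16 := hw.two_pow_lt
  rw [← coeff_ne_zero_iff_re_invApx hL p q cp1 cq1 (by omega) (by omega) (by omega)
    (show j + t / 2 ^ i % 2 + 2 * u < 2 ^ L by omega), coeff_mul_mul_ne_zero_iff]
  have hne : ∀ (P : Prop) [Decidable P], (if P then 1 else 0) ≠ 0 ↔ P := by
    intro P _; split_ifs with h <;> simp [h]
  simp only [cp, cq, hne]

end Step

end WordRAM

namespace WordRAM

open FFT

/-! ### The decision procedure and the search for the number of coins -/

/-- The entry of the window at the highest level. -/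
def Expr.topEntry : Expr := .op .eq (.reg 2 + .reg 28 / .reg 20) (.const 2 * .reg 27)

/-- Compute the windows from the highest level down to level `0`; register `8` holds the number
of coins. -/
def Prog.windows : Prog :=
  .seq (.fill 4 .topEntry) (.seq (.set 4 (.reg 20 / .const 2))
    (.loop (.reg 4) (.seq .step (.set 4 (.reg 4 / .const 2)))))

/-- Search for the number of coins, which is left in register `5`. -/
def Prog.search : Prog :=
  .seq (.set 5 (.const 0)) (.seq (.set 6 (.reg 20 / .const 2))
    (.loop (.reg 6) (.seq (.set 8 (.reg 5 + .reg 6 - .const 1)) (.seq .windows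
      (.seq (.set 5 (.reg 5 + .reg 6 * (.const 1 - .cell 4 (.const 2 * .reg 27))))
        (.set 6 (.reg 6 / .const 2)))))))

section Search

variable {w L u t m : ℕ} {V : Finset ℕ} {σ : State}

theorem Wide.sq_add_lt (hw : Wide w L) (ht : t < 2 ^ L * 2 ^ L) : t + 2 ^ L < 2 ^ w := by
  have h1 := hw.two_pow_lt
  have h2 := hw.pow_lt (k := 3) (by norm_num)
  have h3 : 2 * (2 ^ L * 2 ^ L) ≤ 2 ^ L * (2 ^ L * 2 ^ L) := Nat.mul_le_mul_right _ (by omega)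
  have h4 : 2 ^ L ≤ 2 ^ L * 2 ^ L := Nat.le_mul_of_pos_right _ (by positivity)
  have h5 : (2 ^ L) ^ 3 = 2 ^ L * (2 ^ L * 2 ^ L) := by ring
  omega

-- Register `4` holds `2 ^ (L - 1 - i)` in iteration `i`. The division by it inside `step` extracts
-- the binary digits of the target and of the number of coins that belong to the window being
-- computed.
open Classical in
theorem runs_windows (hw : Wide w L) (hR : Ready L u t V σ) (hV : ∀ x ∈ V, 0 < x ∧ x ≤ u)
    (hu : 9 * u < 2 ^ L) (ht : t < 2 ^ L * 2 ^ L) (h8 : σ.reg 8 = m) (hm : m < 2 ^ L) :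
    Runs w .windows σ (2 ^ L * L * L * 2100) fun τ => SameRegs {2, 3, 4} σ τ ∧
      HoldsSet L τ 4 (Window V u t m 0) ∧ SameArrays L {4, 5, 6, 7} σ τ := by
  have hL := hw.four_le
  have hlt := hw.length_lt
  have h16 := hw.two_pow_lt
  have htw := hw.sq_add_lt ht
  refine Runs.mono (K := 2 ^ L * (Expr.topEntry.cost + 40) + ((1 + 1 + 1) + 1 +
    (L * (2 ^ L * L * 2000 + 4 + 1 + 1) + (1 + 1)))) ?_ ?_ fun _ h => h
  swap
  · have c1 : Expr.topEntry.cost ≤ 60 := Nat.le_of_ble_eq_true rfl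
    have k1 : 2 ^ L * (Expr.topEntry.cost + 40) ≤ 2 ^ L * (L * L * 10) :=
      Nat.mul_le_mul_left _ (by nlinarith)
    have k2 : 16 * (L * L) ≤ 2 ^ L * (L * L) := Nat.mul_le_mul_right _ h16
    have k3 : 4 * L ≤ L * L := Nat.mul_le_mul_right _ hL
    have e1 : 2 ^ L * L * L * 2100 = L * (2 ^ L * L * 2000) + 2 ^ L * (L * L * 10) +
      90 * (2 ^ L * (L * L)) := by ring
    have e2 : L * (2 ^ L * L * 2000 + 4 + 1 + 1) = L * (2 ^ L * L * 2000) + 6 * L := by ring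
    rw [e1, e2]
    omega
  refine Runs.seq (runs_fill_array (fun j => if Window V u t m L j then 1 else 0) hw hR.globals
    (by norm_num) fun j hj σ' h2 hr ha _ => ?_) fun σ₁ ⟨r₁, f₁, a₁⟩ => ?_
  · have R' : Ready L u t V σ' := hR.congr hr ha (by simp) (by simp)
    have hd : t / 2 ^ L ≤ t := Nat.div_le_self _ _
    refine (eval_eq hw.pos (eval_add (eval_reg h2 (by omega)) (eval_div
      (eval_reg R'.target (by omega)) (eval_length hw R'.globals)) (by omega))
      (eval_mul (eval_const (x := 2) (by omega)) (eval_reg R'.largest (by omega))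
        (by omega))).trans (congrArg some (if_congr ?_ rfl rfl))
    rw [window_top_iff hm]
  have R₁ : Ready L u t V σ₁ := hR.congr r₁ a₁ (by simp) (by simp)
  refine Runs.seq (Q := fun τ => SameRegs {2, 3, 4} σ τ ∧ τ.reg 4 = 2 ^ L / 2 ∧ τ.mem = σ₁.mem)
    (Runs.set (eval_div (eval_length hw R₁.globals) (eval_const (x := 2) (by omega)))
      ⟨(r₁.mono (by simp)).trans (SameRegs.update (by simp)), by simp, rfl⟩) fun σ₂ h₂ => ?_
  refine Runs.mono (Runs.loop (fun i τ => SameRegs {2, 3, 4} σ τ ∧ τ.reg 4 = 2 ^ L / 2 / 2 ^ i ∧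
    HoldsSet L τ 4 (Window V u t m (L - i)) ∧ SameArrays L {4, 5, 6, 7} σ τ) L
    (2 ^ L * L * 2000 + 4) ?_ ?_ ?_) (by simp only [Expr.cost, le_refl]) ?_
  · refine ⟨h₂.1, by simpa using h₂.2.1, fun j hj => ?_,
      (a₁.mono (by simp)).trans (.of_mem_eq h₂.2.2)⟩
    rw [h₂.2.2, f₁ j hj, Nat.sub_zero]
    exact ⟨fun h => if_pos h, fun h => if_neg h⟩
  · rintro i hi τ ⟨hr, h4, hH, ha⟩
    rw [two_pow_div_two_div hi] at h4
    have Rτ : Ready L u t V τ := hR.congr hr ha (by simp) (by simp)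
    have hm' : 2 ^ (L - 1 - i) ≤ 2 ^ L := Nat.pow_le_pow_right two_pos (by omega)
    refine ⟨⟨_, eval_reg h4 (by omega), by positivity⟩, ?_⟩
    rw [show L - i = L - 1 - i + 1 by omega] at hH
    refine Runs.mono (Runs.seq (runs_step hw Rτ hV hu (by omega) h4 (by omega)
      (by rw [hr 8 (by simp), h8]) hm hH) fun υ hυ =>
      Runs.set (x := 2 ^ L / 2 / 2 ^ (i + 1)) ?_ ?_) (Nat.add_le_add_left
        (Nat.le_of_ble_eq_true rfl) _) fun _ h => h
    · rw [div_two_pow_succ, two_pow_div_two_div hi]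
      exact eval_div (eval_reg (by rw [hυ.1 4 (by simp), h4]) (by omega))
        (eval_const (x := 2) (by omega))
    · refine ⟨(hr.trans (hυ.1.mono ?_)).trans (SameRegs.update (by simp)), by simp, ?_,
        ha.trans hυ.2.2⟩
      · intro x; simp; omega
      · rw [show L - (i + 1) = L - 1 - i by omega]
        exact hυ.2.1
  · rintro τ ⟨hr, h4, -⟩
    rw [two_pow_div_two_div_self] at h4
    exact eval_reg h4 (by positivity)
  · rintro τ ⟨hr, -, hH, ha⟩
    rw [Nat.sub_self] at hH
    exact ⟨hr, hH, ha⟩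

-- Binary search with the invariant `q ≤ D < q + 2 ^ (L - i)`. The budgets tested are `m = q + d -
-- 1` with `q + 2 * d ≤ 2 ^ L`, so `m + 1 < 2 ^ L`; the hypothesis on `D` is needed only there,
-- which leaves the value `D = 2 ^ L - 1` free to mean that no budget suffices.
open Classical in
theorem runs_search (hw : Wide w L) (hR : Ready L u t V σ) (hV : ∀ x ∈ V, 0 < x ∧ x ≤ u)
    (hu : 9 * u < 2 ^ L) (ht : t < 2 ^ L * 2 ^ L) {D : ℕ} (hD : D < 2 ^ L)
    (hDm : ∀ m, m + 1 < 2 ^ L → (Feasible V m t ↔ D ≤ m)) :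
    Runs w .search σ (2 ^ L * L * L * L * 2200) fun τ => SameRegs {2, 3, 4, 5, 6, 8} σ τ ∧
      τ.reg 5 = D := by
  have hL := hw.four_le
  have hlt := hw.length_lt
  have h16 := hw.two_pow_lt
  refine Runs.mono (K := 1 + 1 + ((1 + 1 + 1) + 1 + (L * (2 ^ L * L * L * 2100 + 30 + 1 + 1) +
    (1 + 1)))) ?_ ?_ fun _ h => h
  swap
  · have k1 : 16 * (L * L * L) ≤ 2 ^ L * (L * L * L) := Nat.mul_le_mul_right _ h16
    have k2 : 4 * L ≤ L * L := Nat.mul_le_mul_right _ hL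
    have k3 : 4 * (L * L) ≤ L * (L * L) := Nat.mul_le_mul_right _ hL
    have e1 : 2 ^ L * L * L * L * 2200 = L * (2 ^ L * L * L * 2100) +
      100 * (2 ^ L * (L * L * L)) := by ring
    have e2 : L * (L * L) = L * L * L := by ring
    have e3 : L * (2 ^ L * L * L * 2100 + 30 + 1 + 1) = L * (2 ^ L * L * L * 2100) + 32 * L := by
      ring
    rw [e1, e3]
    omega
  refine Runs.seq (Q := fun τ => SameRegs {2, 3, 4, 5, 6, 8} σ τ ∧ τ.reg 5 = 0 ∧ τ.mem = σ.mem)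
    (Runs.set (eval_const (x := 0) (by positivity))
      ⟨SameRegs.update (by simp), by simp, rfl⟩) fun σ₁ h₁ => ?_
  have G₁ : Globals L σ₁ := hR.globals.of_sameRegs h₁.1 (by simp)
  refine Runs.seq (Q := fun τ => SameRegs {2, 3, 4, 5, 6, 8} σ τ ∧ τ.reg 5 = 0 ∧
      τ.reg 6 = 2 ^ L / 2 ∧ τ.mem = σ.mem)
    (Runs.set (eval_div (eval_length hw G₁) (eval_const (x := 2) (by omega)))
      ⟨h₁.1.trans (SameRegs.update (by simp)), by simpa using h₁.2.1, by simp, h₁.2.2⟩)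
    fun σ₂ h₂ => ?_
  refine Runs.mono (Runs.loop (fun i τ => SameRegs {2, 3, 4, 5, 6, 8} σ τ ∧
    τ.reg 6 = 2 ^ L / 2 / 2 ^ i ∧ τ.reg 5 ≤ D ∧ D < τ.reg 5 + 2 ^ (L - i) ∧
    τ.reg 5 + 2 ^ (L - i) ≤ 2 ^ L ∧ SameArrays L {4, 5, 6, 7} σ τ) L
    (2 ^ L * L * L * 2100 + 30) ?_ ?_ ?_) (by simp only [Expr.cost, le_refl]) ?_
  · refine ⟨h₂.1, by simpa using h₂.2.2.1, ?_, ?_, ?_, .of_mem_eq h₂.2.2.2⟩ <;>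
      rw [h₂.2.1] <;> simp [hD]
  · rintro i hi τ ⟨hr, h6, hq, hq', hqL, ha⟩
    rw [two_pow_div_two_div hi] at h6
    have hp : 2 ^ (L - i) = 2 * 2 ^ (L - 1 - i) := by
      rw [← pow_succ']; congr 1; omega
    have hp' : L - (i + 1) = L - 1 - i := by omega
    have hd0 : 0 < 2 ^ (L - 1 - i) := by positivity
    generalize hd : 2 ^ (L - 1 - i) = d at *
    generalize hqq : τ.reg 5 = q at *
    rw [hp] at hq' hqL
    refine ⟨⟨_, eval_reg h6 (by omega), by omega⟩, ?_⟩
    refine Runs.mono (K := 5 + 1 + (2 ^ L * L * L * 2100 + (14 + 1 + (3 + 1)))) ?_ (by omega)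
      fun _ h => h
    refine Runs.seq (Q := fun υ => SameRegs {2, 3, 4, 5, 6, 8} σ υ ∧ υ.reg 5 = q ∧ υ.reg 6 = d ∧
      υ.reg 8 = q + d - 1 ∧ SameArrays L {4, 5, 6, 7} σ υ)
      (Runs.set (eval_sub (eval_add (eval_reg hqq (by omega)) (eval_reg h6 (by omega)) (by omega))
        (eval_const (x := 1) (by omega))) ⟨hr.trans (SameRegs.update (by simp)), by simpa using hqq,
          by simpa using h6, by simp, ha.trans (.of_mem_eq rfl)⟩) fun υ ⟨ur, u5, u6, u8, ua⟩ => ?_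
    have Rυ : Ready L u t V υ := hR.congr ur ua (by simp) (by simp)
    refine Runs.seq (runs_windows hw Rυ hV hu ht u8 (by omega)) fun ρ ⟨rr, rH, ra⟩ => ?_
    have Rρ : Ready L u t V ρ := Rυ.congr rr ra (by simp) (by simp)
    have r5 : ρ.reg 5 = q := by rw [rr 5 (by simp), u5]
    have r6 : ρ.reg 6 = d := by rw [rr 6 (by simp), u6]
    have eW := rH.eval_cell hw Rρ.globals (by norm_num) (eval_mul (eval_const (w := w) (x := 2)
      (by omega)) (eval_reg (w := w) Rρ.largest (by omega)) (by omega)) (by omega)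
    have hrs : SameRegs {2, 3, 4, 5, 6, 8} σ ρ := ur.trans (rr.mono (by intro x; simp; omega))
    refine Runs.seq (Q := fun υ' => SameRegs {2, 3, 4, 5, 6, 8} σ υ' ∧
        υ'.reg 5 = q + d * (1 - if Window V u t (q + d - 1) 0 (2 * u) then 1 else 0) ∧
        υ'.reg 6 = d ∧ SameArrays L {4, 5, 6, 7} σ υ')
      (Runs.set (eval_add (eval_reg r5 (by omega)) (eval_mul (eval_reg r6 (by omega))
        (eval_sub (eval_const (x := 1) (by omega)) eW) ?_) ?_) ⟨hrs.trans (SameRegs.update (by simp)),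
          by simp, by simpa using r6, (ua.trans ra).trans (.of_mem_eq rfl)⟩)
      fun υ' ⟨vr, v5, v6, va⟩ => Runs.set (x := 2 ^ L / 2 / 2 ^ (i + 1)) ?_ ?_
    · split_ifs <;> omega
    · split_ifs <;> omega
    · rw [div_two_pow_succ, two_pow_div_two_div hi, hd]
      exact eval_div (eval_reg v6 (by omega)) (eval_const (x := 2) (by omega))
    · refine ⟨vr.trans (SameRegs.update (by simp)), by simp, ?_⟩
      have hv : ∀ x, Function.update υ'.reg 6 x 5 = υ'.reg 5 := fun x => by simp
      rw [hp', hd]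
      dsimp only
      rw [hv, v5]
      have hF := hDm (q + d - 1) (by omega)
      rw [window_zero_iff]
      refine and_assoc.1 (and_assoc.1 ⟨?_, va.trans (.of_mem_eq rfl)⟩)
      by_cases hf : Feasible V (q + d - 1) t
      · have := hF.1 hf
        simp only [hf, if_true, Nat.sub_self, mul_zero, add_zero]
        omega
      · have : ¬ D ≤ q + d - 1 := fun h => hf (hF.2 h)
        simp only [hf, if_false, Nat.sub_zero, mul_one]
        omega
  · rintro τ ⟨hr, h6, -⟩
    rw [two_pow_div_two_div_self] at h6
    exact eval_reg h6 (by positivity)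
  · rintro τ ⟨hr, -, h1, h2, -⟩
    rw [Nat.sub_self, pow_zero] at h2
    exact ⟨hr, by omega⟩

end Search

end WordRAM

namespace WordRAM

open FFT

/-! ### Square roots and the table of twiddle factors -/

/-- The integer square root of register `14`, by binary search in register `15`. -/
def Prog.sqrt : Prog :=
  .seq (.set 15 (.const 0)) (.seq (.set 16 (.reg 21 * .reg 21))
    (.loop (.reg 16) (.seq
      (.set 15 (.reg 15 + .reg 16 *
        (.const 1 - .op .lt (.reg 14) ((.reg 15 + .reg 16) * (.reg 15 + .reg 16)))))
      (.set 16 (.reg 16 / .const 2)))))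

/-- Multiply the entries of array `2` whose binary digit at the power of two in register `12` is
`1` by the Gaussian integer in register `13`. -/
def Expr.twiddleEntry : Expr :=
  select (.reg 2 / .reg 12 % .const 2) (grnd (gmul (.reg 13) (cell 2 (.reg 2)))) (cell 2 (.reg 2))

/-- Compute the twiddle factors in array `2` and their conjugates in array `3`. -/
def Prog.twiddles : Prog :=
  .seq (.fill 2 (.reg 21)) (.seq (.set 10 (.const 0)) (.seq (.set 11 (.reg 21 * .reg 21))
    (.seq (.set 12 (.const 1)) (.seq (.loop (.op .lt (.reg 12) (.reg 20))
      (.seq (.set 13 (.reg 10 / .reg 21 + .reg 11 / .reg 21 * .reg 22))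
      (.seq (.fill 2 .twiddleEntry)
      (.seq (.set 14 ((.reg 21 * .reg 21 - .reg 10) * (.reg 21 * .reg 21) / .const 2))
      (.seq .sqrt (.seq (.set 11 (.reg 15))
      (.seq (.set 14 ((.reg 21 * .reg 21 + .reg 10) * (.reg 21 * .reg 21) / .const 2))
      (.seq .sqrt (.seq (.set 10 (.reg 15)) (.set 12 (.const 2 * .reg 12)))))))))))
    (.fill 3 (.gstar (.cell 2 (.reg 2))))))))

section Sqrt

variable {w L : ℕ} {σ : State}

theorem scale_sq : scale L * scale L = 2 ^ (24 * L) := by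
  rw [scale, ← pow_add, ← pow_mul, mul_comm L]

theorem Wide.scale_pow_lt (hw : Wide w L) :
    16 * (scale L * scale L * (scale L * scale L)) < 2 ^ w := by
  have h : 16 * (scale L * scale L * (scale L * scale L)) ≤
      2 ^ L * (scale L * scale L * (scale L * scale L)) :=
    Nat.mul_le_mul_right _ hw.two_pow_lt
  refine h.trans_lt ?_
  have : 2 ^ L * (scale L * scale L * (scale L * scale L)) = (2 ^ L) ^ 49 := by
    unfold scale; ring
  rw [this]
  exact hw.pow_lt (by norm_num)

/-- The root is at most `S * S = 2 ^ E` and this value can occur, so `E + 1` binary digits are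
determined, with the invariant `q ^ 2 ≤ x < (q + 2 ^ (E + 1 - i)) ^ 2`. -/
theorem runs_sqrt (hw : Wide w L) (hG : Globals L σ) {x : ℕ} (hx : σ.reg 14 = x)
    (hxQ : x ≤ scale L * scale L * (scale L * scale L)) :
    Runs w .sqrt σ (1000 * L) fun τ => SameRegs {15, 16} σ τ ∧ τ.reg 15 = Nat.sqrt x ∧
      τ.mem = σ.mem := by
  have hQw := hw.scale_pow_lt
  have hL := hw.four_le
  have h1w : 1 < 2 ^ w := Nat.one_lt_two_pow hw.pos.ne'
  have hlt := hw.length_lt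
  have h16 := hw.two_pow_lt
  have hsq := scale_sq (L := L)
  have hQQ : scale L * scale L ≤ scale L * scale L * (scale L * scale L) :=
    Nat.le_mul_of_pos_right _ (by have := scale_pos (L := L); positivity)
  have eQ : ∀ {τ : State}, Globals L τ → (Expr.reg 21 * Expr.reg 21).eval w τ =
      some (scale L * scale L) := fun h => eval_mul (eval_scale hw h) (eval_scale hw h) (by omega)
  simp only [hsq] at hxQ hQw hQQ eQ
  generalize hE : 24 * L = E at *
  refine Runs.mono (K := 1 + 1 + (3 + 1 + ((E + 1) * (20 + 1 + 1) + (1 + 1)))) ?_ (by omega)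
    fun _ h => h
  refine Runs.seq (Q := fun τ => SameRegs {15, 16} σ τ ∧ τ.reg 15 = 0 ∧ τ.mem = σ.mem)
    (Runs.set (eval_const (x := 0) (by positivity))
      ⟨SameRegs.update (by simp), by simp, rfl⟩) fun σ₁ h₁ => ?_
  refine Runs.seq (Q := fun τ => SameRegs {15, 16} σ τ ∧ τ.reg 15 = 0 ∧ τ.reg 16 = 2 ^ E ∧
    τ.mem = σ.mem) (Runs.set (eQ (hG.of_sameRegs h₁.1 (by simp))) ⟨h₁.1.trans
      (SameRegs.update (by simp)), by simpa using h₁.2.1, by simp, h₁.2.2⟩) fun σ₂ h₂ => ?_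
  refine Runs.mono (Runs.loop (fun i τ => SameRegs {15, 16} σ τ ∧ τ.reg 16 = 2 ^ E / 2 ^ i ∧
    τ.reg 15 * τ.reg 15 ≤ x ∧ x < (τ.reg 15 + 2 ^ (E + 1 - i)) * (τ.reg 15 + 2 ^ (E + 1 - i)) ∧
    τ.mem = σ.mem) (E + 1) 20 ?_ ?_ ?_) (by simp only [Expr.cost, le_refl]) ?_
  · refine ⟨h₂.1, by simpa using h₂.2.2.1, ?_, ?_, h₂.2.2.2⟩
    · simp [h₂.2.1]
    · rw [h₂.2.1, Nat.sub_zero, zero_add, pow_succ]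
      have : 0 < 2 ^ E * 2 ^ E := by positivity
      have e : 2 ^ E * 2 * (2 ^ E * 2) = 4 * (2 ^ E * 2 ^ E) := by ring
      omega
  · rintro i hi τ ⟨hr, h16', hlo, hhi, hmem⟩
    have hd : 2 ^ E / 2 ^ i = 2 ^ (E - i) := Nat.pow_div (by omega) two_pos
    have hdle : 2 ^ (E - i) ≤ 2 ^ E := Nat.pow_le_pow_right two_pos (by omega)
    rw [hd] at h16'
    have hp : 2 ^ (E + 1 - i) = 2 * 2 ^ (E - i) := by
      rw [← pow_succ']; congr 1; omega
    rw [hp] at hhi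
    have hd0 : 0 < 2 ^ (E - i) := by positivity
    have hrle : τ.reg 15 ≤ 2 ^ E := by
      have := hlo.trans hxQ
      exact Nat.mul_self_le_mul_self_iff.1 this
    generalize hq : τ.reg 15 = q at *
    have hdE : 2 ^ E / 2 ^ (i + 1) = 2 ^ (E - i) / 2 := by rw [div_two_pow_succ, hd]
    have hp' : E + 1 - (i + 1) = E - i := by omega
    rw [hp', hdE]
    generalize 2 ^ (E - i) = d at *
    have hqd : (q + d) * (q + d) ≤ 4 * (2 ^ E * 2 ^ E) := by
      calc (q + d) * (q + d) ≤ (2 ^ E + 2 ^ E) * (2 ^ E + 2 ^ E) := by gcongr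
        _ = _ := by ring
    refine ⟨⟨_, eval_reg h16' (by omega), by omega⟩, ?_⟩
    have e15 : (Expr.reg 15).eval w τ = some q := eval_reg hq (by omega)
    have e16 : (Expr.reg 16).eval w τ = some d := eval_reg h16' (by omega)
    have e14 : (Expr.reg 14).eval w τ = some x := eval_reg (by rw [hr 14 (by simp), hx]) (by omega)
    have es := eval_add e15 e16 (by omega)
    refine Runs.mono (K := 15 + 1 + (3 + 1)) ?_ (by norm_num) fun _ h => h
    refine Runs.seq (Q := fun υ => SameRegs {15, 16} σ υ ∧ υ.reg 15 = q + d *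
        (1 - if x < (q + d) * (q + d) then 1 else 0) ∧ υ.reg 16 = d ∧ υ.mem = σ.mem)
      (Runs.set (eval_add e15 (eval_mul e16 (eval_sub (eval_const (x := 1) (by omega))
        (eval_lt hw.pos e14 (eval_mul es es (by omega)))) ?_) ?_)
        ⟨hr.trans (SameRegs.update (by simp)), by simp, by simpa using h16', hmem⟩)
      fun υ ⟨ur, u15, u16, um⟩ => Runs.set (eval_div (eval_reg u16 (by omega))
        (eval_const (x := 2) (by omega))) ⟨ur.trans (SameRegs.update (by simp)), by simp, ?_⟩
    · split_ifs <;> omega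
    · split_ifs <;> omega
    · have hv : ∀ y, Function.update υ.reg 16 y 15 = υ.reg 15 := fun y => by simp
      dsimp only
      rw [hv, u15]
      refine and_assoc.1 ⟨?_, um⟩
      split_ifs with hc
      · simpa using ⟨hlo, hc⟩
      · rw [Nat.sub_zero, mul_one]
        rw [show q + 2 * d = q + d + d by ring] at hhi
        exact ⟨by omega, hhi⟩
  · rintro τ ⟨hr, h16', -⟩
    have : 2 ^ E / 2 ^ (E + 1) = 0 :=
      Nat.div_eq_of_lt (Nat.pow_lt_pow_right one_lt_two (by omega))
    rw [this] at h16'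
    exact eval_reg h16' (by positivity)
  · rintro τ ⟨hr, -, hlo, hhi, hmem⟩
    rw [Nat.sub_self, pow_zero] at hhi
    exact ⟨hr, Nat.eq_sqrt.2 ⟨hlo, hhi⟩, hmem⟩

end Sqrt

section Twiddles

variable {w L : ℕ} {σ : State}

theorem twenty_mul_le_scale (hL : 4 ≤ L) {k : ℕ} (hk : k ≤ L) : 20 * k ≤ scale L := by
  have hN := sixteen_le_two_pow hL
  have hLN : L < 2 ^ L := Nat.lt_two_pow_self
  calc 20 * k ≤ 256 * 2 ^ L := by omega
    _ = 16 * 16 * 2 ^ L := by ring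
    _ ≤ 2 ^ L * 2 ^ L * 2 ^ L := by gcongr
    _ = (2 ^ L) ^ 3 := by ring
    _ ≤ scale L := Nat.pow_le_pow_right (by positivity) (by norm_num)

theorem five_le_scale (hL : 4 ≤ L) : 5 ≤ scale L := by
  have := sixteen_le_two_pow hL
  have := two_pow_le_scale (L := L)
  omega

theorem four_mul_scale_sq_lt (hL : 4 ≤ L) :
    (scale L : ℝ) * (1 + 1) * (scale L * (1 + 1)) < (2 ^ L) ^ 32 / 2 := by
  rw [cast_scale]
  have pw := sixteen_mul_pow_le hL
  have h25 : ((2 : ℝ) ^ L) ^ 25 ≤ (2 ^ L) ^ 32 :=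
    pow_le_pow_right₀ (one_le_pow₀ one_le_two) (by norm_num)
  have := pw 24
  have hp : 0 < ((2 : ℝ) ^ L) ^ 24 := by positivity
  generalize (2 : ℝ) ^ L = n at *
  simp only [Nat.reduceAdd] at *
  linarith

theorem norm_thetaApx_mul_lt (hL : 4 ≤ L) {k : ℕ} (hk : k ≤ L) (b : ℕ) :
    ‖((thetaApx (scale L) k * psiApx (scale L) k b : GaussianInt) : ℂ)‖ < (2 ^ L) ^ 32 / 2 := by
  have h5 := five_le_scale hL
  have hk' := twenty_mul_le_scale hL hk
  have h9 : (9 : ℝ) ≤ scale L := by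
    have : 9 ≤ scale L := by
      have := sixteen_le_two_pow hL
      have := two_pow_le_scale (L := L)
      omega
    exact_mod_cast this
  refine (norm_mul_le_of_close (norm_thetaApx_sub_le (two_dvd_scale hL) h5 k)
    (norm_psiApx_sub_le (two_dvd_scale hL) h5 b k hk') (norm_theta k).le (norm_psi k b).le h9
    (by exact_mod_cast hk')).trans_lt (four_mul_scale_sq_lt hL)

theorem norm_twiddle_lt (hL : 4 ≤ L) (b : ℕ) : ‖(twiddle L b : ℂ)‖ < (2 ^ L) ^ 32 / 2 := by
  have h0 : (1 : ℝ) ≤ 2 ^ L := one_le_pow₀ one_le_two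
  have h1 : (1 : ℝ) ≤ scale L := by rw [cast_scale]; exact one_le_pow₀ h0
  refine (norm_le_of_close (norm_twiddle_sub_le hL b) (norm_psi L b).le ?_).trans_lt
    (lt_of_le_of_lt ?_ (four_mul_scale_sq_lt hL))
  · rw [cast_scale]; exact pow_le_pow_right₀ h0 (by norm_num)
  · nlinarith

/-- Both coordinates lie between `0` and the scale, so the code is the plain number `x + y * base L`
and can be assembled without a remainder. -/
theorem enc_thetaApx (hL : 4 ≤ L) (k : ℕ) : enc (base L) (thetaApx (scale L) k) =
    cosApx (scale L * scale L) k / scale L + sinApx (scale L * scale L) k / scale L * base L := by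
  have h1 : cosApx (scale L * scale L) k / scale L ≤ scale L :=
    Nat.div_le_of_le_mul (cosApx_le _ k)
  have h2 : sinApx (scale L * scale L) k / scale L ≤ scale L :=
    Nat.div_le_of_le_mul (sinApx_le _ k)
  have h3 : 2 * scale L ≤ base L := by
    have h16 := sixteen_le_two_pow hL
    calc 2 * scale L ≤ 2 ^ L * scale L := Nat.mul_le_mul_right _ (by omega)
      _ = (2 ^ L) ^ 13 := by unfold scale; ring
      _ ≤ base L := Nat.pow_le_pow_right (by positivity) (by norm_num)
  have h4 : sinApx (scale L * scale L) k / scale L * base L + scale L ≤ base L * base L := by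
    have : (sinApx (scale L * scale L) k / scale L + 1) * base L ≤ base L * base L :=
      Nat.mul_le_mul_right _ (by have := scale_pos (L := L); omega)
    rw [Nat.succ_mul] at this
    omega
  rw [← mod_eq_enc (n := cosApx (scale L * scale L) k / scale L +
    sinApx (scale L * scale L) k / scale L * base L), Nat.mod_eq_of_lt (by omega)]
  rw [encHom_apply, thetaApx]
  push_cast
  rfl

/-- Iteration `i` multiplies the entries with binary digit `i` equal to `1` by the approximation of
`theta i`, following the recursion of `psiApx`, and then halves the angle. The two square roots cost
`O(L)` per iteration, negligible beside the pass over the array. -/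
theorem runs_twiddles (hw : Wide w L) (hG : Globals L σ) :
    Runs w .twiddles σ (2 ^ L * L * 3000) fun τ =>
      SameRegs {2, 10, 11, 12, 13, 14, 15, 16} σ τ ∧ Holds L τ 2 (twiddle L) ∧
      Holds L τ 3 (fun b => star (twiddle L b)) ∧ SameArrays L {2, 3} σ τ := by
  have hL := hw.four_le
  have h16 := hw.two_pow_lt
  have hlt := hw.length_lt
  have hMw := hw.modulus_lt
  have hQw := hw.scale_pow_lt
  have hQQ : scale L * scale L ≤ scale L * scale L * (scale L * scale L) :=
    Nat.le_mul_of_pos_right _ (by have := scale_pos (L := L); positivity)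
  have hLN : L < 2 ^ L := Nat.lt_two_pow_self
  have eQ : ∀ {τ : State}, Globals L τ → (Expr.reg 21 * Expr.reg 21).eval w τ =
      some (scale L * scale L) := fun h => eval_mul (eval_scale hw h) (eval_scale hw h) (by omega)
  set s : Set ℕ := {2, 10, 11, 12, 13, 14, 15, 16} with hs
  have hs20 : ∀ r ∈ s, r < 20 := by simp [hs]
  refine Runs.mono (K := 2 ^ L * (1 + 40) + (1 + 1 + (3 + 1 + (1 + 1 + (
    (L * (2 ^ L * 240 + 2000 * L + 100 + 3 + 1) + (3 + 1)) + 2 ^ L * 100))))) ?_ ?_ fun _ h => h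
  swap
  · have e1 : 2 ^ L * L * 3000 = L * (2 ^ L * 240) + L * (2 ^ L * 2000) + L * (2 ^ L * 700) +
      L * (2 ^ L * 60) := by ring
    have e2 : L * (2 ^ L * 240 + 2000 * L + 100 + 3 + 1) = L * (2 ^ L * 240) + L * (2000 * L) +
      L * 104 := by ring
    have k1 : L * (2000 * L) ≤ L * (2 ^ L * 2000) := Nat.mul_le_mul_left _ (by omega)
    have k2 : L * 104 ≤ L * (2 ^ L * 60) := Nat.mul_le_mul_left _ (by omega)
    have k3 : 4 * (2 ^ L * 700) ≤ L * (2 ^ L * 700) := Nat.mul_le_mul_right _ hL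
    rw [e1, e2]
    omega
  refine Runs.seq (runs_fill_array (k := 2) (fun j => enc (base L) (psiApx (scale L) 0 j)) hw hG
    (by norm_num) fun j hj σ' h2 hr ha _ => ?_) fun σ₁ ⟨r₁, f₁, a₁⟩ => ?_
  · rw [psiApx]
    have := cast_scale_mul (L := L) (c := 1) le_rfl
    rw [Nat.cast_one, mul_one, mul_one] at this
    rw [this]
    exact eval_scale hw (hG.of_sameRegs hr (by simp))
  have r₁' : SameRegs s σ σ₁ := r₁.mono (by simp [hs])
  refine Runs.seq (Q := fun τ => SameRegs s σ τ ∧ τ.reg 10 = 0 ∧ τ.mem = σ₁.mem)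
    (Runs.set (eval_const (x := 0) (by positivity))
      ⟨r₁'.trans (SameRegs.update (by simp [hs])), by simp, rfl⟩) fun σ₂ h₂ => ?_
  refine Runs.seq (Q := fun τ => SameRegs s σ τ ∧ τ.reg 10 = 0 ∧
      τ.reg 11 = scale L * scale L ∧ τ.mem = σ₁.mem)
    (Runs.set (eQ (hG.of_sameRegs h₂.1 hs20)) ⟨h₂.1.trans (SameRegs.update (by simp [hs])),
      by simpa using h₂.2.1, by simp, h₂.2.2⟩) fun σ₃ h₃ => ?_
  refine Runs.seq (Q := fun τ => SameRegs s σ τ ∧ τ.reg 10 = 0 ∧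
      τ.reg 11 = scale L * scale L ∧ τ.reg 12 = 1 ∧ τ.mem = σ₁.mem)
    (Runs.set (eval_const (x := 1) (by omega)) ⟨h₃.1.trans (SameRegs.update (by simp [hs])),
      by simpa using h₃.2.1, by simpa using h₃.2.2.1, by simp, h₃.2.2.2⟩) fun σ₄ h₄ => ?_
  refine Runs.seq (Q := fun τ => SameRegs s σ τ ∧ Holds L τ 2 (twiddle L) ∧
    SameArrays L {2, 3} σ τ) (Runs.mono (Runs.loop (fun i τ => SameRegs s σ τ ∧
    τ.reg 10 = cosApx (scale L * scale L) i ∧ τ.reg 11 = sinApx (scale L * scale L) i ∧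
    τ.reg 12 = 2 ^ i ∧ Holds L τ 2 (psiApx (scale L) i) ∧ SameArrays L {2, 3} σ τ) L
    (2 ^ L * 240 + 2000 * L + 100) ?_ ?_ ?_) (by simp only [Expr.cost, Nat.reduceAdd, le_refl]) ?_) ?_
  · refine ⟨h₄.1, h₄.2.1, h₄.2.2.1, by simpa using h₄.2.2.2.1, fun j hj => ?_,
      (a₁.mono (by simp)).trans (.of_mem_eq h₄.2.2.2.2)⟩
    rw [h₄.2.2.2.2]
    exact f₁ j hj
  · rintro i hi τ ⟨hr, h10, h11, h12, hH, ha⟩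
    have hGτ : Globals L τ := hG.of_sameRegs hr hs20
    have hm : 2 ^ i < 2 ^ L := Nat.pow_lt_pow_right one_lt_two hi
    have e3 := eval_lt hw.pos (eval_reg (w := w) h12 (by omega)) (eval_length hw hGτ)
    rw [if_pos hm] at e3
    refine ⟨⟨_, e3, one_ne_zero⟩, ?_⟩
    have hc := cosApx_le (scale L * scale L) i
    have hsn := sinApx_le (scale L * scale L) i
    have heT := enc_thetaApx hL i
    have hTlt := enc_lt_modulus (L := L) (z := thetaApx (scale L) i)
    have cTw : Expr.twiddleEntry.cost ≤ 200 := Nat.le_of_ble_eq_true rfl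
    refine Runs.mono (K := 9 + 1 + (2 ^ L * (Expr.twiddleEntry.cost + 40) + (11 + 1 + (1000 * L +
      (1 + 1 + (11 + 1 + (1000 * L + (1 + 1 + (3 + 1))))))))) ?_ ?_ fun _ h => h
    swap
    · have : 2 ^ L * (Expr.twiddleEntry.cost + 40) ≤ 2 ^ L * 240 :=
        Nat.mul_le_mul_left _ (by omega)
      omega
    refine Runs.seq (Q := fun υ => SameRegs s τ υ ∧ υ.reg 10 = cosApx (scale L * scale L) i ∧
        υ.reg 12 = 2 ^ i ∧ υ.reg 13 = enc (base L) (thetaApx (scale L) i) ∧ υ.mem = τ.mem)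
      (Runs.set (x := enc (base L) (thetaApx (scale L) i)) ?_
        ⟨SameRegs.update (by simp [hs]), by simpa using h10, by simpa using h12, by simp, rfl⟩)
      fun τ₁ ⟨q₁, p10, p12, p13, m₁⟩ => ?_
    · rw [heT] at hTlt ⊢
      exact eval_add (eval_div (eval_reg h10 (by omega)) (eval_scale hw hGτ))
        (eval_mul (eval_div (eval_reg h11 (by omega)) (eval_scale hw hGτ)) (eval_base hw hGτ)
          ((Nat.le_add_left _ _).trans_lt (hTlt.trans (by omega)))) (hTlt.trans (by omega))
    have G₁ : Globals L τ₁ := hGτ.of_sameRegs q₁ hs20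
    have H₁ : Holds L τ₁ 2 (psiApx (scale L) i) := fun j hj => by rw [m₁]; exact hH j hj
    refine Runs.seq (runs_fill_array (k := 2) (fun j => enc (base L) (psiApx (scale L) (i + 1) j))
      hw G₁ (by norm_num) fun j hj σ' h2 hr' ha' hself => ?_) fun τ₂ ⟨q₂, f₂, a₂⟩ => ?_
    · have hG' : Globals L σ' := G₁.of_sameRegs hr' (by simp)
      have e2 : (Expr.reg 2).eval w σ' = some j := eval_reg h2 (by omega)
      have he := enc_lt_modulus (L := L) (z := psiApx (scale L) i j)
      have ec : EvalsTo w L σ' (.cell 2 (.reg 2)) (psiApx (scale L) i j) :=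
        eval_cell_lt hw hG' (by norm_num) e2 hj (hself.trans (H₁ j hj)) (by omega)
      have e13 : EvalsTo w L σ' (.reg 13) (thetaApx (scale L) i) :=
        eval_reg (by rw [hr' 13 (by simp), p13]) (by omega)
      have hb := (e13.gmul hw hG' ec).grnd hw hG' (norm_thetaApx_mul_lt hL hi.le j)
      refine EvalsTo.select hw ?_ hb ec
      refine (eval_mod (eval_div e2 (eval_reg (by rw [hr' 12 (by simp), p12]) (by omega)))
        (eval_const (x := 2) (by omega))).trans (congrArg some ?_)
      have : j / 2 ^ i % 2 < 2 := Nat.mod_lt _ two_pos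
      split_ifs <;> omega
    have G₂ : Globals L τ₂ := G₁.of_sameRegs q₂ (by simp)
    have t10 : τ₂.reg 10 = cosApx (scale L * scale L) i := by rw [q₂ 10 (by simp), p10]
    have t12 : τ₂.reg 12 = 2 ^ i := by rw [q₂ 12 (by simp), p12]
    have b₁ : (scale L * scale L - cosApx (scale L * scale L) i) * (scale L * scale L) ≤
        scale L * scale L * (scale L * scale L) := Nat.mul_le_mul_right _ (by omega)
    have b₂ : (scale L * scale L + cosApx (scale L * scale L) i) * (scale L * scale L) ≤
        2 * (scale L * scale L * (scale L * scale L)) := by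
      rw [← mul_assoc 2]; exact Nat.mul_le_mul_right _ (by omega)
    -- The sine comes first: both square roots need the old cosine, so register `10` is replaced
    -- only at the end.
    refine Runs.seq (Q := fun υ => SameRegs s τ₂ υ ∧ υ.reg 14 =
        (scale L * scale L - cosApx (scale L * scale L) i) * (scale L * scale L) / 2 ∧
        υ.reg 10 = τ₂.reg 10 ∧ υ.reg 12 = τ₂.reg 12 ∧ υ.mem = τ₂.mem)
      (Runs.set (eval_div (eval_mul (eval_sub (eQ G₂) (eval_reg t10 (by omega))) (eQ G₂) (by omega))
        (eval_const (x := 2) (by omega)))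
        ⟨SameRegs.update (by simp [hs]), by simp, by simp, by simp, rfl⟩)
      fun τ₃ ⟨q₃, p14, h310, h312, m₃⟩ => ?_
    have G₃ : Globals L τ₃ := G₂.of_sameRegs q₃ hs20
    refine Runs.seq (runs_sqrt hw G₃ p14 ((Nat.div_le_self _ _).trans b₁))
      fun τ₄ ⟨q₄, p15, m₄⟩ => ?_
    have q₄' : SameRegs s τ₂ τ₄ := q₃.trans (q₄.mono (by simp [hs, Set.subset_def]))
    have hS := sinApx_le (scale L * scale L) (i + 1)
    have hC := cosApx_le (scale L * scale L) (i + 1)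
    have v10 : τ₄.reg 10 = cosApx (scale L * scale L) i := by
      rw [q₄ 10 (by simp), h310, t10]
    have v12 : τ₄.reg 12 = 2 ^ i := by rw [q₄ 12 (by simp), h312, t12]
    replace p15 : τ₄.reg 15 = sinApx (scale L * scale L) (i + 1) := p15
    refine Runs.seq (Q := fun υ => SameRegs s τ₂ υ ∧ υ.reg 10 = cosApx (scale L * scale L) i ∧
        υ.reg 11 = sinApx (scale L * scale L) (i + 1) ∧ υ.reg 12 = 2 ^ i ∧ υ.mem = τ₂.mem)
      (Runs.set (eval_reg p15 (by omega)) ⟨q₄'.trans (SameRegs.update (by simp [hs])),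
        by simpa using v10, by simp, by simpa using v12, m₄.trans m₃⟩)
      fun τ₅ ⟨q₅, w10, w11, w12, m₅⟩ => ?_
    have G₅ : Globals L τ₅ := G₂.of_sameRegs q₅ hs20
    refine Runs.seq (Q := fun υ => SameRegs s τ₂ υ ∧ υ.reg 14 =
        (scale L * scale L + cosApx (scale L * scale L) i) * (scale L * scale L) / 2 ∧
        υ.reg 11 = sinApx (scale L * scale L) (i + 1) ∧ υ.reg 12 = 2 ^ i ∧ υ.mem = τ₂.mem)
      (Runs.set (eval_div (eval_mul (eval_add (eQ G₅) (eval_reg w10 (by omega)) (by omega))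
        (eQ G₅) (by omega)) (eval_const (x := 2) (by omega)))
        ⟨q₅.trans (SameRegs.update (by simp [hs])), by simp, by simpa using w11,
          by simpa using w12, m₅⟩)
      fun τ₆ ⟨q₆, x14, x11, x12, m₆⟩ => ?_
    have G₆ : Globals L τ₆ := G₂.of_sameRegs q₆ hs20
    refine Runs.seq (runs_sqrt hw G₆ x14 (by omega)) fun τ₇ ⟨q₇, y15, m₇⟩ => ?_
    have q₇' : SameRegs s τ₂ τ₇ := q₆.trans (q₇.mono (by simp [hs, Set.subset_def]))
    have y11 : τ₇.reg 11 = sinApx (scale L * scale L) (i + 1) := by rw [q₇ 11 (by simp), x11]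
    have y12 : τ₇.reg 12 = 2 ^ i := by rw [q₇ 12 (by simp), x12]
    replace y15 : τ₇.reg 15 = cosApx (scale L * scale L) (i + 1) := y15
    refine Runs.seq (Q := fun υ => SameRegs s τ₂ υ ∧
        υ.reg 10 = cosApx (scale L * scale L) (i + 1) ∧
        υ.reg 11 = sinApx (scale L * scale L) (i + 1) ∧ υ.reg 12 = 2 ^ i ∧ υ.mem = τ₂.mem)
      (Runs.set (eval_reg y15 (by omega)) ⟨q₇'.trans (SameRegs.update (by simp [hs])),
        by simp, by simpa using y11, by simpa using y12, m₇.trans m₆⟩)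
      fun τ₈ ⟨q₈, z10, z11, z12, m₈⟩ => ?_
    refine Runs.set (eval_mul (eval_const (x := 2) (by omega)) (eval_reg z12 (by omega))
      (by omega)) ⟨?_, by simpa using z10, by simpa using z11, by simp [pow_succ'], ?_, ?_⟩
    · exact (((hr.trans q₁).trans (q₂.mono (by simp [hs]))).trans q₈).trans
        (SameRegs.update (by simp [hs]))
    · intro j hj
      exact (congrFun m₈ _).trans (f₂ j hj)
    · exact ((ha.trans (.of_mem_eq m₁)).trans (a₂.mono (by simp))).trans (.of_mem_eq m₈)
  · rintro τ ⟨hr, -, -, h12, -⟩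
    have e3 := eval_lt hw.pos (eval_reg (w := w) h12 (by omega))
      (eval_length hw (hG.of_sameRegs hr hs20))
    rwa [if_neg (lt_irrefl _)] at e3
  · rintro τ ⟨hr, -, -, -, hH, ha⟩
    exact ⟨hr, hH, ha⟩
  · rintro τ ⟨hr, hH, ha⟩
    have hGτ : Globals L τ := hG.of_sameRegs hr hs20
    have cS : (Expr.gstar (.cell 2 (.reg 2))).cost ≤ 60 := Nat.le_of_ble_eq_true rfl
    refine Runs.mono (runs_fill_array (k := 3) (fun j => enc (base L) (star (twiddle L j)))
      hw hGτ (by norm_num) fun j hj σ' h2 hr' ha' _ => ?_)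
      (Nat.mul_le_mul_left _ (by omega)) ?_
    · have hG' : Globals L σ' := hGτ.of_sameRegs hr' (by simp)
      exact ((hH.congr ha' (by simp)).evalsTo_cell hw hG' (by norm_num) (eval_reg h2 (by omega))
        hj).gstar hw hG' (norm_twiddle_lt hL j)
    · rintro υ ⟨hr', hf, ha'⟩
      exact ⟨hr.trans (hr'.mono (by simp [hs])), hH.congr ha' (by simp), hf,
        ha.trans (ha'.mono (by simp))⟩

end Twiddles

end WordRAM

namespace WordRAM

open FFT

/-! ### Initialization -/

/-- Powers of an expression. -/
def Expr.npow (a : Expr) : ℕ → Expr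
  | 0 => .const 1
  | k + 1 => a.npow k * a

/-- Compute the largest coin in register `27`. -/
def Prog.largest : Prog :=
  .seq (.set 27 (.const 0)) (.seq (.set 9 (.const 0))
    (.loop (.op .lt (.reg 9) (.load (.const 0)))
      (.seq (.set 27 (.reg 27 + (.load (.reg 9 + .const 2) - .reg 27)))
        (.set 9 (.reg 9 + .const 1)))))

/-- Compute the length of the arrays in register `20`. -/
def Prog.length : Prog :=
  .seq (.set 20 (.const 1)) (.loop (.op .lt (.reg 20) (.const 9 * .reg 27 + .const 1))
    (.set 20 (.const 2 * .reg 20)))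

/-- Compute the parameters of the arithmetic and reduce the target. -/
def Prog.parameters : Prog :=
  .seq (.set 21 (Expr.npow (.reg 20) 12)) (.seq (.set 22 (Expr.npow (.reg 20) 32))
  (.seq (.set 23 (.reg 22 * .reg 22 + .const 1))
  (.seq (.set 24 (.reg 22 / .const 2 * .reg 22 + .reg 22 / .const 2))
  (.seq (.set 25 (.reg 22 / .const 2 / .reg 21 * .reg 22 + .reg 22 / .const 2 / .reg 21))
  (.seq (.set 26 (.reg 22 / .const 2 * .reg 22 - .reg 22 / .const 2))
  (.seq (.set 30 (.reg 22 / .const 2 + Expr.npow (.reg 20) 13 / .const 2))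
  (.seq (.set 29 ((.load (.const 1) - .reg 27 * .reg 27) / .reg 27))
    (.set 28 (.load (.const 1) - .reg 29 * .reg 27)))))))))

/-- Mark the coins in array `1`. -/
def Prog.coins : Prog :=
  .seq (.set 9 (.const 0)) (.loop (.op .lt (.reg 9) (.load (.const 0)))
    (.seq (.store (.reg 20 + .load (.reg 9 + .const 2)) (.const 1))
      (.set 9 (.reg 9 + .const 1))))

/-- The whole algorithm. -/
def Prog.minCoins : Prog :=
  .seq .largest (.seq .length (.seq .parameters (.seq .coins (.seq .twiddles (.seq .search
    (.seq (.set 0 (.op .lt (.reg 5) (.reg 20 - .const 1))) (.set 1 (.reg 5 + .reg 29))))))))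

section Init

variable {w L u t : ℕ} {v : List ℕ} {σ : State}

theorem eval_npow {a : Expr} {x : ℕ} (ha : a.eval w σ = some x) (hx : 0 < x) :
    ∀ {k : ℕ}, x ^ k < 2 ^ w → (a.npow k).eval w σ = some (x ^ k)
  | 0, h => eval_const h
  | k + 1, h =>
    eval_mul (eval_npow ha hx ((Nat.pow_le_pow_right hx k.le_succ).trans_lt h)) ha h

theorem runs_largest (hu : u ∈ v) (hv : ∀ x ∈ v, x ≤ u) (hn : v.length ≤ u)
    (hw : 16 * u + 16 < 2 ^ w) (hσ : σ.mem = (input v t).mem) :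
    Runs w .largest σ (20 * u + 20) fun τ => τ.mem = σ.mem ∧ τ.reg 27 = u := by
  have hw0 : 0 < w := Nat.pos_of_ne_zero fun h => by simp [h] at hw
  refine Runs.mono (K := 1 + 1 + (1 + 1 + (v.length * (13 + 4 + 1) + (4 + 1)))) ?_ (by omega)
    fun _ h => h
  have el : ∀ {τ : State}, τ.mem = σ.mem →
      (Expr.load (.const 0)).eval w τ = some v.length := fun h =>
    eval_load (eval_const (by omega)) (by rw [h, hσ]; rfl) (by omega)
  refine Runs.seq (Q := fun τ => τ.reg 27 = 0 ∧ τ.mem = σ.mem)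
    (Runs.set (eval_const (x := 0) (by omega)) ⟨by simp, rfl⟩) fun σ₁ h₁ => ?_
  refine Runs.seq (Q := fun τ => τ.reg 9 = 0 ∧ τ.reg 27 = 0 ∧ τ.mem = σ.mem)
    (Runs.set (eval_const (x := 0) (by omega)) ⟨by simp, by simpa using h₁.1, h₁.2⟩)
    fun σ₂ h₂ => ?_
  refine Runs.mono (Runs.loop (fun i τ => τ.reg 9 = i ∧ τ.reg 27 ≤ u ∧
    (∀ x ∈ v.take i, x ≤ τ.reg 27) ∧ τ.mem = σ.mem) v.length 13 ?_ ?_ ?_)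
    (by simp only [Expr.cost, le_refl]) ?_
  · exact ⟨h₂.1, by omega, by simp, h₂.2.2⟩
  · rintro i hi τ ⟨h9, h27, hmax, hm⟩
    have e9 : (Expr.reg 9).eval w τ = some i := eval_reg h9 (by omega)
    have e3 := eval_lt hw0 e9 (el hm)
    rw [if_pos hi] at e3
    refine ⟨⟨_, e3, one_ne_zero⟩, ?_⟩
    have hle : v[i] ≤ u := hv _ (List.getElem_mem hi)
    have ev : (Expr.load (.reg 9 + .const 2)).eval w τ = some v[i] :=
      eval_load (eval_add e9 (eval_const (by omega)) (by omega))
        (by rw [hm, hσ]; simp [input, hi]) (by omega)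
    have e27 : (Expr.reg 27).eval w τ = some (τ.reg 27) := eval_reg rfl (by omega)
    refine Runs.mono (K := 8 + 1 + (3 + 1)) ?_ (by norm_num) fun _ h => h
    -- With truncated subtraction, `a + (b - a)` is the maximum of `a` and `b`.
    refine Runs.seq (Q := fun υ => υ.reg 9 = i ∧ υ.reg 27 = τ.reg 27 + (v[i] - τ.reg 27) ∧
        υ.mem = σ.mem)
      (Runs.set (eval_add e27 (eval_sub ev e27) (by omega)) ⟨by simpa using h9, by simp, hm⟩)
      fun υ ⟨h9', h27', hm'⟩ => Runs.set (eval_add (eval_reg h9' (by omega))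
        (eval_const (x := 1) (by omega)) (by omega)) ⟨by simp, ?_, ?_, hm'⟩
    · simp only [ne_eq, Nat.reduceEqDiff, not_false_eq_true,
        Function.update_of_ne, h27']
      omega
    · simp only [ne_eq, Nat.reduceEqDiff, not_false_eq_true,
        Function.update_of_ne, h27']
      intro x hx
      rw [List.take_add_one, List.getElem?_eq_getElem hi] at hx
      rcases List.mem_append.1 hx with hx | hx
      · have := hmax x hx
        omega
      · obtain rfl : x = v[i] := by simpa using hx
        omega
  · rintro τ ⟨h9, -, -, hm⟩
    have e3 := eval_lt hw0 (eval_reg (w := w) h9 (by omega)) (el hm)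
    rwa [if_neg (lt_irrefl _)] at e3
  · rintro τ ⟨-, h27, hmax, hm⟩
    exact ⟨hm, le_antisymm h27 (hmax u (by simpa using hu))⟩

theorem runs_length (h27 : σ.reg 27 = u) (hw : Wide w L) (hu : 9 * u < 2 ^ L)
    (hL : ∀ i < L, 2 ^ i ≤ 9 * u) :
    Runs w .length σ (20 * L + 20) fun τ => τ.mem = σ.mem ∧ τ.reg 27 = u ∧ τ.reg 20 = 2 ^ L := by
  have hlt := hw.length_lt
  have h16 := hw.two_pow_lt
  have ec : ∀ {i : ℕ} {τ : State}, i ≤ L → τ.reg 27 = u → τ.reg 20 = 2 ^ i →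
      (Expr.op .lt (.reg 20) (.const 9 * .reg 27 + .const 1)).eval w τ =
        some (if 2 ^ i < 9 * u + 1 then 1 else 0) := by
    intro i τ hi h h'
    have : 2 ^ i ≤ 2 ^ L := Nat.pow_le_pow_right two_pos hi
    exact eval_lt hw.pos (eval_reg h' (by omega)) (eval_add (eval_mul (eval_const (by omega))
      (eval_reg h (by omega)) (by omega)) (eval_const (by omega)) (by omega))
  refine Runs.mono (K := 1 + 1 + (L * (4 + 7 + 1) + (7 + 1))) ?_ (by omega) fun _ h => h
  refine Runs.seq (Q := fun τ => τ.mem = σ.mem ∧ τ.reg 27 = u ∧ τ.reg 20 = 1)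
    (Runs.set (eval_const (x := 1) (by omega)) ⟨rfl, by simpa using h27, by simp⟩)
    fun σ₁ h₁ => ?_
  refine Runs.mono (Runs.loop (fun i τ => τ.mem = σ.mem ∧ τ.reg 27 = u ∧ τ.reg 20 = 2 ^ i) L 4
    ?_ ?_ ?_) (by simp only [Expr.cost, le_refl]) fun _ h => h
  · simpa using h₁
  · rintro i hi τ ⟨hm, h, h'⟩
    have e := ec hi.le h h'
    have := hL i hi
    rw [if_pos (by omega)] at e
    refine ⟨⟨_, e, one_ne_zero⟩, ?_⟩
    exact Runs.set (eval_mul (eval_const (x := 2) (by omega)) (eval_reg h' (by omega)) (by omega))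
      ⟨hm, by simpa using h, by simp [pow_succ']⟩
  · rintro τ ⟨hm, h, h'⟩
    have e := ec le_rfl h h'
    rwa [if_neg (by omega)] at e

theorem runs_parameters (hw : Wide w L) (hu0 : 0 < u) (hu : 9 * u < 2 ^ L) (ht : t < 2 ^ w)
    (h20 : σ.reg 20 = 2 ^ L) (h27 : σ.reg 27 = u) (h1 : σ.mem 1 = t) :
    Runs w .parameters σ 400 fun τ => τ.mem = σ.mem ∧ Globals L τ ∧ τ.reg 27 = u ∧
      τ.reg 28 = t - (t - u * u) / u * u ∧ τ.reg 29 = (t - u * u) / u ∧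
      τ.reg 30 = half L + (2 ^ L) ^ 13 / 2 := by
  have hlt := hw.length_lt
  have hMw := hw.modulus_lt
  have h16 := hw.two_pow_lt
  have hp12 := hw.pow_lt (k := 12) (by norm_num)
  have hp32 := hw.pow_lt (k := 32) (by norm_num)
  have hp13 := hw.pow_lt (k := 13) (by norm_num)
  have hN0 : 0 < 2 ^ L := by positivity
  have hshift := shift_le hw.four_le
  have hunshift := unshift_le hw.four_le
  have hM : modulus L = base L * base L + 1 := rfl
  have hh : base L / 2 = half L := rfl
  have hB := base_le_modulus (L := L)
  have h13B : (2 ^ L) ^ 13 ≤ base L := Nat.pow_le_pow_right hN0 (by norm_num)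
  have huu : u * u < 2 ^ w := by
    have : u * u ≤ 2 ^ L * 2 ^ L := Nat.mul_le_mul (by omega) (by omega)
    have := hw.pow_lt (k := 2) (by norm_num)
    rw [pow_two] at this
    omega
  have hk : (t - u * u) / u * u ≤ t := (Nat.div_mul_le_self _ _).trans (Nat.sub_le _ _)
  have hkt : (t - u * u) / u ≤ t := (Nat.div_le_self _ _).trans (Nat.sub_le _ _)
  have hhalf : half L ≤ base L := Nat.div_le_self _ _
  have hhs : half L / scale L ≤ half L := Nat.div_le_self _ _
  have e20 : ∀ {τ : State}, τ.reg 20 = 2 ^ L → (Expr.reg 20).eval w τ = some (2 ^ L) :=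
    fun h => eval_reg h (by omega)
  have e22 : ∀ {τ : State}, τ.reg 22 = base L → (Expr.reg 22).eval w τ = some (base L) :=
    fun h => eval_reg h (by omega)
  have eh : ∀ {τ : State}, τ.reg 22 = base L →
      (Expr.reg 22 / Expr.const 2).eval w τ = some (half L) :=
    fun h => eval_div (e22 h) (eval_const (x := 2) (by omega))
  have e27 : ∀ {τ : State}, τ.reg 27 = u → (Expr.reg 27).eval w τ = some u :=
    fun h => eval_reg h (by omega)
  have e1 : ∀ {τ : State}, τ.mem = σ.mem → (Expr.load (.const 1)).eval w τ = some t :=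
    fun h => eval_load (eval_const (by omega)) (by rw [h, h1]) ht
  refine Runs.mono (K := 25 + 1 + (65 + 1 + (5 + 1 + (9 + 1 + (13 + 1 + (9 + 1 + (33 + 1 +
    (8 + 1 + (6 + 1))))))))) ?_ (by norm_num) fun _ h => h
  refine Runs.seq (Q := (· = _)) (Runs.set (x := scale L) (eval_npow (e20 h20) hN0 hp12) rfl) ?_
  rintro _ rfl
  refine Runs.seq (Q := (· = _)) (Runs.set (x := base L)
    (eval_npow (e20 (by simpa using h20)) hN0 hp32) rfl) ?_
  rintro _ rfl
  refine Runs.seq (Q := (· = _)) (Runs.set (x := modulus L) (eval_add (eval_mul (e22 (by simp))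
    (e22 (by simp)) (by omega)) (eval_const (by omega)) (by omega)) rfl) ?_
  rintro _ rfl
  refine Runs.seq (Q := (· = _)) (Runs.set (eval_add (eval_mul (eh (by simp))
    (e22 (by simp)) (by omega)) (eh (by simp)) (by omega)) rfl) ?_
  rintro _ rfl
  refine Runs.seq (Q := (· = _)) (Runs.set (eval_add (eval_mul (eval_div (eh (by simp))
    (eval_reg (x := scale L) (by simp) hp12)) (e22 (by simp))
    (((Nat.le_add_right _ _).trans hunshift).trans_lt (by omega)))
    (eval_div (eh (by simp)) (eval_reg (x := scale L) (by simp) hp12))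
    (hunshift.trans_lt (by omega))) rfl) ?_
  rintro _ rfl
  refine Runs.seq (Q := (· = _)) (Runs.set (eval_sub (eval_mul (eh (by simp))
    (e22 (by simp)) (by omega)) (eh (by simp))) rfl) ?_
  rintro _ rfl
  refine Runs.seq (Q := (· = _)) (Runs.set (eval_add (eh (by simp)) (eval_div
    (eval_npow (e20 (by simpa using h20)) hN0 hp13) (eval_const (x := 2) (by omega)))
    (by omega)) rfl) ?_
  rintro _ rfl
  refine Runs.seq (Q := (· = _)) (Runs.set (eval_div (eval_sub (e1 rfl)
    (eval_mul (e27 (by simpa using h27)) (e27 (by simpa using h27)) huu))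
    (e27 (by simpa using h27))) rfl) ?_
  rintro _ rfl
  refine Runs.set (eval_sub (e1 rfl) (eval_mul (eval_reg (x := (t - u * u) / u) (by simp)
    (by omega)) (e27 (by simpa using h27)) (by omega)))
    ⟨rfl, ⟨?_, ?_, ?_, ?_, ?_, ?_, ?_⟩, ?_, ?_, ?_, ?_⟩
  all_goals simp [h20, h27]

/-- The input occupies cells below `2 ^ L`, that is, array `0`; marking in array `1` leaves it
intact while it is read. All other cells of array `1` still have their initial value `0`. -/
theorem runs_coins (hw : Wide w L) (hv : ∀ x ∈ v, 9 * x < 2 ^ L) (hn : 9 * v.length < 2 ^ L)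
    (hσ : σ.mem = (input v t).mem) (h20 : σ.reg 20 = 2 ^ L) :
    Runs w .coins σ (20 * 2 ^ L) fun τ => SameRegs {9} σ τ ∧
      HoldsSet L τ 1 (· ∈ v.toFinset) := by
  have hlt := hw.length_lt
  have h16 := hw.two_pow_lt
  have el : ∀ {τ : State}, τ.mem 0 = σ.mem 0 →
      (Expr.load (.const 0)).eval w τ = some v.length := fun h =>
    eval_load (eval_const (by omega)) (by rw [h, hσ]; rfl) (by omega)
  refine Runs.mono (K := 1 + 1 + (v.length * (12 + 4 + 1) + (4 + 1))) ?_ (by omega) fun _ h => h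
  refine Runs.seq (Q := fun τ => SameRegs {9} σ τ ∧ τ.reg 9 = 0 ∧ τ.mem = σ.mem)
    (Runs.set (eval_const (x := 0) (by omega)) ⟨SameRegs.update (by simp), by simp, rfl⟩)
    fun σ₁ h₁ => ?_
  refine Runs.mono (Runs.loop (fun i τ => SameRegs {9} σ τ ∧ τ.reg 9 = i ∧
    (∀ x ∈ v.take i, τ.mem (2 ^ L + x) = 1) ∧
    ∀ a, (∀ x ∈ v.take i, a ≠ 2 ^ L + x) → τ.mem a = σ.mem a) v.length 12 ?_ ?_ ?_)
    (by simp only [Expr.cost, le_refl]) ?_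
  · exact ⟨h₁.1, h₁.2.1, by simp, fun a _ => by rw [h₁.2.2]⟩
  · rintro i hi τ ⟨hr, h9, hone, hsame⟩
    have e9 : (Expr.reg 9).eval w τ = some i := eval_reg h9 (by omega)
    have hlow : ∀ a < 2 ^ L, τ.mem a = σ.mem a := fun a ha => hsame a fun x _ => by omega
    have e3 := eval_lt hw.pos e9 (el (hlow 0 (by omega)))
    rw [if_pos hi] at e3
    refine ⟨⟨_, e3, one_ne_zero⟩, ?_⟩
    have hle := hv _ (List.getElem_mem hi)
    have ev : (Expr.load (.reg 9 + .const 2)).eval w τ = some v[i] :=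
      eval_load (eval_add e9 (eval_const (by omega)) (by omega))
        (by rw [hlow _ (by omega), hσ]; simp [input, hi]) (by omega)
    refine Runs.mono (K := 6 + 1 + 1 + (3 + 1)) ?_ (by norm_num) fun _ h => h
    refine Runs.seq (Q := fun υ => υ.reg = τ.reg ∧ υ.mem = Function.update τ.mem (2 ^ L + v[i]) 1)
      (Runs.store (eval_add (eval_reg ((hr 20 (by simp)).trans h20) (by omega)) ev (by omega))
        (eval_const (by omega)) ⟨rfl, rfl⟩)
      fun υ ⟨hr', hm'⟩ => Runs.set (eval_add (eval_reg ((congrFun hr' 9).trans h9) (by omega))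
        (eval_const (x := 1) (by omega)) (by omega)) ⟨?_, by simp, ?_, ?_⟩
    · exact (hr.trans fun r _ => by rw [hr']).trans (SameRegs.update (by simp))
    · intro x hx
      rw [List.take_add_one, List.getElem?_eq_getElem hi] at hx
      simp only [hm', Function.update_apply]
      rcases List.mem_append.1 hx with hx | hx
      · rw [hone x hx, ite_self]
      · obtain rfl : x = v[i] := by simpa using hx
        rw [if_pos rfl]
    · intro a ha
      rw [List.take_add_one, List.getElem?_eq_getElem hi] at ha
      simp only [hm', Function.update_apply]
      rw [if_neg (ha _ (List.mem_append_right _ (by simp)))]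
      exact hsame a fun x hx => ha x (List.mem_append_left _ hx)
  · rintro τ ⟨-, h9, -, hsame⟩
    have e3 := eval_lt hw.pos (eval_reg (w := w) h9 (by omega))
      (el (hsame 0 fun x _ => by omega))
    rwa [if_neg (lt_irrefl _)] at e3
  · rintro τ ⟨hr, -, hone, hsame⟩
    rw [List.take_length] at hone hsame
    refine ⟨hr, fun j hj => ⟨fun h => ?_, fun h => ?_⟩⟩
    · rw [one_mul]
      exact hone j (List.mem_toFinset.1 h)
    · rw [one_mul, hsame _ fun x hx hxj => h (List.mem_toFinset.2 (by
        obtain rfl : j = x := by omega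
        exact hx)), hσ]
      exact List.getD_eq_default _ _ (by simp only [List.length_cons]; omega)

end Init

/-! ### The main theorem -/

section Main

variable {w L u t D k : ℕ} {V : Finset ℕ} {v : List ℕ}

/-- The search works with the reduced target, and the stripped copies `(t - u * u) / u` of the
largest coin are added at the end. The value `D = 2 ^ L - 1` encodes that there is no solution. -/
theorem runs_minCoins (hw : Wide w L) (huv : u ∈ v) (hv : ∀ x ∈ v, 0 < x ∧ x ≤ u)
    (hn : v.length ≤ u) (hu : 9 * u < 2 ^ L) (hL : ∀ i < L, 2 ^ i ≤ 9 * u)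
    (ht : t + 2 ^ L < 2 ^ w) (hD : D < 2 ^ L)
    (hDm : ∀ m, m + 1 < 2 ^ L →
      (Feasible v.toFinset m (t - (t - u * u) / u * u) ↔ D ≤ m)) :
    Runs w .minCoins (input v t) (2 ^ L * L * L * L * 6000) fun τ =>
      output τ = if D < 2 ^ L - 1 then ((D + (t - u * u) / u : ℕ) : ℕ∞) else ⊤ := by
  have hlt := hw.length_lt
  have h16 := hw.two_pow_lt
  have hL4 := hw.four_le
  have hu0 := (hv u huv).1
  have hkt : (t - u * u) / u ≤ t := (Nat.div_le_self _ _).trans (Nat.sub_le _ _)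
  refine Runs.mono (K := 20 * u + 20 + (20 * L + 20 + (400 + (20 * 2 ^ L + (2 ^ L * L * 3000 +
    (2 ^ L * L * L * L * 2200 + (5 + 1 + (3 + 1)))))))) ?_ ?_ fun _ h => h
  swap
  · have h1 : 2 ^ L * L * (4 * 4) ≤ 2 ^ L * L * (L * L) :=
      Nat.mul_le_mul_left _ (Nat.mul_le_mul hL4 hL4)
    have h2 : 2 ^ L * 4 ≤ 2 ^ L * L := Nat.mul_le_mul_left _ hL4
    have h3 : L < 2 ^ L := Nat.lt_two_pow_self
    rw [← mul_assoc (2 ^ L * L) L L] at h1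
    generalize 2 ^ L * L * L * L = x at *
    generalize 2 ^ L * L = y at *
    omega
  refine Runs.seq (runs_largest huv (fun x hx => (hv x hx).2) hn (by omega) rfl)
    fun σ₁ ⟨m₁, l₁⟩ => ?_
  refine Runs.seq (runs_length l₁ hw hu hL) fun σ₂ ⟨m₂, l₂, n₂⟩ => ?_
  have M₂ : σ₂.mem = (input v t).mem := m₂.trans m₁
  refine Runs.seq (runs_parameters hw hu0 hu (t := t) (by omega) n₂ l₂ (by rw [M₂]; rfl))
    fun σ₃ ⟨m₃, G₃, l₃, t₃, k₃, s₃⟩ => ?_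
  refine Runs.seq (runs_coins hw (fun x hx => by have := hv x hx; omega) (by omega)
    (m₃.trans M₂) G₃.length) fun σ₄ ⟨r₄, c₄⟩ => ?_
  refine Runs.seq (runs_twiddles hw (G₃.of_sameRegs r₄ (by simp)))
    fun σ₅ ⟨r₅, w₅, c₅, a₅⟩ => ?_
  have G₅ : Globals L σ₅ := (G₃.of_sameRegs r₄ (by simp)).of_sameRegs r₅ (by simp)
  have R : Ready L u (t - (t - u * u) / u * u) v.toFinset σ₅ :=
    { globals := G₅
      largest := by rw [r₅ 27 (by simp), r₄ 27 (by simp), l₃]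
      target := by rw [r₅ 28 (by simp), r₄ 28 (by simp), t₃]
      threshold := by rw [r₅ 30 (by simp), r₄ 30 (by simp), s₃]
      coins := c₄.congr a₅ (by simp)
      twiddle := w₅
      conjTwiddle := c₅ }
  have ht' : t - (t - u * u) / u * u < 2 ^ L * 2 ^ L := by
    have h1 : t - u * u < (t - u * u) / u * u + u := Nat.lt_div_mul_add hu0
    have h2 : u * u + u ≤ 2 ^ L * 2 ^ L := by
      calc u * u + u = u * (u + 1) := by ring
        _ ≤ 2 ^ L * 2 ^ L := Nat.mul_le_mul (by omega) (by omega)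
    omega
  refine Runs.seq (runs_search hw R (fun x hx => hv x (List.mem_toFinset.1 hx)) hu ht' hD hDm)
    fun σ₆ ⟨r₆, d₆⟩ => ?_
  have n₆ : σ₆.reg 20 = 2 ^ L := by rw [r₆ 20 (by simp), G₅.length]
  have k₆ : σ₆.reg 29 = (t - u * u) / u := by
    rw [r₆ 29 (by simp), r₅ 29 (by simp), r₄ 29 (by simp), k₃]
  refine Runs.seq (Q := fun τ => τ.reg 0 = (if D < 2 ^ L - 1 then 1 else 0) ∧ τ.reg 5 = D ∧
      τ.reg 29 = (t - u * u) / u)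
    (Runs.set (eval_lt hw.pos (eval_reg d₆ (by omega)) (eval_sub (eval_reg n₆ (by omega))
      (eval_const (x := 1) (by omega)))) ⟨by simp, by simpa using d₆, by simpa using k₆⟩)
    fun σ₇ ⟨h0, h5, h29⟩ => Runs.set (eval_add (eval_reg h5 (by omega))
      (eval_reg h29 (by omega)) (by omega)) ?_
  simp only [output, ne_eq, zero_ne_one, not_false_eq_true, Function.update_of_ne,
    Function.update_self, h0]
  split_ifs <;> simp_all

end Main

end WordRAM

/-! ### From the search result to `minCoins`, and the bounds on time and word length -/

theorem minCoins_eq_coe {V : Finset ℕ} {t n : ℕ} (h : ∀ m, Feasible V m t ↔ n ≤ m) :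
    minCoins V t = n := by
  refine le_antisymm (minCoins_le_iff.2 ((h n).2 le_rfl)) ?_
  by_contra hlt
  obtain ⟨m, hm⟩ := ENat.ne_top_iff_exists.1 (ne_top_of_lt (not_le.1 hlt))
  have := (h m).1 (minCoins_le_iff.1 hm.symm.le)
  rw [← hm] at hlt
  exact hlt (by exact_mod_cast this)

theorem minCoins_eq_top {V : Finset ℕ} {t : ℕ} (h : ∀ m, ¬ Feasible V m t) :
    minCoins V t = ⊤ := by
  by_contra hne
  obtain ⟨m, hm⟩ := ENat.ne_top_iff_exists.1 hne
  exact h m (minCoins_le_iff.1 hm.symm.le)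

/-- The number of coins for the reduced target, truncated, determines `minCoins`. -/
theorem exists_threshold {V : Finset ℕ} {u t N : ℕ} (huV : u ∈ V) (hV : ∀ x ∈ V, x ≤ u)
    (hu : 0 < u) (hN : 9 * u < N) : ∃ D < N,
      (∀ m, m + 1 < N → (Feasible V m (t - (t - u * u) / u * u) ↔ D ≤ m)) ∧
      (if D < N - 1 then ((D + (t - u * u) / u : ℕ) : ℕ∞) else ⊤) = minCoins V t := by
  have h1 : t - u * u < (t - u * u) / u * u + u := Nat.lt_div_mul_add hu
  have h2 : (t - u * u) / u * u ≤ t - u * u := Nat.div_mul_le_self _ _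
  -- Truncated subtraction covers small targets: for `t ≤ u * u` no coin is stripped, and otherwise
  -- at least `u * u` remains, as `feasible_add_mul_iff` requires.
  have hk : (t - u * u) / u = 0 ∨ u * u ≤ t - (t - u * u) / u * u := by
    rcases le_total (u * u) t with h | h
    · right; omega
    · left; rw [Nat.sub_eq_zero_of_le h, Nat.zero_div]
  have hsum : t - (t - u * u) / u * u + (t - u * u) / u * u = t := Nat.sub_add_cancel (by omega)
  have hlt : t - (t - u * u) / u * u < u * u + u := by omega
  generalize (t - u * u) / u = k at *
  generalize t - k * u = s at *
  subst hsum
  have key : ∀ m, Feasible V m (s + k * u) ↔ k ≤ m ∧ Feasible V (m - k) s := by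
    intro m
    constructor
    · intro h
      have hkm := h.le_of_large huV hV hu hk
      refine ⟨hkm, (feasible_add_mul_iff huV hV hu hk).1 ?_⟩
      rwa [Nat.sub_add_cancel hkm]
    · rintro ⟨hkm, h⟩
      have := (feasible_add_mul_iff huV hV hu hk).2 h
      rwa [Nat.sub_add_cancel hkm] at this
  classical
  by_cases hex : ∃ m, Feasible V m s
  · have hD : ∀ m, Feasible V m s ↔ Nat.find hex ≤ m :=
      fun m => ⟨Nat.find_min' hex, (Nat.find_spec hex).mono⟩
    have h2u : Nat.find hex ≤ 2 * u :=
      (hD _).1 ((Nat.find_spec hex).le_two_mul huV hV hu hlt)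
    refine ⟨Nat.find hex, by omega, fun m _ => hD m, ?_⟩
    rw [if_pos (by omega)]
    refine (minCoins_eq_coe fun m => ?_).symm
    rw [key, hD]
    omega
  · push Not at hex
    -- If the target is unreachable, both sides of the equivalence are false for every `m` below `N
    -- - 1`.
    refine ⟨N - 1, by omega, fun m hm => ⟨fun h => absurd h (hex m), fun h => by omega⟩, ?_⟩
    rw [if_neg (lt_irrefl _)]
    exact (minCoins_eq_top fun m h => hex _ ((key m).1 h).2).symm

theorem pow_clog_le {u : ℕ} (hu : 0 < u) : 2 ^ Nat.clog 2 (9 * u + 1) ≤ 18 * u := by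
  have h := Nat.pow_pred_clog_lt_self one_lt_two (show 1 < 9 * u + 1 by omega)
  have hp := Nat.clog_pos one_lt_two (show 1 < 9 * u + 1 by omega)
  have e : 2 ^ Nat.clog 2 (9 * u + 1) = 2 * 2 ^ (Nat.clog 2 (9 * u + 1)).pred := by
    rw [← pow_succ']
    exact congrArg _ (Nat.succ_pred_eq_of_pos hp).symm
  omega

/-- From `18 * u ≤ 2 ^ 5 * (u + 1) ≤ (u + 1) ^ 6` and `log 2 ≥ 1 / 2` one gets `L ≤ 12 * log (u +
1)`. Using `u + 1` makes this valid for `u = 1` as well. -/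
theorem cost_le {u L : ℕ} (hu : 0 < u) (hL : 2 ^ L ≤ 18 * u) :
    ((2 ^ L * L * L * L * 6000 : ℕ) : ℝ) ≤
      6000 * 18 * 12 ^ 3 * ((u : ℝ) * Real.log ((u : ℝ) + 1) ^ 3) := by
  have hu1 : (1 : ℝ) ≤ u := by exact_mod_cast hu
  have h2 : (2 : ℝ) ^ L ≤ 18 * u := by exact_mod_cast hL
  have h3 : (2 : ℝ) ^ L ≤ (u + 1) ^ 6 := by
    calc (2 : ℝ) ^ L ≤ 2 ^ 5 * (u + 1) := by linarith
      _ ≤ (u + 1) ^ 5 * (u + 1) := by gcongr; linarith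
      _ = _ := by ring
  have h4 := Real.log_le_log (by positivity) h3
  rw [Real.log_pow, Real.log_pow] at h4
  have h5 := Real.log_two_gt_d9
  have h6 : (L : ℝ) ≤ 12 * Real.log (u + 1) := by
    have : (L : ℝ) * (1 / 2) ≤ L * Real.log 2 := by gcongr; linarith
    push_cast at h4
    linarith
  push_cast
  calc (2 : ℝ) ^ L * L * L * L * 6000 = 2 ^ L * (L : ℝ) ^ 3 * 6000 := by ring
    _ ≤ (18 * u) * (12 * Real.log (u + 1)) ^ 3 * 6000 := by gcongr
    _ = _ := by ring

/-- Since the logarithm `l` is at least `1`, `5 + (l + 1) ≤ 7 * l`; the factor `2 ^ 5` absorbs the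
`18`. -/
theorem two_pow_le_of_log {u t L : ℕ} (hu : 0 < u) (hL : 2 ^ L ≤ 18 * u) :
    2 ^ L ≤ 2 ^ (7 * Nat.log 2 (u + t + 2)) ∧ t < 2 ^ (7 * Nat.log 2 (u + t + 2)) ∧
      1 ≤ Nat.log 2 (u + t + 2) := by
  have h1 : 1 ≤ Nat.log 2 (u + t + 2) := Nat.log_pos one_lt_two (by omega)
  have h2 : u + t + 2 < 2 ^ (Nat.log 2 (u + t + 2) + 1) := Nat.lt_pow_succ_log_self one_lt_two _
  have h3 : 2 ^ 5 * 2 ^ (Nat.log 2 (u + t + 2) + 1) ≤ 2 ^ (7 * Nat.log 2 (u + t + 2)) := by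
    rw [← pow_add]
    exact Nat.pow_le_pow_right two_pos (by omega)
  refine ⟨?_, ?_, h1⟩ <;> omega

theorem mainTheorem4 :
    ∃ (P : WordRAM.Prog) (c : ℕ) (C : ℝ),
      ∀ (V : Finset ℕ) (hV : V.Nonempty), (∀ x ∈ V, 0 < x) →
      ∀ (t : ℕ) (v : List ℕ), v.Nodup → v.toFinset = V →
      ∀ w : ℕ, c * Nat.log 2 (V.max' hV + t + 2) ≤ w →
        ∃ (k : ℕ) (τ : WordRAM.State),
          WordRAM.Exec w P (WordRAM.input v t) k τ ∧
          WordRAM.output τ = minCoins V t ∧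
          (k : ℝ) ≤ C * ((V.max' hV : ℝ) * Real.log ((V.max' hV : ℝ) + 1) ^ 3) := by
  -- The word length constant is `1400 = 7 * 200`: `2 ^ L` needs at most `7` logarithms of bits and
  -- `Wide` asks for its power `200`. In the time constant, `18` comes from `2 ^ L ≤ 18 * u` and `12
  -- ^ 3` from the three factors `L`.
  refine ⟨.minCoins, 1400, 6000 * 18 * 12 ^ 3, ?_⟩
  rintro V hV hpos t v hnd rfl w hw
  generalize hu : v.toFinset.max' hV = u at *
  have huV : u ∈ v.toFinset := hu ▸ Finset.max'_mem _ _
  have hle : ∀ x ∈ v.toFinset, x ≤ u := fun x hx => hu ▸ Finset.le_max' _ x hx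
  have hu0 : 0 < u := hpos u huV
  have hn : v.length ≤ u := by
    rw [← List.toFinset_card_of_nodup hnd]
    calc v.toFinset.card ≤ (Finset.Icc 1 u).card := Finset.card_le_card fun x hx =>
          Finset.mem_Icc.2 ⟨hpos x hx, hle x hx⟩
      _ = u := by simp
  have hlo : 9 * u < 2 ^ Nat.clog 2 (9 * u + 1) := Nat.le_pow_clog one_lt_two _
  have hhi := pow_clog_le hu0
  have hmin : ∀ i < Nat.clog 2 (9 * u + 1), 2 ^ i ≤ 9 * u :=
    fun i hi => Nat.lt_succ_iff.1 (Nat.pow_lt_of_lt_clog hi)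
  generalize Nat.clog 2 (9 * u + 1) = L at *
  obtain ⟨hN, ht, hl⟩ := two_pow_le_of_log (t := t) hu0 hhi
  have hW : WordRAM.Wide w L :=
    { four_le := by
        by_contra h
        have : 2 ^ L ≤ 2 ^ 3 := Nat.pow_le_pow_right two_pos (by omega)
        omega
      pow_le := by
        calc (2 ^ L) ^ 200 ≤ (2 ^ (7 * Nat.log 2 (u + t + 2))) ^ 200 := Nat.pow_le_pow_left hN _
          _ = 2 ^ (1400 * Nat.log 2 (u + t + 2)) := by rw [← pow_mul]; congr 1; ring
          _ ≤ 2 ^ w := Nat.pow_le_pow_right two_pos hw }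
  -- Needed for the final addition: the number of stripped coins is at most `t` and the search
  -- result is below `2 ^ L`.
  have htw : t + 2 ^ L < 2 ^ w := by
    have h1 : 2 * 2 ^ (7 * Nat.log 2 (u + t + 2)) ≤ 2 ^ w := by
      rw [← pow_succ']
      exact Nat.pow_le_pow_right two_pos (by omega)
    omega
  obtain ⟨D, hD, hDm, hout⟩ := exists_threshold (t := t) huV hle hu0 hlo
  obtain ⟨k, τ, hk, hkK, hτ⟩ := WordRAM.runs_minCoins hW (List.mem_toFinset.1 huV)
    (fun x hx => ⟨hpos x (List.mem_toFinset.2 hx), hle x (List.mem_toFinset.2 hx)⟩) hn hlo hmin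
    htw hD hDm
  exact ⟨k, τ, hk, hτ.trans hout, (Nat.cast_le.2 hkK).trans (cost_le hu0 hhi)⟩
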